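/- **Setting.** An instance of the connected $k$-clustering problem with disjoint clusters consists of a set $V$ of $n$ points, a metric $\mathrm{dist}: V\times V\to\mathbb{R}$, an undirected unweighted connectivity graph $G=(V,E)$ and a number $k$ with $1\le k\le n$. A feasible solution is a partition of $V$ into $k$ pairwise disjoint nonempty clusters $C_1,\dots,C_k$ such that every $C_i$ induces a connected subgraph of $G$. In the connected $k$-center problem a solution also contains centers $c_1,\dots,c_k$ corresponding to the clusters, and the cost is $\max_{i}\max_{x\in C_i}\mathrm{dist}(x,c_i)$; in the connected $k$-diameter problem the cost is $\max_i\max_{x,y\in C_i}\mathrm{dist}(x,y)$. In the $k$-center problem the algorithms output centers $c_i\in C_i$, and are compared with the optimum over all choices of centers $c_i\in V$. An $\alpha$-approximation algorithm is an algorithm that halts on every instance after a number of steps that is polynomial in the size of the input and that outputs, whenever a feasible solution exists, a feasible solution of cost at most $\alpha$ times the minimum cost. Algorithms are programs of a random access machine whose memory consists of cells for natural numbers and cells for real numbers; at unit cost it can copy, add, subtract and compare numbers and address memory indirectly, and it has no real constants. The input consists of $n$, $k$, the adjacency matrix of $G$ and the matrix of distances and, in part 3 below, also of $d$ and the coordinates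 of the points. The *doubling constant* of a metric space $M=(X,\mathrm{dist})$ is the smallest number $m$ such that for all $x\in X$ and $r>0$ the closed ball of radius $r$ around $x$ is covered by at most $m$ closed balls of radius $r/2$ with centers in $X$; the *doubling dimension* of $M$ is $\dim(M)=\lceil\log_2 m\rceil$. **Theorem.** For each of the two problems, connected $k$-center with disjoint clusters and connected $k$-diameter with disjoint clusters, and for arbitrary connectivity graphs, there is an absolute constant $C$ such that: 1. for general metrics there is an approximation algorithm with approximation factor $C(1+\log k)^2$, which is $O(\log^2 k)$ for $k\ge 2$, and running time polynomial in $n$; 2. there is an approximation algorithm with approximation factor $C\cdot 2^{3\dim(M)}$, where $\dim(M)$ is the doubling dimension of the input metric $M=(V,\mathrm{dist})$, and running time polynomial in $n$ (the algorithm and the polynomial do not depend on $\dim(M)$); 3. there is an approximation algorithm with approximation factor $C\cdot d^{2+1/p}$ for all instances in which the points lie in $\mathbb{R}^d$, $d\ge 1$, and $\mathrm{dist}$ is the $L_p$-metric for some $p\in[1,\infty]$ (with $1/\infty=0$); its running time is polynomial in $n+d$ (the algorithm, the polynomial and $C$ do not depend on $p$ or $d$). -/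

import Mathlib

namespace ConnectedClustering

/-! ### Clusterings, objectives, doubling dimension -/

/-- `C 0, …, C (k-1)` is a partition of the vertex set into `k` pairwise disjoint clusters, each of
which induces a connected (in particular nonempty) subgraph of the connectivity graph `G`. -/
structure IsDisjointClustering {V : Type*} (G : SimpleGraph V) {k : ℕ} (C : Fin k → Set V) :
    Prop where
  cover : ∀ v, ∃ i, v ∈ C i
  disjoint : ∀ i j, i ≠ j → Disjoint (C i) (C j)
  connected : ∀ i, (G.induce (C i)).Connected

/-- The maximum radius `max_{i, x ∈ C i} d (x, c i)`. -/
noncomputable def maxRadius {V : Type*} (d : V → V → ℝ) {k : ℕ} (C : Fin k → Set V)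
    (c : Fin k → V) : ℝ :=
  ⨆ q : {q : Fin k × V // q.2 ∈ C q.1}, d q.1.2 (c q.1.1)

/-- The maximum diameter `max_i max_{x, y ∈ C i} d (x, y)`. -/
noncomputable def maxDiameter {V : Type*} (d : V → V → ℝ) {k : ℕ} (C : Fin k → Set V) : ℝ :=
  ⨆ q : {q : Fin k × V × V // q.2.1 ∈ C q.1 ∧ q.2.2 ∈ C q.1}, d q.1.2.1 q.1.2.2

/-- The smallest `m` such that every closed ball of every radius `r > 0` is covered by at most `m`
closed balls of radius `r / 2`. -/
noncomputable def doublingConstant {V : Type*} (d : V → V → ℝ) : ℕ :=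
  sInf {m : ℕ | ∀ x : V, ∀ r : ℝ, 0 < r → ∃ Y : Finset V, Y.card ≤ m ∧
    {y | d x y ≤ r} ⊆ ⋃ z ∈ Y, {y | d z y ≤ r / 2}}

/-- `⌈log₂ (doubling constant)⌉`. -/
noncomputable def doublingDim {V : Type*} (d : V → V → ℝ) : ℕ :=
  Nat.clog 2 (doublingConstant d)

/-- An instance of a connected `k`-clustering problem with `n` points: a connectivity graph, a
metric and a number `k` of clusters. -/
structure Instance (n : ℕ) where
  graph : SimpleGraph (Fin n)
  dist : Fin n → Fin n → ℝ
  dist_eq_zero : ∀ u v, dist u v = 0 ↔ u = v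
  dist_comm : ∀ u v, dist u v = dist v u
  dist_triangle : ∀ u v w, dist u w ≤ dist u v + dist v w
  k : ℕ
  one_le_k : 1 ≤ k
  k_le_n : k ≤ n

/-- There is some partition into `k` connected clusters. -/
def Instance.Feasible {n : ℕ} (I : Instance n) : Prop :=
  ∃ C : Fin I.k → Set (Fin n), IsDisjointClustering I.graph C

/-! ### The machine model

A random access machine with structured control flow. Its memory consists of two-dimensional arrays
of natural numbers and two-dimensional arrays of real numbers, addressed by (computed) natural
numbers. Every elementary operation costs one step. The only arithmetic operations are addition and
subtraction, and a program contains no real constants; reals can influence the control flow only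
through comparisons. -/

/-- Memory contents: `nat a i j` and `real a i j` are the cells `(i, j)` of the `a`-th array of
naturals and of the `a`-th array of reals. -/
structure Memory where
  nat : ℕ → ℕ → ℕ → ℕ
  real : ℕ → ℕ → ℕ → ℝ

/-- Expressions over the naturals (`sub` is truncated subtraction). -/
inductive NatExp where
  | lit (m : ℕ)
  | read (a : ℕ) (i j : NatExp)
  | add (e f : NatExp)
  | sub (e f : NatExp)

/-- Expressions over the reals. -/
inductive RealExp where
  | read (a : ℕ) (i j : NatExp)
  | add (e f : RealExp)
  | sub (e f : RealExp)

/-- Tests. -/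
inductive Test where
  | natLE (e f : NatExp)
  | realLE (e f : RealExp)
  | not (b : Test)
  | and (b b' : Test)

/-- Programs. -/
inductive Program where
  | skip
  | writeNat (a : ℕ) (i j e : NatExp)
  | writeReal (a : ℕ) (i j : NatExp) (e : RealExp)
  | seq (p q : Program)
  | ite (b : Test) (p q : Program)
  | while (b : Test) (p : Program)

def NatExp.eval (s : Memory) : NatExp → ℕ
  | lit m => m
  | read a i j => s.nat a (i.eval s) (j.eval s)
  | add e f => e.eval s + f.eval s
  | sub e f => e.eval s - f.eval s

/-- The number of elementary operations in the evaluation of an expression. -/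
def NatExp.cost : NatExp → ℕ
  | lit _ => 1
  | read _ i j => i.cost + j.cost + 1
  | add e f => e.cost + f.cost + 1
  | sub e f => e.cost + f.cost + 1

def RealExp.eval (s : Memory) : RealExp → ℝ
  | read a i j => s.real a (i.eval s) (j.eval s)
  | add e f => e.eval s + f.eval s
  | sub e f => e.eval s - f.eval s

def RealExp.cost : RealExp → ℕ
  | read _ i j => i.cost + j.cost + 1
  | add e f => e.cost + f.cost + 1
  | sub e f => e.cost + f.cost + 1

def Test.Holds (s : Memory) : Test → Prop
  | natLE e f => e.eval s ≤ f.eval s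
  | realLE e f => e.eval s ≤ f.eval s
  | not b => ¬ b.Holds s
  | and b b' => b.Holds s ∧ b'.Holds s

def Test.cost : Test → ℕ
  | natLE e f => e.cost + f.cost + 1
  | realLE e f => e.cost + f.cost + 1
  | not b => b.cost + 1
  | and b b' => b.cost + b'.cost + 1

def Memory.writeNat (s : Memory) (a i j m : ℕ) : Memory :=
  { s with nat := fun a' i' j' => if a' = a ∧ i' = i ∧ j' = j then m else s.nat a' i' j' }

noncomputable def Memory.writeReal (s : Memory) (a i j : ℕ) (x : ℝ) : Memory :=
  { s with real := fun a' i' j' => if a' = a ∧ i' = i ∧ j' = j then x else s.real a' i' j' }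

/-- `Exec p s s' t`: started in memory `s`, the program `p` halts after exactly `t` steps with
memory `s'`. -/
inductive Exec : Program → Memory → Memory → ℕ → Prop
  | skip (s) : Exec .skip s s 1
  | writeNat (s a i j e) :
      Exec (.writeNat a i j e) s (s.writeNat a (i.eval s) (j.eval s) (e.eval s))
        (i.cost + j.cost + e.cost + 1)
  | writeReal (s a i j e) :
      Exec (.writeReal a i j e) s (s.writeReal a (i.eval s) (j.eval s) (e.eval s))
        (i.cost + j.cost + e.cost + 1)
  | seq {p q s s' s'' t t'} :
      Exec p s s' t → Exec q s' s'' t' → Exec (.seq p q) s s'' (t + t')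
  | ite_true {b p q s s' t} :
      b.Holds s → Exec p s s' t → Exec (.ite b p q) s s' (b.cost + 1 + t)
  | ite_false {b p q s s' t} :
      ¬ b.Holds s → Exec q s s' t → Exec (.ite b p q) s s' (b.cost + 1 + t)
  | while_true {b p s s' s'' t t'} :
      b.Holds s → Exec p s s' t → Exec (.while b p) s' s'' t' →
        Exec (.while b p) s s'' (b.cost + 1 + t + t')
  | while_false {b p s} :
      ¬ b.Holds s → Exec (.while b p) s s (b.cost + 1)

/-- Programs are deterministic. -/
theorem Exec.deterministic {p : Program} {s s₁ s₂ : Memory} {t₁ t₂ : ℕ}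
    (h₁ : Exec p s s₁ t₁) (h₂ : Exec p s s₂ t₂) : s₁ = s₂ ∧ t₁ = t₂ := by
  induction h₁ generalizing s₂ t₂ with
  | skip s => cases h₂; exact ⟨rfl, rfl⟩
  | writeNat => cases h₂; exact ⟨rfl, rfl⟩
  | writeReal => cases h₂; exact ⟨rfl, rfl⟩
  | seq _ _ ih ih' =>
    cases h₂ with
    | seq k k' =>
      obtain ⟨rfl, rfl⟩ := ih k
      obtain ⟨rfl, rfl⟩ := ih' k'
      exact ⟨rfl, rfl⟩
  | ite_true hb _ ih =>
    cases h₂ with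
    | ite_true _ k => obtain ⟨rfl, rfl⟩ := ih k; exact ⟨rfl, rfl⟩
    | ite_false hb' _ => exact absurd hb hb'
  | ite_false hb _ ih =>
    cases h₂ with
    | ite_true hb' _ => exact absurd hb' hb
    | ite_false _ k => obtain ⟨rfl, rfl⟩ := ih k; exact ⟨rfl, rfl⟩
  | while_true hb _ _ ih ih' =>
    cases h₂ with
    | while_true _ k k' =>
      obtain ⟨rfl, rfl⟩ := ih k
      obtain ⟨rfl, rfl⟩ := ih' k'
      exact ⟨rfl, rfl⟩
    | while_false hb' => exact absurd hb hb'
  | while_false hb =>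
    cases h₂ with
    | while_true hb' _ _ => exact absurd hb' hb
    | while_false _ => exact ⟨rfl, rfl⟩

/-! ### Input, output and approximation guarantee -/

open Classical in
/-- The initial memory for an instance whose points carry coordinate vectors `x v ∈ ℝ^m`.
Array `0` of naturals holds `n`, `k`, `m` in row `0`, array `1` of naturals the adjacency matrix of
the connectivity graph, array `0` of reals the distance matrix, array `1` of reals the coordinates.
All other cells are `0`. -/
noncomputable def Instance.inputWithCoordinates {n : ℕ} (I : Instance n) {m : ℕ}
    (x : Fin n → Fin m → ℝ) : Memory where
  nat a i j :=
    match a, i, j with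
    | 0, 0, 0 => n
    | 0, 0, 1 => I.k
    | 0, 0, 2 => m
    | 1, i, j => if ∃ (hi : i < n) (hj : j < n), I.graph.Adj ⟨i, hi⟩ ⟨j, hj⟩ then 1 else 0
    | _, _, _ => 0
  real a i j :=
    match a with
    | 0 => if h : i < n ∧ j < n then I.dist ⟨i, h.1⟩ ⟨j, h.2⟩ else 0
    | 1 => if h : i < n ∧ j < m then x ⟨i, h.1⟩ ⟨j, h.2⟩ else 0
    | _ => 0

/-- The initial memory for an instance with a general metric: no coordinates. -/
noncomputable def Instance.input {n : ℕ} (I : Instance n) : Memory :=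
  I.inputWithCoordinates (m := 0) (fun _ => Fin.elim0)

/-- Output convention: array `2` of naturals holds, in its cell `(v, 0)`, the index of the cluster
of the point `v`. -/
def Memory.clusters (s : Memory) (n k : ℕ) : Fin k → Set (Fin n) :=
  fun i => {v | s.nat 2 v 0 = i}

inductive Objective where
  | center
  | diameter

/-- The final memory `s` holds a solution whose cost is at most `α` times the cost of every solution
with disjoint clusters. For the `k`-center problem, array `3` of naturals holds, in its cell
`(i, 0)`, the center of the `i`-th cluster, which has to lie in that cluster; the solutions it is
compared with may use any points as centers. -/
def Instance.IsApproxSolution {n : ℕ} (I : Instance n) (α : ℝ) (s : Memory) : Objective → Prop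
  | .center =>
      IsDisjointClustering I.graph (s.clusters n I.k) ∧
      ∃ c : Fin I.k → Fin n,
        (∀ i : Fin I.k, s.nat 3 i 0 = c i) ∧ (∀ i, c i ∈ s.clusters n I.k i) ∧
        ∀ (C' : Fin I.k → Set (Fin n)) (c' : Fin I.k → Fin n), IsDisjointClustering I.graph C' →
          maxRadius I.dist (s.clusters n I.k) c ≤ α * maxRadius I.dist C' c'
  | .diameter =>
      IsDisjointClustering I.graph (s.clusters n I.k) ∧
      ∀ C' : Fin I.k → Set (Fin n), IsDisjointClustering I.graph C' →
        maxDiameter I.dist (s.clusters n I.k) ≤ α * maxDiameter I.dist C'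

/-- Started in memory `s₀`, the program `p` halts within `T` steps and, if `I` has a feasible
solution, outputs an `α`-approximate one. -/
def Instance.ApproximatedBy {n : ℕ} (I : Instance n) (obj : Objective) (α : ℝ) (p : Program)
    (s₀ : Memory) (T : ℕ) : Prop :=
  ∃ (s : Memory) (t : ℕ), Exec p s₀ s t ∧ t ≤ T ∧ (I.Feasible → I.IsApproxSolution α s obj)

end ConnectedClustering

/-!
One algorithm serves both objectives. Fix a distance `D` that occurs in the instance. The connected
ball of a point `c` consists of the points that `c` reaches in the connectivity graph inside the
ball of radius `D` around `c`, and centers are chosen greedily: a point becomes a center unless it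
lies in the connected ball of an earlier center. Two points of one connected cluster of diameter at
most `D` lie in the connected balls of each other, so each cluster of a feasible solution of
diameter at most `D` contains at most one center. Hence the smallest distance `D` that leads to at
most `k` centers is a lower bound for the optimal diameter, and at most twice the optimal radius
(`threshold_run`).

The connected balls of the centers cover all points, but they overlap. They are made disjoint with
the help of a colouring of the centers with `l` colours, where centers of the same colour that are
linked by a chain of centers of this colour, with steps of length at most `2 * D`, have distance at
most `H`. The colours are treated one after another. Every center that is still unassigned seeds a
new cluster, and then clusters grow into the unassigned points along edges inside the connected
balls of the centers of the current colour. An overlap of two balls of the same colour is a step of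
length at most `2 * D` between their centers, so a cluster grows by at most `H + 2 * D` in each
round and has radius at most `l * (H + 2 * D)` in the end. To obtain exactly `k` clusters, at most
`n - k` points are attached to existing clusters in this way; once this budget is used up, all
points that are left become singletons, and the number of clusters is `k` (`merge_run`). The
approximation factor is therefore governed by `l * (H + 2 * D) / D`
(`approximatedBy_pipeline`), and the three parts of the theorem differ only in the colouring.

* In a general metric, balls of centers are carved out. The radius of a ball grows by `2 * D` until
  this no longer more than doubles the number of centers in it, which happens after at most `log₂ k` steps.
  The centers in the ball receive the current colour, those in the surrounding shell of width
  `2 * D` wait for a later colour. At least half of the centers is coloured each time, so that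
  `O(log k)` colours suffice, with `H = O(D log k)` (`colours_general`).
* In a doubling metric, every center belongs to a point of a `2 * D`-separated net, and the net is
  coloured first fit so that net points at distance at most `6 * D` receive different colours.
  There are at most `m ^ 3` such points for the doubling constant `m`, and a chain of centers of one
  colour never leaves the centers of a single net point, so that `H = 4 * D` (`colours_doubling`).
* For an `L_p`-metric, each coordinate axis is divided into consecutive blocks of length at most
  `2 * D`, numbered modulo `d + 1`. A center receives a residue that differs from the residues of
  all its `d` blocks. A chain of one colour avoids a residue in every coordinate and so stays
  within `d` consecutive blocks, whence `H = O(d ^ (1 + 1 / p) D)` with `d + 1` colours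
  (`colours_lp`).

The algorithms are written as programs with counting loops (`Code`), whose meaning is a function on
memories. They translate to machine programs, and the running time is at most the value at
`n + d + 1` of a polynomial that is read off from the program (`Code.exec_compile`).

The use of the memory is as follows. Arrays of naturals: `4` connected balls, `5` flags of the
centers, `6` the number of centers, `7` and `28` flags, `8` labels of the points, `9` number of
clusters, `10` colours, `11` budget, `12` and `13` numbers of candidates in two balls, `14`
candidates of the carving, `15` owners in the net, `16` least unmarked number, `17` marks, `18`
colours of the net, `19` residue, `20` to `26` loop counters, `29` blocks, `30` residues of the
blocks. Real variables: `2` the radius `D`,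
`3` the best threshold, `4` the carving radius, `5` the beginning of a block.
-/

namespace ConnectedClustering

/-! ### Loop programs -/

/-- The admissible numbers of iterations of a loop: the number `n` of points, the number `m` of
coordinates, or `n + m + 1`. -/
inductive Bound where
  | pts
  | dim
  | all

/-- The expression that evaluates a bound from the input cells of the machine. -/
def Bound.exp : Bound → NatExp
  | pts => .read 0 (.lit 0) (.lit 0)
  | dim => .read 0 (.lit 0) (.lit 2)
  | all => .add (.add (.read 0 (.lit 0) (.lit 0)) (.read 0 (.lit 0) (.lit 2))) (.lit 1)

/-- Programs whose only loops are counting loops: `loop a N p` executes `p` for the values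
`0, …, N - 1` of the counter, which is the cell `(0, 0)` of the `a`-th array of naturals. -/
inductive Code where
  | skip
  | nat (a : ℕ) (i j e : NatExp)
  | real (a : ℕ) (i j : NatExp) (e : RealExp)
  | seq (p q : Code)
  | ite (b : Test) (p q : Code)
  | loop (a : ℕ) (N : Bound) (p : Code)

namespace Code

/-- Sequential composition of a list of programs. -/
def block : List Code → Code
  | [] => skip
  | p :: ps => seq p (block ps)

/-- One-armed conditional. -/
def guard (b : Test) (p : Code) : Code := ite b p skip

/-- The iteration `f (N - 1) ∘ ⋯ ∘ f 0`. -/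
def iter {α : Type*} (f : ℕ → α → α) : ℕ → α → α
  | 0, s => s
  | N + 1, s => f N (iter f N s)

open Classical in
/-- The function on memories that a loop program computes. -/
noncomputable def run : Code → Memory → Memory
  | skip, s => s
  | nat a i j e, s => s.writeNat a (i.eval s) (j.eval s) (e.eval s)
  | real a i j e, s => s.writeReal a (i.eval s) (j.eval s) (e.eval s)
  | seq p q, s => q.run (p.run s)
  | ite b p q, s => if b.Holds s then p.run s else q.run s
  | loop a N p, s =>
      iter (fun i s' => (p.run s').writeNat a 0 0 (i + 1)) (N.exp.eval s) (s.writeNat a 0 0 0)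

/-- The arrays of naturals that a program may change. -/
def natWrites : Code → List ℕ
  | skip => []
  | nat a _ _ _ => [a]
  | real _ _ _ _ => []
  | seq p q => p.natWrites ++ q.natWrites
  | ite _ p q => p.natWrites ++ q.natWrites
  | loop a _ p => a :: p.natWrites

/-- The arrays of reals that a program may change. -/
def realWrites : Code → List ℕ
  | skip => []
  | nat _ _ _ _ => []
  | real a _ _ _ => [a]
  | seq p q => p.realWrites ++ q.realWrites
  | ite _ p q => p.realWrites ++ q.realWrites
  | loop _ _ p => p.realWrites

/-- No loop body changes its own counter, and the sizes in array `0` are never changed. -/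
def ok : Code → Bool
  | skip => true
  | nat a _ _ _ => a != 0
  | real _ _ _ _ => true
  | seq p q => p.ok && q.ok
  | ite _ p q => p.ok && q.ok
  | loop a _ p => a != 0 && !(p.natWrites.contains a) && p.ok

/-- The machine program of a loop program. -/
def compile : Code → Program
  | skip => .skip
  | nat a i j e => .writeNat a i j e
  | real a i j e => .writeReal a i j e
  | seq p q => .seq p.compile q.compile
  | ite b p q => .ite b p.compile q.compile
  | loop a N p =>
      .seq (.writeNat a (.lit 0) (.lit 0) (.lit 0))
        (.while (.natLE (.add (.read a (.lit 0) (.lit 0)) (.lit 1)) N.exp)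
          (.seq p.compile (.writeNat a (.lit 0) (.lit 0)
            (.add (.read a (.lit 0) (.lit 0)) (.lit 1)))))

/-- A bound on the running time of a program in terms of `n + m + 1`, which bounds the number of
iterations of every loop. The constants bound the cost of the loop control. -/
noncomputable def timePoly : Code → Polynomial ℕ
  | skip => 1
  | nat _ i j e => (i.cost + j.cost + e.cost + 1 : ℕ)
  | real _ i j e => (i.cost + j.cost + e.cost + 1 : ℕ)
  | seq p q => p.timePoly + q.timePoly
  | ite b p q => (b.cost + 1 : ℕ) + (p.timePoly + q.timePoly)
  | loop _ _ p => 30 + Polynomial.X * (p.timePoly + 30)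

theorem nat_run {p : Code} {a : ℕ} (h : a ∉ p.natWrites) (s : Memory) :
    (p.run s).nat a = s.nat a := by
  induction p generalizing s with
  | skip => rfl
  | nat b i j e =>
    have hab : a ≠ b := by simpa [natWrites] using h
    funext i' j'
    simp [run, Memory.writeNat, hab]
  | real b i j e => rfl
  | seq p q ihp ihq =>
    simp only [natWrites, List.mem_append, not_or] at h
    simp only [run, ihq h.2, ihp h.1]
  | ite b p q ihp ihq =>
    simp only [natWrites, List.mem_append, not_or] at h
    simp only [run]
    split_ifs
    exacts [ihp h.1 s, ihq h.2 s]
  | loop b N p ih =>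
    simp only [natWrites, List.mem_cons, not_or] at h
    have hw : ∀ (s : Memory) m, (s.writeNat b 0 0 m).nat a = s.nat a := fun s m => by
      funext i' j'
      simp [Memory.writeNat, h.1]
    simp only [run]
    generalize N.exp.eval s = M
    induction M with
    | zero => exact hw s 0
    | succ M ihM => simp only [iter, hw, ih h.2, ihM]

theorem real_run {p : Code} {a : ℕ} (h : a ∉ p.realWrites) (s : Memory) :
    (p.run s).real a = s.real a := by
  induction p generalizing s with
  | skip => rfl
  | nat b i j e => rfl
  | real b i j e =>
    have hab : a ≠ b := by simpa [realWrites] using h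
    funext i' j'
    simp [run, Memory.writeReal, hab]
  | seq p q ihp ihq =>
    simp only [realWrites, List.mem_append, not_or] at h
    simp only [run, ihq h.2, ihp h.1]
  | ite b p q ihp ihq =>
    simp only [realWrites, List.mem_append, not_or] at h
    simp only [run]
    split_ifs
    exacts [ihp h.1 s, ihq h.2 s]
  | loop b N p ih =>
    simp only [realWrites] at h
    have hw : ∀ (s : Memory) m, (s.writeNat b 0 0 m).real a = s.real a := fun s m => rfl
    simp only [run]
    generalize N.exp.eval s = M
    induction M with
    | zero => exact hw s 0
    | succ M ihM => simp only [iter, hw, ih h, ihM]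

theorem natWrites_ne_zero {p : Code} (h : p.ok) : 0 ∉ p.natWrites := by
  induction p with
  | skip => simp [natWrites]
  | nat a i j e =>
    have ha : a ≠ 0 := by simpa [ok] using h
    simpa [natWrites] using ha.symm
  | real a i j e => simp [natWrites]
  | seq p q ihp ihq =>
    simp only [ok, Bool.and_eq_true] at h
    simp [natWrites, ihp h.1, ihq h.2]
  | ite b p q ihp ihq =>
    simp only [ok, Bool.and_eq_true] at h
    simp [natWrites, ihp h.1, ihq h.2]
  | loop a N p ih =>
    simp only [ok, Bool.and_eq_true, bne_iff_ne] at h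
    simp [natWrites, ih h.2, h.1.1.symm]

theorem _root_.ConnectedClustering.Bound.eval_congr (N : Bound) {s s' : Memory}
    (h : s'.nat 0 = s.nat 0) : N.exp.eval s' = N.exp.eval s := by
  cases N <;> simp [Bound.exp, NatExp.eval, h]

theorem _root_.ConnectedClustering.Bound.eval_le (N : Bound) (s : Memory) :
    N.exp.eval s ≤ s.nat 0 0 0 + s.nat 0 0 2 + 1 := by
  cases N <;> simp [Bound.exp, NatExp.eval] <;> omega

theorem _root_.ConnectedClustering.Bound.cost_le (N : Bound) : N.exp.cost ≤ 9 := by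
  cases N <;> simp [Bound.exp, NatExp.cost]

/-- The machine program computes the function of the loop program within the time bound. -/
theorem exec_compile {p : Code} (h : p.ok) (s : Memory) :
    ∃ t, Exec p.compile s (p.run s) t ∧
      t ≤ p.timePoly.eval (s.nat 0 0 0 + s.nat 0 0 2 + 1) := by
  induction p generalizing s with
  | skip => exact ⟨_, .skip s, by simp [timePoly]⟩
  | nat a i j e => exact ⟨_, .writeNat s a i j e, by simp [timePoly]⟩
  | real a i j e => exact ⟨_, .writeReal s a i j e, by simp [timePoly]⟩
  | seq p q ihp ihq =>
    simp only [ok, Bool.and_eq_true] at h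
    obtain ⟨t, ht, hle⟩ := ihp h.1 s
    obtain ⟨t', ht', hle'⟩ := ihq h.2 (p.run s)
    rw [nat_run (natWrites_ne_zero h.1)] at hle'
    exact ⟨_, .seq ht ht', by simp only [timePoly, Polynomial.eval_add]; omega⟩
  | ite b p q ihp ihq =>
    simp only [ok, Bool.and_eq_true] at h
    obtain ⟨t, ht, hle⟩ := ihp h.1 s
    obtain ⟨t', ht', hle'⟩ := ihq h.2 s
    simp only [timePoly, Polynomial.eval_add, Polynomial.eval_natCast, run, compile]
    by_cases hb : b.Holds s
    · rw [if_pos hb]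
      exact ⟨_, .ite_true hb ht, by simp only [Nat.cast_id]; omega⟩
    · rw [if_neg hb]
      exact ⟨_, .ite_false hb ht', by simp only [Nat.cast_id]; omega⟩
  | loop a N p ih =>
    simp only [ok, Bool.and_eq_true, bne_iff_ne, Bool.not_eq_true', List.contains_eq_mem,
      decide_eq_false_iff_not] at h
    obtain ⟨⟨ha, hap⟩, hp⟩ := h
    set f : ℕ → Memory → Memory := fun i s' => (p.run s').writeNat a 0 0 (i + 1) with hf
    set s₀ := s.writeNat a 0 0 0 with hs₀
    set S := s.nat 0 0 0 + s.nat 0 0 2 + 1 with hS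
    set W : Program := (.while (.natLE (.add (.read a (.lit 0) (.lit 0)) (.lit 1)) N.exp)
          (.seq p.compile (.writeNat a (.lit 0) (.lit 0)
            (.add (.read a (.lit 0) (.lit 0)) (.lit 1))))) with hW
    have hz : ∀ i, (iter f i s₀).nat 0 = s.nat 0 := by
      intro i
      induction i with
      | zero => funext i' j'; simp [iter, hs₀, Memory.writeNat, ha.symm]
      | succ i ihi =>
        rw [← ihi, ← nat_run (natWrites_ne_zero hp) (iter f i s₀)]
        funext i' j'
        simp [iter, hf, Memory.writeNat, ha.symm]
    have hc : ∀ i, (iter f i s₀).nat a 0 0 = i := by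
      intro i
      cases i with
      | zero => simp [iter, hs₀, Memory.writeNat]
      | succ i => simp [iter, hf, Memory.writeNat]
    -- the loop, entered when `j` iterations are left
    have key : ∀ j, j ≤ N.exp.eval s → ∃ t,
        Exec W (iter f (N.exp.eval s - j) s₀) (iter f (N.exp.eval s) s₀) t ∧
          t ≤ 20 + j * (p.timePoly.eval S + 30) := by
      intro j
      have hcost := N.cost_le
      induction j with
      | zero =>
        intro _
        refine ⟨_, .while_false ?_, ?_⟩
        · simp only [Test.Holds, NatExp.eval, N.eval_congr (hz _), tsub_zero, hc]
          omega
        · simp only [Test.cost, NatExp.cost]; omega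
      | succ j ihj =>
        intro hj
        obtain ⟨t, ht, hle⟩ := ihj (by omega)
        obtain ⟨t', ht', hle'⟩ := ih hp (iter f (N.exp.eval s - (j + 1)) s₀)
        rw [hz] at hle'
        have hsucc : N.exp.eval s - j = N.exp.eval s - (j + 1) + 1 := by omega
        have hstep : iter f (N.exp.eval s - j) s₀ =
            (p.run (iter f (N.exp.eval s - (j + 1)) s₀)).writeNat a
              ((NatExp.lit 0).eval (p.run (iter f (N.exp.eval s - (j + 1)) s₀)))
              ((NatExp.lit 0).eval (p.run (iter f (N.exp.eval s - (j + 1)) s₀)))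
              ((NatExp.add (.read a (.lit 0) (.lit 0)) (.lit 1)).eval
                (p.run (iter f (N.exp.eval s - (j + 1)) s₀))) := by
          rw [hsucc]
          simp only [iter, NatExp.eval, nat_run hap, hc]
          rfl
        rw [hstep] at ht
        refine ⟨_, .while_true ?_ (.seq ht' (.writeNat _ _ _ _ _)) ht, ?_⟩
        · simp only [Test.Holds, NatExp.eval, N.eval_congr (hz _), hc]
          omega
        · simp only [Test.cost, NatExp.cost, add_mul]
          rw [← hS] at hle'
          omega
    obtain ⟨t, ht, hle⟩ := key _ le_rfl
    rw [Nat.sub_self] at ht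
    refine ⟨_, .seq (.writeNat _ _ _ _ _) ht, ?_⟩
    have hmul := Nat.mul_le_mul_right (p.timePoly.eval S + 30) (N.eval_le s)
    simp only [NatExp.cost, timePoly, Polynomial.eval_add, Polynomial.eval_mul, Polynomial.eval_X,
      Polynomial.eval_ofNat]
    rw [← hS] at hmul
    omega

end Code

namespace Code

/-! ### Reasoning about loop programs -/

/-- The memory `s` agrees with `s₀` on all arrays that `p` does not change. -/
structure Agree (p : Code) (s₀ s : Memory) : Prop where
  nat : ∀ a, a ∉ p.natWrites → s.nat a = s₀.nat a
  real : ∀ a, a ∉ p.realWrites → s.real a = s₀.real a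

/-- Invariant rule for loops. Invariants do not refer to the loop counter, hence `hc`. -/
theorem run_loop {a : ℕ} {N : Bound} {p : Code} {s₀ : Memory} {M : ℕ} (hok : (loop a N p).ok)
    (hM : N.exp.eval s₀ = M) (Inv : ℕ → Memory → Prop) (h0 : Inv 0 s₀)
    (hstep : ∀ i < M, ∀ s, Agree (loop a N p) s₀ s → s.nat a 0 0 = i → Inv i s →
      Inv (i + 1) (p.run s))
    (hc : ∀ i j s, Inv i s → Inv i (s.writeNat a 0 0 j) := by intro _ _ _ h; exact h) :
    Inv M ((loop a N p).run s₀) := by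
  have hap : a ∉ p.natWrites := by
    simp only [ok, Bool.and_eq_true, Bool.not_eq_true', List.contains_eq_mem,
      decide_eq_false_iff_not] at hok
    exact hok.1.2
  have key : ∀ j ≤ M, ∀ s, s = iter (fun i s' => (p.run s').writeNat a 0 0 (i + 1)) j
      (s₀.writeNat a 0 0 0) → Agree (loop a N p) s₀ s ∧ s.nat a 0 0 = j ∧ Inv j s := by
    intro j
    induction j with
    | zero =>
      rintro - s rfl
      refine ⟨⟨fun b hb => ?_, fun b _ => rfl⟩, by simp [iter, Memory.writeNat], hc _ _ _ h0⟩
      have : b ≠ a := fun h => hb (by simp [natWrites, h])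
      funext i j
      simp [iter, Memory.writeNat, this]
    | succ j ih =>
      rintro hj s rfl
      obtain ⟨hA, hn, hI⟩ := ih (by omega) _ rfl
      refine ⟨⟨fun b hb => ?_, fun b hb => ?_⟩, by simp [iter, Memory.writeNat],
        hc _ _ _ (hstep j (by omega) _ hA hn hI)⟩
      · have h1 : b ≠ a := fun h => hb (by simp [natWrites, h])
        have h2 : b ∉ p.natWrites := fun h => hb (by simp [natWrites, h])
        refine Eq.trans ?_ ((nat_run h2 _).trans (hA.nat b hb))
        funext i j
        simp [iter, Memory.writeNat, h1]
      · exact Eq.trans rfl ((real_run (p := p) hb _).trans (hA.real b hb))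
  obtain ⟨-, -, h⟩ := key M le_rfl _ rfl
  rw [run, hM]
  exact h

/-- Invariant rule for a loop over the points of `Fin n`. -/
theorem run_loop_fin {n : ℕ} {a : ℕ} {N : Bound} {p : Code} {s₀ : Memory}
    (hM : N.exp.eval s₀ = n) (Inv : ℕ → Memory → Prop) (h0 : Inv 0 s₀)
    (hstep : ∀ (i : Fin n) (s), Agree (loop a N p) s₀ s → s.nat a 0 0 = i → Inv i s →
      Inv (i + 1) (p.run s))
    (hok : (loop a N p).ok := by rfl)
    (hc : ∀ i j s, Inv i s → Inv i (s.writeNat a 0 0 j) := by intro _ _ _ h; exact h) :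
    Inv n ((loop a N p).run s₀) :=
  run_loop hok hM Inv h0 (fun i hi s hA hn hI => hstep ⟨i, hi⟩ s hA hn hI) hc

/-- Rule for a loop that establishes `Q i` in its `i`-th iteration and preserves it later on. -/
theorem run_loop_each {n : ℕ} {a : ℕ} {N : Bound} {p : Code} {s₀ : Memory}
    (hM : N.exp.eval s₀ = n) (Inv : Memory → Prop) (Q : Fin n → Memory → Prop) (h0 : Inv s₀)
    (hstep : ∀ (i : Fin n) (s), Agree (loop a N p) s₀ s → s.nat a 0 0 = i → Inv s →
      Inv (p.run s) ∧ Q i (p.run s) ∧ ∀ j, j < i → Q j s → Q j (p.run s))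
    (hok : (loop a N p).ok := by rfl)
    (hc : ∀ j s, Inv s → Inv (s.writeNat a 0 0 j) := by intro _ _ h; exact h)
    (hcQ : ∀ i j s, Q i s → Q i (s.writeNat a 0 0 j) := by intro _ _ _ h; exact h) :
    Inv ((loop a N p).run s₀) ∧ ∀ i, Q i ((loop a N p).run s₀) := by
  have := run_loop_fin hM (fun t s => Inv s ∧ ∀ i : Fin n, (i : ℕ) < t → Q i s)
    ⟨h0, fun i hi => absurd hi (by omega)⟩ (fun i s hA hn hI => ?_) hok
    (fun i j s h => ⟨hc _ _ h.1, fun i' hi' => hcQ _ _ _ (h.2 i' hi')⟩)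
  · exact ⟨this.1, fun i => this.2 i i.2⟩
  · obtain ⟨h1, h2, h3⟩ := hstep i s hA hn hI.1
    refine ⟨h1, fun i' hi' => ?_⟩
    rcases eq_or_ne i' i with rfl | hne
    · exact h2
    · have : (i' : ℕ) < i := by
        have := Fin.val_ne_of_ne hne
        omega
      exact h3 i' this (hI.2 i' this)

/-- `n` rounds of adding the successors of all elements reach everything that is reachable. -/
theorem reach_of_rounds {n : ℕ} (R : Fin n → Fin n → Prop) (X : ℕ → Set (Fin n))
    (hmono : ∀ t, X t ⊆ X (t + 1)) (hsucc : ∀ t, ∀ u ∈ X t, ∀ v, R u v → v ∈ X (t + 1))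
    {u v : Fin n} (hu : u ∈ X 0) (huv : Relation.ReflTransGen R u v) : v ∈ X n := by
  classical
  -- the smallest sequence with these properties
  let Y : ℕ → Finset (Fin n) := fun t =>
    Nat.rec (motive := fun _ => Finset (Fin n)) {u}
      (fun _ Z => Z ∪ (Finset.univ : Finset (Fin n)).filter fun y => ∃ x ∈ Z, R x y) t
  have hY : ∀ t, Y (t + 1) =
      Y t ∪ (Finset.univ : Finset (Fin n)).filter fun y => ∃ x ∈ Y t, R x y := fun _ => rfl
  have hYX : ∀ t, ∀ y ∈ Y t, y ∈ X t := by
    intro t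
    induction t with
    | zero => intro y hy; rw [Finset.mem_singleton.1 hy]; exact hu
    | succ t ih =>
      intro y hy
      rw [hY, Finset.mem_union, Finset.mem_filter] at hy
      rcases hy with hy | ⟨-, x, hx, hxy⟩
      · exact hmono t (ih y hy)
      · exact hsucc t x (ih x hx) y hxy
  have hgrow : ∀ t, t < (Y t).card ∨ ∀ x ∈ Y t, ∀ y, R x y → y ∈ Y t := by
    intro t
    induction t with
    | zero => left; simp [Y]
    | succ t ih =>
      by_cases hc : ∀ x ∈ Y t, ∀ y, R x y → y ∈ Y t
      · right
        have : Y (t + 1) = Y t := by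
          rw [hY, Finset.union_eq_left]
          intro y hy
          obtain ⟨-, x, hx, hxy⟩ := Finset.mem_filter.1 hy
          exact hc x hx y hxy
        rw [this]; exact hc
      · left
        have hlt := ih.resolve_right hc
        push Not at hc
        obtain ⟨x, hx, y, hxy, hy⟩ := hc
        have : (Y t).card < (Y (t + 1)).card := by
          refine Finset.card_lt_card ⟨?_, fun h => hy (h ?_)⟩
          · rw [hY]; exact Finset.subset_union_left
          · rw [hY]
            exact Finset.mem_union_right _ (Finset.mem_filter.2 ⟨Finset.mem_univ _, x, hx, hxy⟩)
        omega
  refine hYX n v ?_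
  have hclosed := (hgrow n).resolve_left (by
    have := Finset.card_le_univ (Y n)
    simp only [Fintype.card_fin] at this
    omega)
  have huY : u ∈ Y n := by
    have : ∀ t, u ∈ Y t := by
      intro t
      induction t with
      | zero => simp [Y]
      | succ t ih => rw [hY]; exact Finset.mem_union_left _ ih
    exact this n
  induction huv with
  | refl => exact huY
  | tail _ hbc ih => exact hclosed _ ih _ hbc

/-- The elements that are reachable from `u` in at most `t` steps of the relation `R`. -/
def within {n : ℕ} (R : Fin n → Fin n → Prop) (u : Fin n) : ℕ → Set (Fin n)
  | 0 => {u}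
  | t + 1 => within R u t ∪ {y | ∃ x ∈ within R u t, R x y}

theorem mem_within {n : ℕ} {R : Fin n → Fin n → Prop} {u v : Fin n}
    (huv : Relation.ReflTransGen R u v) : v ∈ within R u n :=
  reach_of_rounds R (within R u) (fun _ => Set.subset_union_left)
    (fun _ x hx _ hxy => Or.inr ⟨x, hx, hxy⟩) rfl huv

end Code

/-! ### Notation for programs -/

/-- The scalar variable `a`, stored in the cell `(0, 0)` of the `a`-th array of naturals. -/
def var (a : ℕ) : NatExp := .read a (.lit 0) (.lit 0)

/-- The entry `(i, 0)` of the `a`-th array of naturals. -/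
def entry (a : ℕ) (i : NatExp) : NatExp := .read a i (.lit 0)

/-- The real scalar variable `a`. -/
def rvar (a : ℕ) : RealExp := .read a (.lit 0) (.lit 0)

/-- Equality of naturals. -/
def Test.eq (e f : NatExp) : Test := .and (.natLE e f) (.natLE f e)

/-- Conjunction of a list of tests. -/
def Test.all : List Test → Test
  | [] => .natLE (.lit 0) (.lit 0)
  | b :: bs => .and b (Test.all bs)

@[simp] theorem Test.holds_eq {s : Memory} {e f : NatExp} :
    (Test.eq e f).Holds s ↔ e.eval s = f.eval s := by
  simp [Test.eq, Test.Holds, le_antisymm_iff]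

@[simp] theorem Test.holds_all_nil {s : Memory} : (Test.all []).Holds s ↔ True := by
  simp [Test.all, Test.Holds]

@[simp] theorem Test.holds_all_cons {s : Memory} {b : Test} {bs : List Test} :
    (Test.all (b :: bs)).Holds s ↔ b.Holds s ∧ (Test.all bs).Holds s := Iff.rfl

@[simp] theorem Test.holds_natLE {s : Memory} {e f : NatExp} :
    (Test.natLE e f).Holds s ↔ e.eval s ≤ f.eval s := Iff.rfl

@[simp] theorem Test.holds_realLE {s : Memory} {e f : RealExp} :
    (Test.realLE e f).Holds s ↔ e.eval s ≤ f.eval s := Iff.rfl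

@[simp] theorem Test.holds_not {s : Memory} {b : Test} : (Test.not b).Holds s ↔ ¬ b.Holds s :=
  Iff.rfl

@[simp] theorem eval_var {s : Memory} {a : ℕ} : (var a).eval s = s.nat a 0 0 := rfl

@[simp] theorem eval_entry {s : Memory} {a : ℕ} {i : NatExp} :
    (entry a i).eval s = s.nat a (i.eval s) 0 := rfl

@[simp] theorem eval_rvar {s : Memory} {a : ℕ} : (rvar a).eval s = s.real a 0 0 := rfl

@[simp] theorem Memory.nat_writeNat {s : Memory} {a i j m a' i' j' : ℕ} :
    (s.writeNat a i j m).nat a' i' j' = if a' = a ∧ i' = i ∧ j' = j then m else s.nat a' i' j' :=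
  rfl

@[simp] theorem Memory.real_writeNat {s : Memory} {a i j m : ℕ} :
    (s.writeNat a i j m).real = s.real := rfl

@[simp] theorem Memory.nat_writeReal {s : Memory} {a i j : ℕ} {x : ℝ} :
    (s.writeReal a i j x).nat = s.nat := rfl

@[simp] theorem Memory.real_writeReal {s : Memory} {a i j : ℕ} {x : ℝ} {a' i' j' : ℕ} :
    (s.writeReal a i j x).real a' i' j' =
      if a' = a ∧ i' = i ∧ j' = j then x else s.real a' i' j' :=
  rfl

attribute [simp] NatExp.eval RealExp.eval

namespace Code

@[simp] theorem run_block_nil {s : Memory} : (block []).run s = s := rfl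

@[simp] theorem run_block_cons {s : Memory} {p : Code} {ps : List Code} :
    (block (p :: ps)).run s = (block ps).run (p.run s) := rfl

@[simp] theorem run_nat {s : Memory} {a : ℕ} {i j e : NatExp} :
    (nat a i j e).run s = s.writeNat a (i.eval s) (j.eval s) (e.eval s) := rfl

@[simp] theorem run_real {s : Memory} {a : ℕ} {i j : NatExp} {e : RealExp} :
    (real a i j e).run s = s.writeReal a (i.eval s) (j.eval s) (e.eval s) := rfl

open Classical in
@[simp] theorem run_ite {s : Memory} {b : Test} {p q : Code} :
    (ite b p q).run s = if b.Holds s then p.run s else q.run s := by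
  simp only [run]

open Classical in
@[simp] theorem run_guard {s : Memory} {b : Test} {p : Code} :
    (guard b p).run s = if b.Holds s then p.run s else s := by
  simp only [guard, run]

/-- Assignment to a scalar variable. -/
def set (a : ℕ) (e : NatExp) : Code := nat a (.lit 0) (.lit 0) e

/-- Assignment to the entry `(i, 0)` of an array of naturals. -/
def setEntry (a : ℕ) (i e : NatExp) : Code := nat a i (.lit 0) e

@[simp] theorem run_set {s : Memory} {a : ℕ} {e : NatExp} :
    (set a e).run s = s.writeNat a 0 0 (e.eval s) := rfl

@[simp] theorem run_setEntry {s : Memory} {a : ℕ} {i e : NatExp} :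
    (setEntry a i e).run s = s.writeNat a (i.eval s) 0 (e.eval s) := rfl

end Code

/-! ### Connected balls and greedy centers -/

section

variable {n : ℕ} (I : Instance n)

/-- The points that are connected to `c` within the ball of radius `D` around `c`. -/
def Instance.ball (D : ℝ) (c : Fin n) : Set (Fin n) :=
  {v | Relation.ReflTransGen (fun u w => I.graph.Adj u w ∧ I.dist c w ≤ D) c v}

/-- The memory contains the instance `I` and the coordinates `x`. -/
structure Loaded {m : ℕ} (x : Fin n → Fin m → ℝ) (s : Memory) : Prop where
  size : s.nat 0 0 0 = n
  clusters : s.nat 0 0 1 = I.k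
  dims : s.nat 0 0 2 = m
  adj : ∀ u v : Fin n, s.nat 1 u v = 1 ↔ I.graph.Adj u v
  dist : ∀ u v : Fin n, s.real 0 u v = I.dist u v
  coord : ∀ (u : Fin n) (i : Fin m), s.real 1 u i = x u i

variable {I} {m : ℕ} {x : Fin n → Fin m → ℝ} {s : Memory}

theorem Loaded.pts (hs : Loaded I x s) : Bound.pts.exp.eval s = n := hs.size

theorem Loaded.dim (hs : Loaded I x s) : Bound.dim.exp.eval s = m := hs.dims

theorem Loaded.all (hs : Loaded I x s) : Bound.all.exp.eval s = n + m + 1 := by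
  simp [Bound.exp, hs.size, hs.dims]

/-- The program does not change the arrays that hold the input. -/
def Code.keepsInput (p : Code) : Bool :=
  p.natWrites.all (fun a => 1 < a) && p.realWrites.all (fun a => 1 < a)

theorem Loaded.agree {p : Code} {s' : Memory} (hs : Loaded I x s) (hA : p.Agree s s')
    (hp : p.keepsInput := by rfl) : Loaded I x s' := by
  simp only [Code.keepsInput, Bool.and_eq_true, List.all_eq_true, decide_eq_true_eq] at hp
  have hn : ∀ a < 2, s'.nat a = s.nat a := fun a ha =>
    hA.nat a fun h => by have := hp.1 a h; omega
  have hr : ∀ a < 2, s'.real a = s.real a := fun a ha =>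
    hA.real a fun h => by have := hp.2 a h; omega
  constructor
  · rw [hn 0 (by omega)]; exact hs.size
  · rw [hn 0 (by omega)]; exact hs.clusters
  · rw [hn 0 (by omega)]; exact hs.dims
  · rw [hn 1 (by omega)]; exact hs.adj
  · rw [hr 0 (by omega)]; exact hs.dist
  · rw [hr 1 (by omega)]; exact hs.coord

theorem Loaded.run {p : Code} (hs : Loaded I x s)
    (hp : p.keepsInput := by rfl) : Loaded I x (p.run s) :=
  hs.agree ⟨fun _ h => Code.nat_run h s, fun _ h => Code.real_run h s⟩ hp

end

namespace Code

/-- Adds all neighbours `v` of the point `u` in variable `21` that have distance at most `D` from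
the point `c` in variable `20` to the ball of `c`, if `u` belongs to it. The ball of `c` is stored
in row `c` of array `4`, the radius `D` in the real variable `2`. -/
def ballStep : Code :=
  loop 23 .pts (guard (Test.all [.eq (.read 4 (var 20) (var 21)) (.lit 1),
      .eq (.read 1 (var 21) (var 23)) (.lit 1),
      .realLE (.read 0 (var 20) (var 23)) (rvar 2)])
    (nat 4 (var 20) (var 23) (.lit 1)))

/-- Computes the connected balls of radius `D` around all points. -/
def balls : Code :=
  loop 20 .pts (block [
    loop 21 .pts (nat 4 (var 20) (var 21) (.lit 0)),
    nat 4 (var 20) (var 20) (.lit 1),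
    loop 22 .pts (loop 21 .pts ballStep)])

variable {n : ℕ} {I : Instance n} {m : ℕ} {x : Fin n → Fin m → ℝ} {s : Memory}

theorem ballStep_run (hs : Loaded I x s) (c u : Fin n) (hc : s.nat 20 0 0 = c)
    (hu : s.nat 21 0 0 = u) :
    (∀ c' : Fin n, c' ≠ c → ∀ v : Fin n, (ballStep.run s).nat 4 c' v = s.nat 4 c' v) ∧
    ∀ v : Fin n, (ballStep.run s).nat 4 c v = 1 ↔ s.nat 4 c v = 1 ∨
      s.nat 4 c u = 1 ∧ I.graph.Adj u v ∧ I.dist c v ≤ s.real 2 0 0 := by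
  have := run_loop_each (s₀ := s) (a := 23) (N := .pts)
    (p := guard (Test.all [.eq (.read 4 (var 20) (var 21)) (.lit 1),
      .eq (.read 1 (var 21) (var 23)) (.lit 1),
      .realLE (.read 0 (var 20) (var 23)) (rvar 2)])
    (nat 4 (var 20) (var 23) (.lit 1))) hs.pts
    (fun s' => (∀ c' : Fin n, c' ≠ c → ∀ v : Fin n, s'.nat 4 c' v = s.nat 4 c' v) ∧
      (∀ v : Fin n, s.nat 4 c v = 1 → s'.nat 4 c v = 1) ∧
      ∀ v : Fin n, s'.nat 4 c v = 1 → s.nat 4 c v = 1 ∨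
        s.nat 4 c u = 1 ∧ I.graph.Adj u v ∧ I.dist c v ≤ s.real 2 0 0)
    (fun v s' => s.nat 4 c u = 1 ∧ I.graph.Adj u v ∧ I.dist c v ≤ s.real 2 0 0 →
      s'.nat 4 c v = 1)
    ⟨fun _ _ _ => rfl, fun _ h => h, fun _ h => Or.inl h⟩ ?_
  · refine ⟨this.1.1, fun v => ⟨this.1.2.2 v, fun h => h.elim (this.1.2.1 v) (this.2 v)⟩⟩
  · intro v s' hA hv hI
    have hs' := hs.agree hA
    have hc' : s'.nat 20 0 0 = c := by rw [hA.nat 20 (by decide)]; exact hc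
    have hu' : s'.nat 21 0 0 = u := by rw [hA.nat 21 (by decide)]; exact hu
    have hD : s'.real 2 = s.real 2 := hA.real 2 (by decide)
    obtain ⟨h1, h2, h3⟩ := hI
    simp only [run_guard]
    split_ifs with h <;> simp only [Test.holds_all_cons, Test.holds_all_nil, Test.holds_eq,
      Test.holds_realLE, NatExp.eval, eval_var, RealExp.eval, eval_rvar, hc', hu', hv, hs'.adj,
      hs'.dist, hD, and_true] at h
    · simp only [run_nat, eval_var, NatExp.eval, hc', hv, Memory.nat_writeNat, true_and,
        Fin.val_inj]
      refine ⟨⟨fun c' hc' v' => ?_, fun v' hv' => ?_, fun v' hv' => ?_⟩, fun _ => ?_,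
        fun v' _ hv' hh => ?_⟩
      · simpa [hc'] using h1 c' hc' v'
      · simp [h2 v' hv']
      · by_cases hvv : v' = v
        · subst hvv
          rcases h3 u h.1 with hu | hu
          · exact Or.inr ⟨hu, h.2⟩
          · exact Or.inr ⟨hu.1, h.2⟩
        · simp only [hvv, if_false] at hv'
          exact h3 v' hv'
      · simp
      · simp [hv' hh]
    · exact ⟨⟨h1, h2, h3⟩, fun hh => absurd ⟨h2 u hh.1, hh.2⟩ h, fun _ _ h => h⟩

theorem balls_run (hs : Loaded I x s) (c v : Fin n) :
    (balls.run s).nat 4 c v = 1 ↔ v ∈ I.ball (s.real 2 0 0) c := by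
  set D := s.real 2 0 0 with hD
  refine (run_loop_each (n := n) (s₀ := s) hs.pts (fun _ => True)
    (fun c s' => ∀ v : Fin n, s'.nat 4 c v = 1 ↔ v ∈ I.ball D c) trivial ?_).2 c v
  intro c s₁ hA hc _
  have hs₁ := hs.agree hA
  have hD₁ : s₁.real 2 0 0 = D := by rw [hA.real 2 (by decide)]
  simp only [run_block_cons, run_block_nil, true_and]
  -- clearing the row
  obtain ⟨h2a, h2b⟩ := run_loop_each (s₀ := s₁) (a := 21) (N := .pts)
    (p := nat 4 (var 20) (var 21) (.lit 0)) hs₁.pts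
    (fun s' => ∀ c' : Fin n, c' ≠ c → ∀ v : Fin n, s'.nat 4 c' v = s₁.nat 4 c' v)
    (fun v s' => s'.nat 4 c v = 0) (fun _ _ _ => rfl) (by
      intro v s' hA hv hI
      have hc' : s'.nat 20 0 0 = c := by rw [hA.nat 20 (by decide)]; exact hc
      simp only [run_nat, eval_var, NatExp.eval, hc', hv, Memory.nat_writeNat, true_and,
        Fin.val_inj]
      refine ⟨fun c' hc' v' => ?_, by simp, fun v' _ h => by simp [h]⟩
      simpa [hc'] using hI c' hc' v')
  have hs₂ : Loaded I x ((loop 21 .pts (nat 4 (var 20) (var 21) (.lit 0))).run s₁) := hs₁.run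
  have hc₂ : ((loop 21 .pts (nat 4 (var 20) (var 21) (.lit 0))).run s₁).nat 20 0 0 = c := by
    rw [nat_run (by decide)]; exact hc
  have hD₂ : ((loop 21 .pts (nat 4 (var 20) (var 21) (.lit 0))).run s₁).real 2 0 0 = D := by
    rw [real_run (by decide)]; exact hD₁
  generalize (loop 21 .pts (nat 4 (var 20) (var 21) (.lit 0))).run s₁ = s₂ at *
  have hs₃ : Loaded I x ((nat 4 (var 20) (var 20) (.lit 1)).run s₂) := hs₂.run
  have h3a : ∀ c' : Fin n, c' ≠ c → ∀ v : Fin n,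
      ((nat 4 (var 20) (var 20) (.lit 1)).run s₂).nat 4 c' v = s₁.nat 4 c' v := by
    intro c' hc' v
    simpa [hc₂, Fin.val_inj, hc'] using h2a c' hc' v
  have h3b : ∀ v : Fin n, ((nat 4 (var 20) (var 20) (.lit 1)).run s₂).nat 4 c v = 1 ↔ v = c := by
    intro v
    simp [hc₂, Fin.val_inj, h2b]
  have hc₃ : ((nat 4 (var 20) (var 20) (.lit 1)).run s₂).nat 20 0 0 = c := by
    rw [nat_run (by decide)]; exact hc₂
  have hD₃ : ((nat 4 (var 20) (var 20) (.lit 1)).run s₂).real 2 0 0 = D := by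
    rw [real_run (by decide)]; exact hD₂
  generalize (nat 4 (var 20) (var 20) (.lit 1)).run s₂ = s₃ at *
  -- the rounds
  set R : Fin n → Fin n → Prop := fun u w => I.graph.Adj u w ∧ I.dist c w ≤ D with hR
  have := run_loop_fin (s₀ := s₃) (a := 22) (N := .pts) (p := loop 21 .pts ballStep) hs₃.pts
    (fun t s' => (∀ c' : Fin n, c' ≠ c → ∀ v : Fin n, s'.nat 4 c' v = s₁.nat 4 c' v) ∧
      (∀ v : Fin n, s'.nat 4 c v = 1 → v ∈ I.ball D c) ∧
      ∀ v ∈ within R c t, s'.nat 4 c v = 1)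
    ⟨h3a, fun v hv => by rw [(h3b v).1 hv]; exact .refl, fun v hv => (h3b v).2 hv⟩ ?_
  · obtain ⟨h1, h2, h3⟩ := this
    refine ⟨fun v => ⟨h2 v, fun hv => h3 v (mem_within hv)⟩, fun c' hlt h v => ?_⟩
    rw [h1 c' hlt.ne v]
    exact h v
  · intro t s₄ hA hct ⟨h1, h2, h3⟩
    have hs₄ := hs₃.agree hA
    have := run_loop_each (s₀ := s₄) (a := 21) (N := .pts) (p := ballStep) hs₄.pts
      (fun s' => (∀ c' : Fin n, c' ≠ c → ∀ v : Fin n, s'.nat 4 c' v = s₁.nat 4 c' v) ∧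
        (∀ v : Fin n, s'.nat 4 c v = 1 → v ∈ I.ball D c) ∧
        (∀ v : Fin n, s₄.nat 4 c v = 1 → s'.nat 4 c v = 1))
      (fun u s' => s₄.nat 4 c u = 1 → ∀ v, R u v → s'.nat 4 c v = 1)
      ⟨h1, h2, fun _ h => h⟩ ?_
    · obtain ⟨⟨g1, g2, g3⟩, g4⟩ := this
      refine ⟨g1, g2, fun v hv => ?_⟩
      rcases hv with hv | ⟨u, hu, huv⟩
      · exact g3 v (h3 v hv)
      · exact g4 u (h3 u hu) v huv
    · intro u s₅ hA' hu ⟨g1, g2, g3⟩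
      have hs₅ := hs₄.agree hA'
      have hD₅ : s₅.real 2 0 0 = D := by
        rw [hA'.real 2 (by decide), hA.real 2 (by decide), hD₃]
      obtain ⟨e1, e2⟩ := ballStep_run hs₅ c u
        (by rw [hA'.nat 20 (by decide), hA.nat 20 (by decide), hc₃]) hu
      rw [hD₅] at e2
      refine ⟨⟨fun c' hc' v => by rw [e1 c' hc', g1 c' hc'], fun v hv => ?_,
        fun v hv => (e2 v).2 (Or.inl (g3 v hv))⟩, fun hu' v huv => (e2 v).2 (Or.inr ⟨g3 u hu', huv⟩),
        fun u' _ h hu' v huv => (e2 v).2 (Or.inl (h hu' v huv))⟩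
      rcases (e2 v).1 hv with hv | ⟨hu', huv⟩
      · exact g2 v hv
      · exact (g2 u hu').tail huv

end Code

/-- A set of centers chosen greedily: a point is a center if and only if it does not belong to the
connected ball of an earlier center. -/
def Instance.IsGreedy {n : ℕ} (I : Instance n) (D : ℝ) (S : Finset (Fin n)) : Prop :=
  ∀ c, c ∈ S ↔ ∀ v ∈ S, v < c → c ∉ I.ball D v

namespace Instance

variable {n : ℕ} {I : Instance n} {D : ℝ} {S : Finset (Fin n)}

theorem mem_ball_self (c : Fin n) : c ∈ I.ball D c := Relation.ReflTransGen.refl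

theorem dist_self (v : Fin n) : I.dist v v = 0 := (I.dist_eq_zero v v).2 rfl

theorem dist_nonneg (u v : Fin n) : 0 ≤ I.dist u v := by
  have := I.dist_triangle u v u
  rw [dist_self, I.dist_comm v u] at this
  linarith

theorem dist_le_of_mem_ball (hD : 0 ≤ D) {c v : Fin n} (h : v ∈ I.ball D c) : I.dist c v ≤ D := by
  rcases Relation.ReflTransGen.cases_tail h with rfl | ⟨u, -, -, h⟩
  · rwa [dist_self]
  · exact h

theorem IsGreedy.unique {S' : Finset (Fin n)} (h : I.IsGreedy D S) (h' : I.IsGreedy D S') :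
    S = S' := by
  ext c
  induction c using WellFoundedLT.induction with
  | ind c ih =>
    rw [h c, h' c]
    exact ⟨fun H v hv hvc => H v ((ih v hvc).2 hv) hvc, fun H v hv hvc => H v ((ih v hvc).1 hv) hvc⟩

theorem IsGreedy.cover (h : I.IsGreedy D S) (v : Fin n) : ∃ c ∈ S, v ∈ I.ball D c := by
  by_cases hv : v ∈ S
  · exact ⟨v, hv, mem_ball_self v⟩
  · rw [h v] at hv
    push Not at hv
    obtain ⟨c, hc, -, hvc⟩ := hv
    exact ⟨c, hc, hvc⟩

/-- A connected cluster of diameter at most `D` lies in the connected ball of each of its points. -/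
theorem cluster_subset_ball {A : Set (Fin n)} (hA : (I.graph.induce A).Connected)
    (hD : ∀ u ∈ A, ∀ v ∈ A, I.dist u v ≤ D) {c v : Fin n} (hc : c ∈ A) (hv : v ∈ A) :
    v ∈ I.ball D c := by
  obtain ⟨w⟩ := hA.preconnected ⟨c, hc⟩ ⟨v, hv⟩
  have : ∀ (a b : A), (I.graph.induce A).Walk a b → Relation.ReflTransGen
      (fun u w => I.graph.Adj u w ∧ I.dist c w ≤ D) a.1 b.1 := by
    intro a b w
    induction w with
    | nil => exact .refl
    | cons hadj _ ih => exact .head ⟨hadj, hD _ hc _ (Subtype.prop _)⟩ ih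
  exact this _ _ w

/-- There are at most `k` greedy centers if there is a solution with diameter at most `D`, since
every cluster of the solution contains at most one of them. -/
theorem IsGreedy.card_le (h : I.IsGreedy D S) {C : Fin I.k → Set (Fin n)}
    (hC : IsDisjointClustering I.graph C)
    (hD : ∀ i, ∀ u ∈ C i, ∀ v ∈ C i, I.dist u v ≤ D) : S.card ≤ I.k := by
  choose f hf using hC.cover
  have hinj : Set.InjOn f S := by
    have key : ∀ a ∈ S, ∀ b ∈ S, f a = f b → ¬ a < b := by
      intro a ha b hb hab hlt
      refine (h b).1 hb a ha hlt (cluster_subset_ball (hC.connected (f a)) (hD _) (hf a) ?_)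
      rw [hab]; exact hf b
    intro a ha b hb hab
    exact le_antisymm (not_lt.1 (key b hb a ha hab.symm)) (not_lt.1 (key a ha b hb hab))
  simpa using Finset.card_le_card_of_injOn f (t := Finset.univ) (fun _ _ => Finset.mem_univ _) hinj

/-- The radius `D` leads to at most `k` greedy centers. -/
def Admissible (I : Instance n) (D : ℝ) : Prop := ∃ S, I.IsGreedy D S ∧ S.card ≤ I.k

/-- If all clusters of a solution have diameter at most `R`, then some distance that is at most `R`
is admissible. -/
theorem exists_admissible {C : Fin I.k → Set (Fin n)} (hC : IsDisjointClustering I.graph C)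
    {R : ℝ} (hR : ∀ i, ∀ u ∈ C i, ∀ v ∈ C i, I.dist u v ≤ R) :
    ∃ a b, I.dist a b ≤ R ∧ ∀ S, I.IsGreedy (I.dist a b) S → S.card ≤ I.k := by
  classical
  have hn : 0 < n := lt_of_lt_of_le I.one_le_k I.k_le_n
  obtain ⟨i, hi⟩ := hC.cover ⟨0, hn⟩
  obtain ⟨q, hq, hmax⟩ := Finset.exists_max_image
    ((Finset.univ : Finset (Fin n × Fin n)).filter fun q => ∃ i, q.1 ∈ C i ∧ q.2 ∈ C i)
    (fun q => I.dist q.1 q.2) ⟨(⟨0, hn⟩, ⟨0, hn⟩), by simpa using ⟨i, hi⟩⟩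
  obtain ⟨j, hj⟩ := (Finset.mem_filter.1 hq).2
  refine ⟨q.1, q.2, hR j _ hj.1 _ hj.2, fun S hS => hS.card_le hC fun i u hu v hv => ?_⟩
  exact hmax (u, v) (Finset.mem_filter.2 ⟨Finset.mem_univ _, i, hu, hv⟩)

end Instance

/-! ### Counting -/

/-- The number of indices below `t` with the property `P`. -/
noncomputable def countBelow {n : ℕ} (P : Fin n → Prop) (t : ℕ) : ℕ :=
  open Classical in (Finset.univ.filter fun v : Fin n => (v : ℕ) < t ∧ P v).card

theorem countBelow_zero {n : ℕ} (P : Fin n → Prop) : countBelow P 0 = 0 := by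
  simp [countBelow]

open Classical in
theorem countBelow_succ {n : ℕ} (P : Fin n → Prop) (i : Fin n) :
    countBelow P (i + 1) = countBelow P i + if P i then 1 else 0 := by
  unfold countBelow
  split_ifs with h
  · rw [← Finset.card_insert_of_notMem (a := i) (by simp)]
    congr 1
    ext v
    simp only [Finset.mem_filter, Finset.mem_univ, true_and, Finset.mem_insert]
    constructor
    · rintro ⟨h1, h2⟩
      by_cases hv : v = i
      · exact Or.inl hv
      · exact Or.inr ⟨by have := Fin.val_ne_of_ne hv; omega, h2⟩
    · rintro (rfl | ⟨h1, h2⟩)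
      · exact ⟨by omega, h⟩
      · exact ⟨by omega, h2⟩
  · rw [add_zero]
    congr 1
    ext v
    simp only [Finset.mem_filter, Finset.mem_univ, true_and]
    refine ⟨fun ⟨h1, h2⟩ => ⟨?_, h2⟩, fun ⟨h1, h2⟩ => ⟨by omega, h2⟩⟩
    have : v ≠ i := by rintro rfl; exact h h2
    have := Fin.val_ne_of_ne this
    omega

open Classical in
theorem countBelow_self {n : ℕ} (P : Fin n → Prop) :
    countBelow P n = (Finset.univ.filter P).card := by
  simp [countBelow]

theorem countBelow_congr {n : ℕ} {P Q : Fin n → Prop} {t : ℕ}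
    (h : ∀ v : Fin n, (v : ℕ) < t → (P v ↔ Q v)) : countBelow P t = countBelow Q t := by
  classical
  unfold countBelow
  congr 1
  ext v
  simp only [Finset.mem_filter, Finset.mem_univ, true_and]
  exact ⟨fun ⟨h1, h2⟩ => ⟨h1, (h v h1).1 h2⟩, fun ⟨h1, h2⟩ => ⟨h1, (h v h1).2 h2⟩⟩

/-- The points `v` with entry `1` in the cell `(v, 0)` of the `a`-th array of naturals. -/
def Memory.marked (s : Memory) (n a : ℕ) : Finset (Fin n) :=
  Finset.univ.filter fun v => s.nat a v 0 = 1

@[simp] theorem Memory.mem_marked {s : Memory} {n a : ℕ} {v : Fin n} :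
    v ∈ s.marked n a ↔ s.nat a v 0 = 1 := by simp [Memory.marked]

namespace Code

/-! ### Computing the greedy centers and the threshold -/

/-- Computes the greedy centers from the connected balls in array `4`: marks them in array `5` and
counts them in the variable `6`. -/
def centers : Code :=
  block [
    set 6 (.lit 0),
    loop 20 .pts (block [
      setEntry 5 (var 20) (.lit 1),
      loop 21 .pts (guard (Test.all [.natLE (.add (var 21) (.lit 1)) (var 20),
          .eq (entry 5 (var 21)) (.lit 1), .eq (.read 4 (var 21) (var 20)) (.lit 1)])
        (setEntry 5 (var 20) (.lit 0))),
      guard (.eq (entry 5 (var 20)) (.lit 1)) (set 6 (.add (var 6) (.lit 1)))])]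

variable {n : ℕ} {I : Instance n} {m : ℕ} {x : Fin n → Fin m → ℝ} {s : Memory}

theorem centers_run {D : ℝ} (hs : Loaded I x s)
    (hb : ∀ c v : Fin n, s.nat 4 c v = 1 ↔ v ∈ I.ball D c) :
    I.IsGreedy D ((centers.run s).marked n 5) ∧
      (centers.run s).nat 6 0 0 = ((centers.run s).marked n 5).card := by
  classical
  unfold centers
  simp only [run_block_cons, run_block_nil]
  have hs₁ : Loaded I x ((set 6 (.lit 0)).run s) := hs.run
  have h6 : ((set 6 (.lit 0)).run s).nat 6 0 0 = 0 := by simp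
  have hb₁ : ∀ c v : Fin n, ((set 6 (.lit 0)).run s).nat 4 c v = 1 ↔ v ∈ I.ball D c := by
    rw [nat_run (by decide)]; exact hb
  generalize (set 6 (.lit 0)).run s = s₁ at *
  have := run_loop_fin (s₀ := s₁) (a := 20) (N := .pts) hs₁.pts (p := block [
      setEntry 5 (var 20) (.lit 1),
      loop 21 .pts (guard (Test.all [.natLE (.add (var 21) (.lit 1)) (var 20),
          .eq (entry 5 (var 21)) (.lit 1), .eq (.read 4 (var 21) (var 20)) (.lit 1)])
        (setEntry 5 (var 20) (.lit 0))),
      guard (.eq (entry 5 (var 20)) (.lit 1)) (set 6 (.add (var 6) (.lit 1)))])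
    (fun t s' => s'.nat 6 0 0 = countBelow (fun c : Fin n => s'.nat 5 c 0 = 1) t ∧
      ∀ c : Fin n, (c : ℕ) < t → (s'.nat 5 c 0 = 1 ↔
        ∀ v : Fin n, s'.nat 5 v 0 = 1 → v < c → c ∉ I.ball D v))
    ⟨by rw [countBelow_zero]; exact h6, fun c hc => absurd hc (by omega)⟩ ?_
  · obtain ⟨h1, h2⟩ := this
    refine ⟨fun c => ?_, ?_⟩
    · simp only [Memory.mem_marked]
      exact h2 c c.2
    · rw [h1, countBelow_self]
      congr 1
      ext v
      simp
  · intro c s₂ hA hc ⟨h1, h2⟩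
    have hs₂ := hs₁.agree hA
    have hb₂ : ∀ c v : Fin n, s₂.nat 4 c v = 1 ↔ v ∈ I.ball D c := by
      rw [hA.nat 4 (by decide)]; exact hb₁
    simp only [run_block_cons, run_block_nil]
    have hs₃ : Loaded I x ((setEntry 5 (var 20) (.lit 1)).run s₂) := hs₂.run
    have h3 : ∀ v : Fin n, ((setEntry 5 (var 20) (.lit 1)).run s₂).nat 5 v 0 =
        if v = c then 1 else s₂.nat 5 v 0 := by
      intro v; simp [hc, Fin.val_inj]
    have hb₃ : ((setEntry 5 (var 20) (.lit 1)).run s₂).nat 4 = s₂.nat 4 := nat_run (by decide) _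
    have h6₃ : ((setEntry 5 (var 20) (.lit 1)).run s₂).nat 6 = s₂.nat 6 := nat_run (by decide) _
    have hc₃ : ((setEntry 5 (var 20) (.lit 1)).run s₂).nat 20 0 0 = c := by
      rw [nat_run (by decide)]; exact hc
    generalize (setEntry 5 (var 20) (.lit 1)).run s₂ = s₃ at *
    have := run_loop_fin (s₀ := s₃) (a := 21) (N := .pts) hs₃.pts
      (p := guard (Test.all [.natLE (.add (var 21) (.lit 1)) (var 20),
          .eq (entry 5 (var 21)) (.lit 1), .eq (.read 4 (var 21) (var 20)) (.lit 1)])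
        (setEntry 5 (var 20) (.lit 0)))
      (fun t s' => (∀ v, v ≠ c → s'.nat 5 v 0 = s₂.nat 5 v 0) ∧ (s'.nat 5 c 0 = 1 ↔
        ∀ v : Fin n, (v : ℕ) < t → s₂.nat 5 v 0 = 1 → v < c → c ∉ I.ball D v))
      ⟨fun v hv => by rw [h3, if_neg hv], by simp [h3]⟩ ?_
    · have h6₄ : ((loop 21 .pts (guard (Test.all [.natLE (.add (var 21) (.lit 1)) (var 20),
          .eq (entry 5 (var 21)) (.lit 1), .eq (.read 4 (var 21) (var 20)) (.lit 1)])
        (setEntry 5 (var 20) (.lit 0)))).run s₃).nat 6 = s₂.nat 6 := by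
        rw [nat_run (by decide), h6₃]
      have hc₄ : ((loop 21 .pts (guard (Test.all [.natLE (.add (var 21) (.lit 1)) (var 20),
          .eq (entry 5 (var 21)) (.lit 1), .eq (.read 4 (var 21) (var 20)) (.lit 1)])
        (setEntry 5 (var 20) (.lit 0)))).run s₃).nat 20 0 0 = c := by
        rw [nat_run (by decide), hc₃]
      generalize (loop 21 .pts (guard (Test.all [.natLE (.add (var 21) (.lit 1)) (var 20),
          .eq (entry 5 (var 21)) (.lit 1), .eq (.read 4 (var 21) (var 20)) (.lit 1)])
        (setEntry 5 (var 20) (.lit 0)))).run s₃ = s₄ at *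
      obtain ⟨g1, g2⟩ := this
      have e5 : ∀ v : Fin n, ((guard (.eq (entry 5 (var 20)) (.lit 1))
          (set 6 (.add (var 6) (.lit 1)))).run s₄).nat 5 v 0 = s₄.nat 5 v 0 := by
        intro v; rw [nat_run (by decide)]
      have e6 : ((guard (.eq (entry 5 (var 20)) (.lit 1))
          (set 6 (.add (var 6) (.lit 1)))).run s₄).nat 6 0 0 =
          s₂.nat 6 0 0 + if s₄.nat 5 c 0 = 1 then 1 else 0 := by
        simp only [run_guard, Test.holds_eq, eval_entry, eval_var, hc₄, NatExp.eval]
        split_ifs <;> simp [h6₄]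
      constructor
      · simp only [e5]
        rw [e6, countBelow_succ, h1]
        congr 1
        · exact countBelow_congr fun v hv => by
            rw [g1 v (by rintro rfl; omega)]
        · split_ifs <;> rfl
      · intro c' hc'
        simp only [e5]
        have hcc : c' ≤ c := Fin.le_def.2 (by omega)
        have hrw : (∀ v : Fin n, s₄.nat 5 v 0 = 1 → v < c' → c' ∉ I.ball D v) ↔
            ∀ v : Fin n, s₂.nat 5 v 0 = 1 → v < c' → c' ∉ I.ball D v := by
          refine forall_congr' fun v => ?_
          by_cases hv : v = c
          · subst hv
            exact ⟨fun _ _ h => absurd h (not_lt.2 hcc), fun _ _ h => absurd h (not_lt.2 hcc)⟩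
          · rw [g1 v hv]
        rw [hrw]
        by_cases h : c' = c
        · subst h
          rw [g2]
          exact ⟨fun H v => H v v.2, fun H v _ => H v⟩
        · rw [g1 c' h]
          exact h2 c' (by have := Fin.val_ne_of_ne h; omega)
    · intro v s₄ hA' hv ⟨g1, g2⟩
      have hc₄ : s₄.nat 20 0 0 = c := by rw [hA'.nat 20 (by decide)]; exact hc₃
      have hb₄ : ∀ c v : Fin n, s₄.nat 4 c v = 1 ↔ v ∈ I.ball D c := by
        rw [hA'.nat 4 (by decide), hb₃]; exact hb₂
      simp only [run_guard]
      split_ifs with h <;> simp only [Test.holds_all_cons, Test.holds_all_nil, Test.holds_eq,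
        Test.holds_natLE, NatExp.eval, eval_var, eval_entry, hc₄, hv, hb₄, and_true] at h
      · have hvc : v < c := Fin.lt_def.2 (by omega)
        simp only [run_setEntry, eval_var, NatExp.eval, hc₄, Memory.nat_writeNat, true_and,
          Fin.val_inj]
        refine ⟨fun v' hv' => by simpa [hv'] using g1 v' hv', ?_⟩
        simp only [if_true, zero_ne_one, false_iff]
        intro H
        exact H v (by omega) (by rw [← g1 v hvc.ne]; exact h.2.1) hvc h.2.2
      · refine ⟨g1, g2.trans ⟨fun H v' hv' h1 h2 => ?_, fun H v' hv' => H v' (by omega)⟩⟩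
        by_cases hvv : v' = v
        · subst hvv
          intro h3
          refine h ⟨by have := Fin.lt_def.1 h2; omega, ?_, h3⟩
          rw [g1 v' h2.ne]; exact h1
        · exact H v' (by have := Fin.val_ne_of_ne hvv; omega) h1 h2

/-- Tests whether the distance of the points in the variables `25` and `26` is admissible, and
keeps the smallest admissible distance in the real variable `3`; the variable `7` tells whether
there has been one. -/
def tryThreshold : Code :=
  block [
    real 2 (.lit 0) (.lit 0) (.read 0 (var 25) (var 26)),
    balls,
    centers,
    guard (Test.all [.natLE (var 6) (.read 0 (.lit 0) (.lit 1)),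
        .not (Test.all [.eq (var 7) (.lit 1), .realLE (rvar 3) (rvar 2)])])
      (block [set 7 (.lit 1), real 3 (.lit 0) (.lit 0) (rvar 2)])]

/-- Computes the smallest admissible distance and its balls and centers. -/
def threshold : Code :=
  block [
    set 7 (.lit 0),
    loop 25 .pts (loop 26 .pts tryThreshold),
    real 2 (.lit 0) (.lit 0) (rvar 3),
    balls,
    centers]

theorem balls_centers_run (hs : Loaded I x s) :
    (∀ c v : Fin n, (centers.run (balls.run s)).nat 4 c v = 1 ↔ v ∈ I.ball (s.real 2 0 0) c) ∧
    I.IsGreedy (s.real 2 0 0) ((centers.run (balls.run s)).marked n 5) ∧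
      (centers.run (balls.run s)).nat 6 0 0 =
        ((centers.run (balls.run s)).marked n 5).card := by
  have hb := balls_run hs
  refine ⟨fun c v => ?_, centers_run hs.run hb⟩
  rw [nat_run (p := centers) (by decide)]
  exact hb c v

theorem tryThreshold_run (hs : Loaded I x s) (a b : Fin n) (ha : s.nat 25 0 0 = a)
    (hb : s.nat 26 0 0 = b) :
    (I.Admissible (I.dist a b) ∧ (tryThreshold.run s).nat 7 0 0 = 1 ∧
      (tryThreshold.run s).real 3 0 0 = I.dist a b ∧
      (s.nat 7 0 0 = 1 → I.dist a b ≤ s.real 3 0 0)) ∨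
    ((I.Admissible (I.dist a b) → s.nat 7 0 0 = 1 ∧ s.real 3 0 0 ≤ I.dist a b) ∧
      (tryThreshold.run s).nat 7 0 0 = s.nat 7 0 0 ∧
      (tryThreshold.run s).real 3 0 0 = s.real 3 0 0) := by
  unfold tryThreshold
  simp only [run_block_cons, run_block_nil]
  have hs₁ : Loaded I x ((real 2 (.lit 0) (.lit 0) (.read 0 (var 25) (var 26))).run s) := hs.run
  have hD : ((real 2 (.lit 0) (.lit 0) (.read 0 (var 25) (var 26))).run s).real 2 0 0 =
      I.dist a b := by
    simp [ha, hb, hs.dist]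
  have h7 : ((real 2 (.lit 0) (.lit 0) (.read 0 (var 25) (var 26))).run s).nat 7 = s.nat 7 :=
    nat_run (by decide) _
  have h3 : ((real 2 (.lit 0) (.lit 0) (.read 0 (var 25) (var 26))).run s).real 3 = s.real 3 :=
    real_run (by decide) _
  generalize (real 2 (.lit 0) (.lit 0) (.read 0 (var 25) (var 26))).run s = s₁ at *
  obtain ⟨-, hg, hcard⟩ := balls_centers_run hs₁
  rw [hD] at hg
  have hs₂ : Loaded I x (centers.run (balls.run s₁)) := (hs₁.run (p := balls)).run
  have h7' : (centers.run (balls.run s₁)).nat 7 = s.nat 7 := by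
    rw [nat_run (by decide), nat_run (by decide), h7]
  have h3' : (centers.run (balls.run s₁)).real 3 = s.real 3 := by
    rw [real_run (by decide), real_run (by decide), h3]
  have hD' : (centers.run (balls.run s₁)).real 2 0 0 = I.dist a b := by
    rw [real_run (by decide), real_run (by decide), hD]
  generalize centers.run (balls.run s₁) = s₂ at *
  have hadm : I.Admissible (I.dist a b) ↔ s₂.nat 6 0 0 ≤ I.k := by
    rw [hcard]
    exact ⟨fun ⟨S, hS, hk⟩ => by rwa [hg.unique hS], fun h => ⟨_, hg, h⟩⟩
  simp only [run_guard]
  split_ifs with h <;> simp only [Test.holds_all_cons, Test.holds_all_nil, Test.holds_eq,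
        Test.holds_natLE, Test.holds_realLE, Test.holds_not, NatExp.eval, eval_var, eval_rvar,
        h7', h3', hD', hs₂.clusters, ← hadm, and_true] at h
  · left
    refine ⟨h.1, by simp, by simp [hD'], fun h7 => ?_⟩
    by_contra hlt
    exact h.2 ⟨h7, (not_le.1 hlt).le⟩
  · right
    refine ⟨fun hA => ?_, by rw [h7'], by rw [h3']⟩
    by_contra hh
    exact h ⟨hA, hh⟩

theorem threshold_run (hs : Loaded I x s) :
    ∃ D, (threshold.run s).real 2 0 0 = D ∧
      (∀ c v : Fin n, (threshold.run s).nat 4 c v = 1 ↔ v ∈ I.ball D c) ∧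
      I.IsGreedy D ((threshold.run s).marked n 5) ∧
      (I.Feasible → ((threshold.run s).marked n 5).card ≤ I.k ∧ 0 ≤ D ∧
        ∀ (C : Fin I.k → Set (Fin n)) (R : ℝ), IsDisjointClustering I.graph C →
          (∀ i, ∀ u ∈ C i, ∀ v ∈ C i, I.dist u v ≤ R) → D ≤ R) := by
  unfold threshold
  simp only [run_block_cons, run_block_nil]
  have hs₁ : Loaded I x ((set 7 (.lit 0)).run s) := hs.run
  have h7 : ((set 7 (.lit 0)).run s).nat 7 0 0 = 0 := by simp
  generalize (set 7 (.lit 0)).run s = s₁ at *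
  set Inv : Memory → Prop := fun s' => s'.nat 7 0 0 = 1 →
    I.Admissible (s'.real 3 0 0) ∧ 0 ≤ s'.real 3 0 0 with hInv
  have := run_loop_each (s₀ := s₁) (a := 25) (N := .pts) (p := loop 26 .pts tryThreshold) hs₁.pts
    Inv (fun a s' => ∀ b, I.Admissible (I.dist a b) →
      s'.nat 7 0 0 = 1 ∧ s'.real 3 0 0 ≤ I.dist a b) (fun h => by omega) ?_
  · have hs₂ : Loaded I x ((loop 25 .pts (loop 26 .pts tryThreshold)).run s₁) := hs₁.run
    generalize (loop 25 .pts (loop 26 .pts tryThreshold)).run s₁ = s₂ at *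
    obtain ⟨h1, h2⟩ := this
    have hs₃ : Loaded I x ((real 2 (.lit 0) (.lit 0) (rvar 3)).run s₂) := hs₂.run
    obtain ⟨g1, g2, -⟩ := balls_centers_run hs₃
    have hD : ((real 2 (.lit 0) (.lit 0) (rvar 3)).run s₂).real 2 0 0 = s₂.real 3 0 0 := by simp
    rw [hD] at g1 g2
    refine ⟨s₂.real 3 0 0, ?_, g1, g2, ?_⟩
    · rw [real_run (by decide), real_run (by decide), hD]
    · rintro ⟨C₀, hC₀⟩
      have key : ∀ (C : Fin I.k → Set (Fin n)) (R : ℝ), IsDisjointClustering I.graph C →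
          (∀ i, ∀ u ∈ C i, ∀ v ∈ C i, I.dist u v ≤ R) →
          s₂.nat 7 0 0 = 1 ∧ s₂.real 3 0 0 ≤ R := by
        intro C R hC hR
        obtain ⟨a, b, hab, hS⟩ := Instance.exists_admissible hC hR
        -- a run of the algorithm shows that greedy centers exist for the radius `dist a b`
        have hadm : I.Admissible (I.dist a b) := by
          have hl : Loaded I x (s₂.writeReal 2 0 0 (I.dist a b)) :=
            hs₂.run (p := real 2 (.lit 0) (.lit 0) (.read 0 (.lit a) (.lit b))) |> fun h => by
              simpa [hs₂.dist] using h
          have := (balls_centers_run hl).2.1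
          simp only [Memory.real_writeReal, and_self, if_true] at this
          exact ⟨_, this, hS _ this⟩
        exact ⟨(h2 a b hadm).1, (h2 a b hadm).2.trans hab⟩
      obtain ⟨R, hR⟩ : ∃ R, ∀ i, ∀ u ∈ C₀ i, ∀ v ∈ C₀ i, I.dist u v ≤ R := by
        obtain ⟨R, hR⟩ := (Set.finite_range fun q : Fin n × Fin n => I.dist q.1 q.2).bddAbove
        exact ⟨R, fun i u _ v _ => hR ⟨(u, v), rfl⟩⟩
      obtain ⟨⟨S, hS, hk⟩, h0⟩ := h1 (key C₀ R hC₀ hR).1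
      exact ⟨by rwa [g2.unique hS], h0, fun C R hC hR => (key C R hC hR).2⟩
  · intro a s₂ hA ha hI
    have hs₂ := hs₁.agree hA
    have := run_loop_each (s₀ := s₂) (a := 26) (N := .pts) (p := tryThreshold) hs₂.pts
      (fun s' => Inv s' ∧ (s₂.nat 7 0 0 = 1 → s'.nat 7 0 0 = 1 ∧ s'.real 3 0 0 ≤ s₂.real 3 0 0))
      (fun b s' => I.Admissible (I.dist a b) → s'.nat 7 0 0 = 1 ∧ s'.real 3 0 0 ≤ I.dist a b)
      ⟨hI, fun h => ⟨h, le_rfl⟩⟩ ?_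
    · obtain ⟨⟨h1, h2⟩, h3⟩ := this
      refine ⟨h1, h3, fun a' _ H b hab => ?_⟩
      obtain ⟨e1, e2⟩ := H b hab
      exact ⟨(h2 e1).1, (h2 e1).2.trans e2⟩
    · intro b s₃ hA' hb ⟨h1, h2⟩
      have hs₃ := hs₂.agree hA'
      rcases tryThreshold_run hs₃ a b (by rw [hA'.nat 25 (by decide)]; exact ha) hb with
        ⟨e1, e2, e3, e4⟩ | ⟨e1, e2, e3⟩
      · simp only [hInv, e2, e3]
        refine ⟨⟨fun _ => ⟨e1, Instance.dist_nonneg a b⟩, fun h => ⟨trivial, ?_⟩⟩,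
          fun _ => ⟨trivial, le_rfl⟩, fun b' _ h hb' => ⟨trivial, ?_⟩⟩
        · exact (e4 (h2 h).1).trans (h2 h).2
        · exact (e4 (h hb').1).trans (h hb').2
      · simp only [hInv, e2, e3]
        exact ⟨⟨h1, h2⟩, e1, fun b' _ h => h⟩

end Code

/-! ### Partial clusterings -/

/-- A partial clustering. The label `0` means that a point has not been assigned yet, the label
`i + 1` that it belongs to the `i`-th cluster, whose root is `root i`. There are `num` clusters so
far, and `budget` more points may be attached to existing clusters. -/
structure Partial (n : ℕ) where
  lab : Fin n → ℕ
  root : ℕ → ℕ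
  num : ℕ
  budget : ℕ

namespace Partial

variable {n : ℕ}

/-- Opens a new cluster with root `c`. -/
def seed (σ : Partial n) (c : Fin n) : Partial n where
  lab v := if v = c then σ.num + 1 else σ.lab v
  root i := if i = σ.num then c else σ.root i
  num := σ.num + 1
  budget := σ.budget

/-- Attaches the point `v` to the cluster of `u`. -/
def attach (σ : Partial n) (u v : Fin n) : Partial n where
  lab w := if w = v then σ.lab u else σ.lab w
  root := σ.root
  num := σ.num
  budget := σ.budget - 1

/-- The number of assigned points. -/
def assigned (σ : Partial n) : ℕ := (Finset.univ.filter fun v => σ.lab v ≠ 0).card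

/-- A partial clustering in which all clusters are connected and contain their roots, all points
are `Near` the root of their cluster, and the budget is what remains of `n - k`: this forces exactly
`k` clusters as soon as all points are assigned and the budget is used up. -/
structure Valid (I : Instance n) (Near : Fin n → Fin n → Prop) (σ : Partial n) : Prop where
  count : σ.assigned + σ.budget = σ.num + (n - I.k)
  lab_le : ∀ v, σ.lab v ≤ σ.num
  used : ∀ i < σ.num, ∃ v, σ.lab v = i + 1
  rooted : ∀ v, σ.lab v ≠ 0 → ∃ c : Fin n, σ.root (σ.lab v - 1) = c ∧ σ.lab c = σ.lab v ∧
    Relation.ReflTransGen (fun u w => I.graph.Adj u w ∧ σ.lab u = σ.lab v ∧ σ.lab w = σ.lab v) c v ∧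
    Near c v

variable {I : Instance n} {Near : Fin n → Fin n → Prop} {σ : Partial n}

theorem assigned_update {lab lab' : Fin n → ℕ} {v : Fin n} (hv : lab v = 0) {l : ℕ} (hl : l ≠ 0)
    (h : ∀ w, lab' w = if w = v then l else lab w) :
    (Finset.univ.filter fun w => lab' w ≠ 0).card =
      (Finset.univ.filter fun w => lab w ≠ 0).card + 1 := by
  rw [← Finset.card_insert_of_notMem (a := v) (by simp [hv])]
  congr 1
  ext w
  by_cases hw : w = v <;> simp [h, hw, hl]

theorem Valid.mono {Near' : Fin n → Fin n → Prop} (h : σ.Valid I Near)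
    (hN : ∀ c v, Near c v → Near' c v) : σ.Valid I Near' :=
  ⟨h.count, h.lab_le, h.used, fun v hv =>
    let ⟨c, h1, h2, h3, h4⟩ := h.rooted v hv
    ⟨c, h1, h2, h3, hN c v h4⟩⟩

/-- Changing the label of an unassigned point keeps old clusters connected. -/
theorem reach_update {lab lab' : Fin n → ℕ} {v : Fin n} (hv : lab v = 0) {l : ℕ}
    (h : ∀ w, lab' w = if w = v then l else lab w) {i : ℕ} (hi : i ≠ 0) {a b : Fin n}
    (hr : Relation.ReflTransGen (fun u w => I.graph.Adj u w ∧ lab u = i ∧ lab w = i) a b) :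
    Relation.ReflTransGen (fun u w => I.graph.Adj u w ∧ lab' u = i ∧ lab' w = i) a b := by
  have key : ∀ w, lab w = i → lab' w = i := by
    intro w hw
    rw [h, if_neg]
    · exact hw
    · rintro rfl
      exact hi (hw.symm.trans hv)
  exact hr.lift id fun u w ⟨h1, h2, h3⟩ => ⟨h1, key u h2, key w h3⟩

theorem Valid.seed (h : σ.Valid I Near) {c : Fin n} (hc : σ.lab c = 0) (hN : Near c c) :
    (σ.seed c).Valid I Near := by
  have hlab : ∀ w, (σ.seed c).lab w = if w = c then σ.num + 1 else σ.lab w := fun _ => rfl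
  have hold : ∀ w, w ≠ c → (σ.seed c).lab w = σ.lab w := fun w hw => by rw [hlab, if_neg hw]
  have hself : (σ.seed c).lab c = σ.num + 1 := by rw [hlab, if_pos rfl]
  refine ⟨?_, fun v => ?_, fun i hi => ?_, fun v hv => ?_⟩
  · have := assigned_update hc (Nat.succ_ne_zero σ.num) hlab
    have h1 := h.count
    unfold assigned at h1 ⊢
    simp only [Partial.seed] at this ⊢
    omega
  · have := h.lab_le v
    rw [hlab]
    simp only [Partial.seed]
    split_ifs <;> omega
  · by_cases hi' : i = σ.num
    · exact ⟨c, by rw [hself, hi']⟩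
    · obtain ⟨v, hv⟩ := h.used i (by simp only [Partial.seed] at hi; omega)
      refine ⟨v, ?_⟩
      rw [hold v, hv]
      rintro rfl
      omega
  · by_cases hvc : v = c
    · subst hvc
      exact ⟨v, by rw [hself]; simp [Partial.seed], rfl, .refl, hN⟩
    · rw [hold v hvc] at hv ⊢
      obtain ⟨a, h1, h2, h3, h4⟩ := h.rooted v hv
      have hac : a ≠ c := by
        rintro rfl
        exact hv (h2.symm.trans hc)
      refine ⟨a, ?_, by rw [hold a hac, h2], reach_update hc hlab hv h3, h4⟩
      have := h.lab_le v
      simp only [Partial.seed]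
      rw [if_neg (by omega), h1]

theorem Valid.attach (h : σ.Valid I Near) {u v : Fin n} (hu : σ.lab u ≠ 0) (hv : σ.lab v = 0)
    (hb : 1 ≤ σ.budget) (huv : I.graph.Adj u v) (hN : ∀ c, Near c u → Near c v) :
    (σ.attach u v).Valid I Near := by
  have hlab : ∀ w, (σ.attach u v).lab w = if w = v then σ.lab u else σ.lab w := fun _ => rfl
  have hold : ∀ w, σ.lab w ≠ 0 → (σ.attach u v).lab w = σ.lab w := fun w hw => by
    rw [hlab, if_neg]
    rintro rfl
    exact hw hv
  have hself : (σ.attach u v).lab v = σ.lab u := by rw [hlab, if_pos rfl]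
  refine ⟨?_, fun w => ?_, fun i hi => ?_, fun w hw => ?_⟩
  · have := assigned_update hv hu hlab
    have h1 := h.count
    unfold assigned at h1 ⊢
    simp only [Partial.attach] at this ⊢
    omega
  · have h1 := h.lab_le w
    have h2 := h.lab_le u
    rw [hlab]
    simp only [Partial.attach]
    split_ifs <;> omega
  · obtain ⟨w, hw⟩ := h.used i hi
    exact ⟨w, by rw [hold w (by omega), hw]⟩
  · have key : ∀ w, σ.lab w ≠ 0 → ∃ c : Fin n, σ.root (σ.lab w - 1) = c ∧
        (σ.attach u v).lab c = σ.lab w ∧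
        Relation.ReflTransGen (fun a b => I.graph.Adj a b ∧ (σ.attach u v).lab a = σ.lab w ∧
          (σ.attach u v).lab b = σ.lab w) c w ∧ Near c w := by
      intro w hw
      obtain ⟨c, h1, h2, h3, h4⟩ := h.rooted w hw
      exact ⟨c, h1, by rw [hold c (by rw [h2]; exact hw), h2], reach_update hv hlab hw h3, h4⟩
    by_cases hwv : w = v
    · subst hwv
      rw [hself]
      obtain ⟨c, h1, h2, h3, h4⟩ := key u hu
      exact ⟨c, h1, h2, h3.tail ⟨huv, hold u hu, hself⟩, hN c h4⟩
    · have hww : (σ.attach u v).lab w = σ.lab w := by rw [hlab, if_neg hwv]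
      rw [hww] at hw ⊢
      exact key w hw

/-- The progress made from one partial clustering to another: points remain assigned, an exhausted
budget remains exhausted, and validity and the bound by the number of assigned points of `S` on the
number of clusters are preserved. -/
structure Progress (I : Instance n) (Near : Fin n → Fin n → Prop) (S : Finset (Fin n))
    (σ τ : Partial n) : Prop where
  lab : ∀ v, σ.lab v ≠ 0 → τ.lab v ≠ 0
  budget : σ.budget = 0 → τ.budget = 0
  valid : σ.Valid I Near → τ.Valid I Near
  num : σ.num ≤ (S.filter fun v => σ.lab v ≠ 0).card → τ.num ≤ (S.filter fun v => τ.lab v ≠ 0).card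

variable {S : Finset (Fin n)}

theorem Progress.refl (σ : Partial n) : Progress I Near S σ σ :=
  ⟨fun _ h => h, fun h => h, fun h => h, fun h => h⟩

theorem Progress.trans {σ τ υ : Partial n} (h : Progress I Near S σ τ)
    (h' : Progress I Near S τ υ) : Progress I Near S σ υ :=
  ⟨fun v hv => h'.lab v (h.lab v hv), fun hb => h'.budget (h.budget hb),
    fun hv => h'.valid (h.valid hv), fun hn => h'.num (h.num hn)⟩

theorem progress_seed {c : Fin n} (hc : σ.lab c = 0) (hS : c ∈ S) (hN : Near c c) :
    Progress I Near S σ (σ.seed c) := by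
  refine ⟨fun v hv => ?_, fun h => h, fun h => h.seed hc hN, fun h => ?_⟩
  · simp only [Partial.seed]
    split_ifs
    · omega
    · exact hv
  · have : (S.filter fun v => (σ.seed c).lab v ≠ 0) =
        insert c (S.filter fun v => σ.lab v ≠ 0) := by
      ext w
      rw [Finset.mem_insert, Finset.mem_filter, Finset.mem_filter]
      by_cases hw : w = c <;> simp [Partial.seed, hw, hS]
    rw [this, Finset.card_insert_of_notMem (by simp [hc])]
    exact Nat.succ_le_succ h

theorem progress_attach {u v : Fin n} (hu : σ.lab u ≠ 0) (hv : σ.lab v = 0)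
    (hb : 1 ≤ σ.budget) (huv : I.graph.Adj u v) (hN : ∀ c, Near c u → Near c v) :
    Progress I Near S σ (σ.attach u v) := by
  have hl : ∀ w, σ.lab w ≠ 0 → (σ.attach u v).lab w ≠ 0 := by
    intro w hw
    simp only [Partial.attach]
    split_ifs
    exacts [hu, hw]
  refine ⟨hl, fun h => by omega, fun h => h.attach hu hv hb huv hN, fun h => ?_⟩
  refine le_trans h (Finset.card_le_card fun w hw => ?_)
  rw [Finset.mem_filter] at hw ⊢
  exact ⟨hw.1, hl w hw.2⟩

/-- The point `v` is assigned unless the budget is exhausted. -/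
def Done (σ : Partial n) (v : Fin n) : Prop := σ.lab v ≠ 0 ∨ σ.budget = 0

theorem Progress.done {τ : Partial n} (h : Progress I Near S σ τ) {v : Fin n} (hv : σ.Done v) :
    τ.Done v :=
  hv.imp (h.lab v) h.budget

end Partial

/-- The partial clustering stored in the memory. -/
def Memory.part (s : Memory) (n : ℕ) : Partial n where
  lab v := s.nat 8 v 0
  root i := s.nat 3 i 0
  num := s.nat 9 0 0
  budget := s.nat 11 0 0

/-- The edges within the connected balls of the centers of colour `j`. -/
def Instance.Link {n : ℕ} (I : Instance n) (D : ℝ) (S : Finset (Fin n)) (col : Fin n → ℕ) (j : ℕ)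
    (u v : Fin n) : Prop :=
  I.graph.Adj u v ∧ ∃ c ∈ S, col c = j ∧ u ∈ I.ball D c ∧ v ∈ I.ball D c

theorem Instance.reach_link_of_mem_ball {n : ℕ} {I : Instance n} {D : ℝ} {S : Finset (Fin n)}
    {col : Fin n → ℕ} {c v : Fin n} (hc : c ∈ S) (hv : v ∈ I.ball D c) :
    Relation.ReflTransGen (I.Link D S col (col c)) c v := by
  have key : ∀ w, Relation.ReflTransGen (fun u w => I.graph.Adj u w ∧ I.dist c w ≤ D) c w →
      Relation.ReflTransGen (I.Link D S col (col c)) c w := by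
    intro w hw
    induction hw with
    | refl => exact .refl
    | tail hab hbc ih => exact ih.tail ⟨hbc.1, c, hc, rfl, hab, hab.tail hbc⟩
  exact key v hv

namespace Code

/-! ### Merging the balls into disjoint clusters -/

/-- Opens a new cluster whose root is the point in the variable `21`. -/
def seed : Code :=
  block [
    setEntry 8 (var 21) (.add (var 9) (.lit 1)),
    setEntry 3 (var 9) (var 21),
    set 9 (.add (var 9) (.lit 1))]

/-- Opens new clusters for the unassigned centers of the current colour. -/
def seedLayer : Code :=
  loop 21 .pts (guard (Test.all [.eq (entry 5 (var 21)) (.lit 1), .eq (entry 10 (var 21)) (var 20),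
    .eq (entry 8 (var 21)) (.lit 0)]) seed)

/-- Attaches the point in the variable `24` to the cluster of the point in the variable `23` if
this is possible along an edge in the ball of the center in the variable `21`. -/
def growStep : Code :=
  guard (Test.all [.eq (entry 5 (var 21)) (.lit 1), .eq (entry 10 (var 21)) (var 20),
      .eq (.read 4 (var 21) (var 23)) (.lit 1), .eq (.read 4 (var 21) (var 24)) (.lit 1),
      .eq (.read 1 (var 23) (var 24)) (.lit 1), .not (.eq (entry 8 (var 23)) (.lit 0)),
      .eq (entry 8 (var 24)) (.lit 0), .natLE (.lit 1) (var 11)])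
    (block [setEntry 8 (var 24) (entry 8 (var 23)), set 11 (.sub (var 11) (.lit 1))])

/-- Grows the clusters along all edges in the balls of the current colour. -/
def growRound : Code := loop 21 .pts (loop 23 .pts (loop 24 .pts growStep))

/-- Covers the balls of the centers of the colour in the variable `20`. -/
def layer : Code := block [seedLayer, loop 22 .pts growRound]

/-- Clears the partial clustering and sets the budget to `n - k`. -/
def mergeStart : Code :=
  block [
    set 9 (.lit 0),
    set 11 (.sub (.read 0 (.lit 0) (.lit 0)) (.read 0 (.lit 0) (.lit 1))),
    loop 21 .pts (setEntry 8 (var 21) (.lit 0))]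

/-- Covers the balls of all centers, colour by colour, turns the remaining points into clusters of
their own and writes the output. -/
def merge : Code :=
  block [
    mergeStart,
    loop 20 .all layer,
    loop 21 .pts (guard (.eq (entry 8 (var 21)) (.lit 0)) seed),
    loop 21 .pts (setEntry 2 (var 21) (.sub (entry 8 (var 21)) (.lit 1)))]

variable {n : ℕ} {I : Instance n} {m : ℕ} {x : Fin n → Fin m → ℝ} {s : Memory}
  {D : ℝ} {S : Finset (Fin n)} {col : Fin n → ℕ} {Near : Fin n → Fin n → Prop}

/-- The memory contains the connected balls, the centers and their colours. -/
structure Coloured (I : Instance n) (D : ℝ) (S : Finset (Fin n)) (col : Fin n → ℕ) (s : Memory) :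
    Prop where
  ball : ∀ c v : Fin n, s.nat 4 c v = 1 ↔ v ∈ I.ball D c
  center : ∀ c : Fin n, s.nat 5 c 0 = 1 ↔ c ∈ S
  colour : ∀ c : Fin n, s.nat 10 c 0 = col c

theorem Coloured.congr {s' : Memory} (h : Coloured I D S col s) (h4 : s'.nat 4 = s.nat 4)
    (h5 : s'.nat 5 = s.nat 5) (h10 : s'.nat 10 = s.nat 10) : Coloured I D S col s' :=
  ⟨by rw [h4]; exact h.ball, by rw [h5]; exact h.center, by rw [h10]; exact h.colour⟩

theorem seed_run (c : Fin n) (hc : s.nat 21 0 0 = c) :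
    (seed.run s).part n = (s.part n).seed c := by
  simp only [seed, Memory.part, Partial.seed, run_block_cons, run_block_nil, run_setEntry, run_set,
    eval_var, NatExp.eval, hc, Memory.nat_writeNat, Partial.mk.injEq]
  refine ⟨funext fun v => ?_, funext fun i => ?_, ?_, ?_⟩
  · simp [Fin.val_inj]
  · by_cases h : i = s.nat 9 0 0 <;> simp [h]
  · simp
  · simp

theorem seedLayer_run {j : ℕ} (hs : Loaded I x s) (hC : Coloured I D S col s)
    (hj : s.nat 20 0 0 = j) (hN : ∀ c, Near c c) :
    Partial.Progress I Near S (s.part n) ((seedLayer.run s).part n) ∧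
      ∀ c ∈ S, col c = j → ((seedLayer.run s).part n).lab c ≠ 0 := by
  refine run_loop_each (s₀ := s) (a := 21) (N := .pts) hs.pts
    (fun s' => Partial.Progress I Near S (s.part n) (s'.part n))
    (fun c s' => c ∈ S → col c = j → (s'.part n).lab c ≠ 0) (.refl _) ?_
  intro c s' hA hc hP
  have hC' := hC.congr (hA.nat 4 (by decide)) (hA.nat 5 (by decide)) (hA.nat 10 (by decide))
  have hj' : s'.nat 20 0 0 = j := by rw [hA.nat 20 (by decide)]; exact hj
  simp only [run_guard]
  split_ifs with h <;> simp only [Test.holds_all_cons, Test.holds_all_nil, Test.holds_eq,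
    NatExp.eval, eval_var, eval_entry, hc, hj', hC'.center, hC'.colour, and_true] at h
  · rw [seed_run c hc]
    have := Partial.progress_seed (I := I) (Near := Near) (σ := s'.part n) h.2.2 h.1 (hN c)
    exact ⟨hP.trans this, fun _ _ => by simp [Partial.seed],
      fun c' _ H h1 h2 => this.lab c' (H h1 h2)⟩
  · exact ⟨hP, fun h1 h2 h3 => h ⟨h1, h2, h3⟩, fun _ _ H => H⟩

theorem growStep_run {j : ℕ} (hs : Loaded I x s) (hC : Coloured I D S col s)
    (hN : ∀ c u v, Near c u → I.Link D S col j u v → Near c v)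
    (hj : s.nat 20 0 0 = j) (c u v : Fin n) (hc : s.nat 21 0 0 = c)
    (hu : s.nat 23 0 0 = u) (hv : s.nat 24 0 0 = v) :
    Partial.Progress I Near S (s.part n) ((growStep.run s).part n) ∧
      (I.graph.Adj u v → c ∈ S → col c = j → u ∈ I.ball D c → v ∈ I.ball D c →
        (s.part n).Done u → ((growStep.run s).part n).Done v) := by
  unfold growStep
  simp only [run_guard]
  split_ifs with h <;> simp only [Test.holds_all_cons, Test.holds_all_nil, Test.holds_eq,
    Test.holds_not, Test.holds_natLE,
    NatExp.eval, eval_var, eval_entry, hc, hj, hu, hv, hC.center, hC.colour, hC.ball, hs.adj,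
    and_true] at h
  · obtain ⟨h1, h2, h3, h4, h5, h6, h7, h8⟩ := h
    have hrun : Memory.part ((block [setEntry 8 (var 24) (entry 8 (var 23)),
        set 11 (.sub (var 11) (.lit 1))]).run s) n = (s.part n).attach u v := by
      simp [Memory.part, Partial.attach, hu, hv, Fin.val_inj]
    rw [hrun]
    refine ⟨Partial.progress_attach h6 h7 h8 h5 fun c' hc' => hN c' u v hc' ⟨h5, c, h1, h2, h3, h4⟩,
      fun _ _ _ _ _ _ => Or.inl ?_⟩
    simpa [Partial.attach, Memory.part] using h6
  · refine ⟨.refl _, fun h5 h1 h2 h3 h4 hd => ?_⟩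
    by_contra hd'
    simp only [Partial.Done, Memory.part, not_or, not_not] at hd hd'
    exact h ⟨h1, h2, h3, h4, h5, hd.resolve_right hd'.2, hd'.1, by omega⟩

theorem growRound_run {j : ℕ} (hs : Loaded I x s) (hC : Coloured I D S col s)
    (hN : ∀ c u v, Near c u → I.Link D S col j u v → Near c v) (hj : s.nat 20 0 0 = j) :
    Partial.Progress I Near S (s.part n) ((growRound.run s).part n) ∧
      ∀ u v, I.Link D S col j u v → (s.part n).Done u → ((growRound.run s).part n).Done v := by
  have := run_loop_each (s₀ := s) (a := 21) (N := .pts) (p := loop 23 .pts (loop 24 .pts growStep))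
    hs.pts
    (fun s' => Partial.Progress I Near S (s.part n) (s'.part n))
    (fun c s' => ∀ u v, I.graph.Adj u v → c ∈ S → col c = j → u ∈ I.ball D c → v ∈ I.ball D c →
        (s.part n).Done u → (s'.part n).Done v) (.refl _) ?_
  · exact ⟨this.1, fun u v ⟨h1, c, h2, h3, h4, h5⟩ => this.2 c u v h1 h2 h3 h4 h5⟩
  intro c s₁ hA₁ hc hP₁
  have hs₁ := hs.agree hA₁
  have := run_loop_each (s₀ := s₁) (a := 23) (N := .pts) (p := loop 24 .pts growStep) hs₁.pts
    (fun s' => Partial.Progress I Near S (s₁.part n) (s'.part n))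
    (fun u s' => ∀ v, I.graph.Adj u v → c ∈ S → col c = j → u ∈ I.ball D c → v ∈ I.ball D c →
        (s₁.part n).Done u → (s'.part n).Done v) (.refl _) ?_
  · exact ⟨hP₁.trans this.1, fun u v h1 h2 h3 h4 h5 h6 => this.2 u v h1 h2 h3 h4 h5 (hP₁.done h6),
      fun c' _ H u v h1 h2 h3 h4 h5 h6 => this.1.done (H u v h1 h2 h3 h4 h5 h6)⟩
  intro u s₂ hA₂ hu hP₂
  have hs₂ := hs₁.agree hA₂
  have := run_loop_each (s₀ := s₂) (a := 24) (N := .pts) (p := growStep) hs₂.pts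
    (fun s' => Partial.Progress I Near S (s₂.part n) (s'.part n))
    (fun v s' => I.graph.Adj u v → c ∈ S → col c = j → u ∈ I.ball D c → v ∈ I.ball D c →
        (s₂.part n).Done u → (s'.part n).Done v) (.refl _) ?_
  · exact ⟨hP₂.trans this.1, fun v h1 h2 h3 h4 h5 h6 => this.2 v h1 h2 h3 h4 h5 (hP₂.done h6),
      fun c' _ H v h1 h2 h3 h4 h5 h6 => this.1.done (H v h1 h2 h3 h4 h5 h6)⟩
  intro v s₃ hA₃ hv hP₃
  have hs₃ := hs₂.agree hA₃
  have hC₃ : Coloured I D S col s₃ := ((hC.congr (hA₁.nat 4 (by decide)) (hA₁.nat 5 (by decide))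
    (hA₁.nat 10 (by decide))).congr (hA₂.nat 4 (by decide)) (hA₂.nat 5 (by decide))
    (hA₂.nat 10 (by decide))).congr (hA₃.nat 4 (by decide)) (hA₃.nat 5 (by decide))
    (hA₃.nat 10 (by decide))
  obtain ⟨e1, e2⟩ := growStep_run hs₃ hC₃ hN
    (by rw [hA₃.nat 20 (by decide), hA₂.nat 20 (by decide), hA₁.nat 20 (by decide), hj]) c u v
    (by rw [hA₃.nat 21 (by decide), hA₂.nat 21 (by decide), hc])
    (by rw [hA₃.nat 23 (by decide), hu]) hv
  exact ⟨hP₃.trans e1, fun h1 h2 h3 h4 h5 h6 => e2 h1 h2 h3 h4 h5 (hP₃.done h6),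
    fun c' _ H h1 h2 h3 h4 h5 h6 => e1.done (H h1 h2 h3 h4 h5 h6)⟩

theorem layer_run {j : ℕ} (hs : Loaded I x s) (hC : Coloured I D S col s)
    (hN₀ : ∀ c, Near c c) (hN : ∀ c u v, Near c u → I.Link D S col j u v → Near c v)
    (hj : s.nat 20 0 0 = j) :
    Partial.Progress I Near S (s.part n) ((layer.run s).part n) ∧
      ∀ c ∈ S, col c = j → ∀ v ∈ I.ball D c, ((layer.run s).part n).Done v := by
  unfold layer
  simp only [run_block_cons, run_block_nil]
  obtain ⟨h1, h2⟩ := seedLayer_run (Near := Near) hs hC hj hN₀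
  have hs₁ : Loaded I x (seedLayer.run s) := hs.run
  have hC₁ : Coloured I D S col (seedLayer.run s) := hC.congr (nat_run (by decide) _)
    (nat_run (by decide) _) (nat_run (by decide) _)
  have hj₁ : (seedLayer.run s).nat 20 0 0 = j := by rw [nat_run (by decide)]; exact hj
  generalize seedLayer.run s = s₁ at *
  have := run_loop_fin (s₀ := s₁) (a := 22) (N := .pts) (p := growRound) hs₁.pts
    (fun t s' => Partial.Progress I Near S (s₁.part n) (s'.part n) ∧
      ∀ u, (s₁.part n).Done u → ∀ v ∈ within (I.Link D S col j) u t, (s'.part n).Done v)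
    ⟨.refl _, fun u hu v hv => by rw [show v = u from hv]; exact hu⟩ ?_
  · refine ⟨h1.trans this.1, fun c hc hcj v hv => ?_⟩
    refine this.2 c (Or.inl (h2 c hc hcj)) v (mem_within ?_)
    rw [← hcj]
    exact Instance.reach_link_of_mem_ball hc hv
  · intro t s₂ hA ht ⟨g1, g2⟩
    obtain ⟨e1, e2⟩ := growRound_run (hs₁.agree hA) (hC₁.congr (hA.nat 4 (by decide))
      (hA.nat 5 (by decide)) (hA.nat 10 (by decide))) hN
      (by rw [hA.nat 20 (by decide)]; exact hj₁)
    refine ⟨g1.trans e1, fun u hu v hv => ?_⟩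
    rcases hv with hv | ⟨w, hw, hwv⟩
    · exact e1.done (g2 u hu v hv)
    · exact e2 w v hwv (g2 u hu w hw)

theorem mergeStart_run (hs : Loaded I x s) :
    ((mergeStart.run s).part n).Valid I Near ∧ ((mergeStart.run s).part n).num = 0 := by
  unfold mergeStart
  simp only [run_block_cons, run_block_nil]
  have hs₁ : Loaded I x ((set 9 (.lit 0)).run s) := hs.run
  have h9 : ((set 9 (.lit 0)).run s).nat 9 0 0 = 0 := by simp
  generalize (set 9 (.lit 0)).run s = s₁ at *
  have hs₂ : Loaded I x
      ((set 11 (.sub (.read 0 (.lit 0) (.lit 0)) (.read 0 (.lit 0) (.lit 1)))).run s₁) := hs₁.run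
  have h9' : ((set 11 (.sub (.read 0 (.lit 0) (.lit 0)) (.read 0 (.lit 0) (.lit 1)))).run s₁).nat
      9 0 0 = 0 := by rw [nat_run (by decide)]; exact h9
  have h11 : ((set 11 (.sub (.read 0 (.lit 0) (.lit 0)) (.read 0 (.lit 0) (.lit 1)))).run s₁).nat
      11 0 0 = n - I.k := by simp [hs₁.size, hs₁.clusters]
  generalize (set 11 (.sub (.read 0 (.lit 0) (.lit 0)) (.read 0 (.lit 0) (.lit 1)))).run s₁ = s₂ at *
  have h8 := (run_loop_each (n := n) (s₀ := s₂) (a := 21) (N := .pts)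
    (p := setEntry 8 (var 21) (.lit 0)) hs₂.pts (fun _ => True)
    (fun v s' => s'.nat 8 v 0 = 0) trivial (by
      intro v s' _ hv _
      refine ⟨trivial, by simp [hv], fun v' _ h => by simp [h]⟩)).2
  have h9'' : ((loop 21 .pts (setEntry 8 (var 21) (.lit 0))).run s₂).nat 9 0 0 = 0 := by
    rw [nat_run (by decide)]; exact h9'
  have h11'' : ((loop 21 .pts (setEntry 8 (var 21) (.lit 0))).run s₂).nat 11 0 0 = n - I.k := by
    rw [nat_run (by decide)]; exact h11
  generalize (loop 21 .pts (setEntry 8 (var 21) (.lit 0))).run s₂ = s₃ at *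
  refine ⟨⟨?_, fun v => ?_, fun i hi => ?_, fun v hv => absurd (h8 v) hv⟩, h9''⟩
  · simp [Partial.assigned, Memory.part, h8, h9'', h11'']
  · simp [Memory.part, h8]
  · simp [Memory.part, h9''] at hi

/-- The result of the merging phase: exactly `k` connected clusters whose points are close to the
roots. The function `β` bounds the distance of a point to the root of its cluster after the layers
`0, …, j - 1`. -/
theorem merge_run (hs : Loaded I x s) (hC : Coloured I D S col s) (hS : I.IsGreedy D S)
    (hk : S.card ≤ I.k) (hcol : ∀ c ∈ S, col c < n + m + 1) (β : ℕ → ℝ) (hβ₀ : 0 ≤ β 0)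
    (hβ : ∀ j u v, Relation.ReflTransGen (I.Link D S col j) u v → β j + I.dist u v ≤ β (j + 1)) :
    IsDisjointClustering I.graph ((merge.run s).clusters n I.k) ∧
    ∃ c : Fin I.k → Fin n, (∀ i : Fin I.k, (merge.run s).nat 3 i 0 = c i) ∧
      (∀ i, c i ∈ (merge.run s).clusters n I.k i) ∧
      ∀ i, ∀ v ∈ (merge.run s).clusters n I.k i, I.dist (c i) v ≤ β (n + m + 1) := by
  unfold merge
  simp only [run_block_cons, run_block_nil]
  have hβm : Monotone β := monotone_nat_of_le_succ fun j => by
    have hn : 0 < n := lt_of_lt_of_le I.one_le_k I.k_le_n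
    have := hβ j ⟨0, hn⟩ ⟨0, hn⟩ .refl
    rwa [Instance.dist_self, add_zero] at this
  obtain ⟨hv₁, hn₁⟩ := mergeStart_run (Near := fun c v => I.dist c v ≤ β 0) hs
  have hs₁ : Loaded I x (mergeStart.run s) := hs.run
  have hC₁ : Coloured I D S col (mergeStart.run s) := hC.congr (nat_run (by decide) _)
    (nat_run (by decide) _) (nat_run (by decide) _)
  generalize mergeStart.run s = s₁ at *
  have := run_loop (s₀ := s₁) (a := 20) (N := .all) (p := layer) rfl hs₁.all
    (fun j s' => (s'.part n).Valid I (fun c v => I.dist c v ≤ β j) ∧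
      (s'.part n).num ≤ (S.filter fun v => (s'.part n).lab v ≠ 0).card ∧
      ∀ c ∈ S, col c < j → ∀ v ∈ I.ball D c, (s'.part n).Done v)
    ⟨hv₁, by rw [hn₁]; exact Nat.zero_le _, fun c _ hc => absurd hc (by omega)⟩ ?_
  · have hs₂ : Loaded I x ((loop 20 .all layer).run s₁) := hs₁.run
    generalize (loop 20 .all layer).run s₁ = s₂ at *
    obtain ⟨h1, h2, h3⟩ := this
    have hdone : ∀ v, (s₂.part n).Done v := fun v => by
      obtain ⟨c, hc, hv⟩ := hS.cover v
      exact h3 c hc (hcol c hc) v hv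
    have hkn := I.k_le_n
    -- an unused budget would mean that all points are assigned to clusters opened by centers, of which
    -- there are at most `k`; but then at least `n - k` points have been attached
    have hbud : (s₂.part n).budget = 0 := by
      by_contra hb
      have hall : (s₂.part n).assigned = n := by
        unfold Partial.assigned
        rw [Finset.filter_true_of_mem fun v _ => (hdone v).resolve_right hb]
        simp
      have := h1.count
      have := h2.trans (Finset.card_filter_le _ _)
      omega
    -- as the budget is spent, `n - k` points have been attached, and turning all remaining points into
    -- clusters of their own leads to exactly `k` clusters
    have := run_loop_each (s₀ := s₂) (a := 21) (N := .pts)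
      (p := guard (.eq (entry 8 (var 21)) (.lit 0)) seed) hs₂.pts
      (fun s' => (s'.part n).Valid I (fun c v => I.dist c v ≤ β (n + m + 1)) ∧
        (s'.part n).budget = 0) (fun v s' => (s'.part n).lab v ≠ 0) ⟨h1, hbud⟩ ?_
    · obtain ⟨⟨g1, g2⟩, g3⟩ := this
      have hs₃ : Loaded I x
        ((loop 21 .pts (guard (.eq (entry 8 (var 21)) (.lit 0)) seed)).run s₂) := hs₂.run
      generalize (loop 21 .pts (guard (.eq (entry 8 (var 21)) (.lit 0)) seed)).run s₂ = s₃ at *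
      have hout := (run_loop_each (n := n) (s₀ := s₃) (a := 21) (N := .pts)
        (p := setEntry 2 (var 21) (.sub (entry 8 (var 21)) (.lit 1))) hs₃.pts (fun _ => True)
        (fun v s' => s'.nat 2 v 0 = (s₃.part n).lab v - 1) trivial (by
          intro v s' hA hv _
          refine ⟨trivial, ?_, fun v' hlt h => ?_⟩
          · simp [hv, Memory.part, hA.nat 8 (by decide)]
          · have : (v' : ℕ) ≠ v := Fin.val_ne_of_ne hlt.ne
            simp [hv, this, h])).2
      have hroot : ((loop 21 .pts (setEntry 2 (var 21) (.sub (entry 8 (var 21)) (.lit 1)))).run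
          s₃).nat 3 = s₃.nat 3 := nat_run (by decide) _
      generalize (loop 21 .pts (setEntry 2 (var 21) (.sub (entry 8 (var 21)) (.lit 1)))).run s₃ =
        s₄ at *
      have hnum : (s₃.part n).num = I.k := by
        have := g1.count
        have hall : (s₃.part n).assigned = n := by
          unfold Partial.assigned
          rw [Finset.filter_true_of_mem fun v _ => g3 v]
          simp
        omega
      have hmem : ∀ (i : Fin I.k) v, v ∈ s₄.clusters n I.k i ↔ (s₃.part n).lab v = i + 1 := by
        intro i v
        have := g3 v
        simp only [Memory.clusters, Set.mem_ofPred_eq, hout]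
        omega
      have hc : ∀ i : Fin I.k, ∃ c : Fin n, s₄.nat 3 i 0 = c ∧ c ∈ s₄.clusters n I.k i ∧
          ∀ v ∈ s₄.clusters n I.k i, Relation.ReflTransGen (fun u w => I.graph.Adj u w ∧
            u ∈ s₄.clusters n I.k i ∧ w ∈ s₄.clusters n I.k i) c v ∧
            I.dist c v ≤ β (n + m + 1) := by
        intro i
        have key : ∀ v, (s₃.part n).lab v = i + 1 → ∃ c : Fin n, s₄.nat 3 i 0 = c ∧
            c ∈ s₄.clusters n I.k i ∧ Relation.ReflTransGen (fun u w => I.graph.Adj u w ∧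
            u ∈ s₄.clusters n I.k i ∧ w ∈ s₄.clusters n I.k i) c v ∧
            I.dist c v ≤ β (n + m + 1) := by
          intro v hv
          obtain ⟨c, e1, e2, e3, e4⟩ := g1.rooted v (g3 v)
          simp only [hv] at e1 e2 e3
          refine ⟨c, by rw [hroot]; exact e1, (hmem i c).2 e2, ?_, e4⟩
          simpa only [hmem] using e3
        obtain ⟨v₀, hv₀⟩ := g1.used i (by rw [hnum]; exact i.2)
        obtain ⟨c, e1, e2, -⟩ := key v₀ hv₀
        refine ⟨c, e1, e2, fun v hv => ?_⟩
        obtain ⟨c', f1, -, f3⟩ := key v ((hmem i v).1 hv)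
        rw [Fin.ext (e1.symm.trans f1)]
        exact f3
      choose c hc1 hc2 hc3 using hc
      refine ⟨⟨fun v => ?_, fun i j hij => ?_, fun i => ?_⟩, c, hc1, hc2,
        fun i v hv => (hc3 i v hv).2⟩
      · have h4 := g1.lab_le v
        have h5 := g3 v
        exact ⟨⟨(s₃.part n).lab v - 1, by omega⟩, (hmem _ v).2 (by simp only; omega)⟩
      · refine Set.disjoint_left.2 fun v hvi hvj => hij (Fin.ext ?_)
        have h4 := (hmem i v).1 hvi
        have h5 := (hmem j v).1 hvj
        omega
      · rw [SimpleGraph.connected_iff_exists_forall_reachable]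
        refine ⟨⟨c i, hc2 i⟩, fun ⟨v, hv⟩ => ?_⟩
        have : ∀ w, Relation.ReflTransGen (fun u w => I.graph.Adj u w ∧
            u ∈ s₄.clusters n I.k i ∧ w ∈ s₄.clusters n I.k i) (c i) w →
            ∀ hw : w ∈ s₄.clusters n I.k i,
              (I.graph.induce (s₄.clusters n I.k i)).Reachable ⟨c i, hc2 i⟩ ⟨w, hw⟩ := by
          intro w hw
          induction hw with
          | refl => exact fun _ => .rfl
          | tail _ hbc ih =>
            exact fun hw => (ih hbc.2.1).trans (SimpleGraph.Adj.reachable hbc.1)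
        exact this v (hc3 i v hv).1 hv
    · intro v s' hA hv ⟨e1, e2⟩
      simp only [run_guard]
      split_ifs with h <;> simp only [Test.holds_eq, NatExp.eval, eval_var, eval_entry, hv] at h
      · rw [seed_run v hv]
        refine ⟨⟨e1.seed h ?_, e2⟩, by simp [Partial.seed], fun v' _ hv' => ?_⟩
        · rw [Instance.dist_self]
          exact hβ₀.trans (hβm (Nat.zero_le _))
        · simp only [Partial.seed]
          split_ifs
          · omega
          · exact hv'
      · exact ⟨⟨e1, e2⟩, h, fun _ _ H => H⟩
  · intro j hj s' hA hj' ⟨e1, e2, e3⟩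
    obtain ⟨f1, f2⟩ := layer_run (j := j)
      (Near := fun c v => ∃ u, I.dist c u ≤ β j ∧
        Relation.ReflTransGen (I.Link D S col j) u v) (hs₁.agree hA)
      (hC₁.congr (hA.nat 4 (by decide)) (hA.nat 5 (by decide)) (hA.nat 10 (by decide)))
      (fun c => ⟨c, by rw [Instance.dist_self]; exact hβ₀.trans (hβm (Nat.zero_le _)), .refl⟩)
      (fun c u v ⟨w, hw, hwu⟩ huv => ⟨w, hw, hwu.tail huv⟩) hj'
    refine ⟨(f1.valid (e1.mono fun c v h => ⟨v, h, .refl⟩)).mono ?_, f1.num e2,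
      fun c hc hcj v hv => ?_⟩
    · rintro c v ⟨u, h1, h2⟩
      have := I.dist_triangle c u v
      have := hβ j u v h2
      linarith
    · rcases Nat.lt_succ_iff_lt_or_eq.1 hcj with h | h
      · exact f1.done (e3 c hc h v hv)
      · exact f2 c hc h v hv

end Code

/-! ### From colourings to approximation guarantees -/

/-- A colouring of the centers with colours less than `l` such that any two centers that are joined
by a chain of centers of the same colour with steps of length at most `2 * D` have distance at most
`H`. -/
structure Instance.IsColouring {n : ℕ} (I : Instance n) (D : ℝ) (S : Finset (Fin n))
    (col : Fin n → ℕ) (l : ℕ) (H : ℝ) : Prop where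
  lt : ∀ c ∈ S, col c < l
  dist_le : ∀ c c', Relation.ReflTransGen
    (fun a b => (a ∈ S ∧ b ∈ S) ∧ col a = col b ∧ I.dist a b ≤ 2 * D) c c' → I.dist c c' ≤ H

namespace Instance

variable {n : ℕ} {I : Instance n} {D H : ℝ} {S : Finset (Fin n)} {col : Fin n → ℕ} {l : ℕ}

theorem IsColouring.link_dist (h : I.IsColouring D S col l H) (hD : 0 ≤ D) {j : ℕ} {u v : Fin n}
    (huv : Relation.ReflTransGen (I.Link D S col j) u v) :
    u = v ∨ j < l ∧ I.dist u v ≤ H + 2 * D := by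
  have key : u = v ∨ ∃ c ∈ S, ∃ c' ∈ S, col c = j ∧ col c' = j ∧ u ∈ I.ball D c ∧
      v ∈ I.ball D c' ∧ Relation.ReflTransGen
        (fun a b => (a ∈ S ∧ b ∈ S) ∧ col a = col b ∧ I.dist a b ≤ 2 * D) c c' := by
    induction huv with
    | refl => exact Or.inl rfl
    | @tail v w _ hvw ih =>
      right
      obtain ⟨-, c₁, h1, h2, h3, h4⟩ := hvw
      rcases ih with rfl | ⟨c, hc, c', hc', hj, hj', hu, hv, hcc⟩
      · exact ⟨c₁, h1, c₁, h1, h2, h2, h3, h4, .refl⟩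
      · refine ⟨c, hc, c₁, h1, hj, h2, hu, h4, hcc.tail ⟨⟨hc', h1⟩, by rw [hj', h2], ?_⟩⟩
        have := I.dist_triangle c' v c₁
        have := dist_le_of_mem_ball hD hv
        have := dist_le_of_mem_ball hD h3
        rw [I.dist_comm] at this
        linarith
  rcases key with h' | ⟨c, hc, c', hc', hj, hj', hu, hv, hcc⟩
  · exact Or.inl h'
  · right
    refine ⟨by rw [← hj]; exact h.lt c hc, ?_⟩
    have h1 := h.dist_le c c' hcc
    have h2 := I.dist_triangle u c v
    have h3 := I.dist_triangle c c' v
    have h4 := dist_le_of_mem_ball hD hu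
    have h5 := dist_le_of_mem_ball hD hv
    rw [I.dist_comm] at h4
    linarith

end Instance

namespace Code

variable {n : ℕ} {I : Instance n} {m : ℕ} {x : Fin n → Fin m → ℝ} {s : Memory} {D : ℝ}

/-- The memory contains the threshold `D` and the greedy centers `S`. -/
structure Centered (I : Instance n) (x : Fin n → Fin m → ℝ) (D : ℝ) (S : Finset (Fin n))
    (s : Memory) : Prop where
  loaded : Loaded I x s
  radius : s.real 2 0 0 = D
  center : ∀ c : Fin n, s.nat 5 c 0 = 1 ↔ c ∈ S

/-- The program writes a colouring of the centers into array `10` that is good enough for the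
approximation factor `α`. -/
def Colours (p : Code) (I : Instance n) (x : Fin n → Fin m → ℝ) (α : ℝ) : Prop :=
  ∀ (s : Memory) (D : ℝ) (S : Finset (Fin n)), Centered I x D S s → 0 ≤ D → S.card ≤ I.k →
    (∀ c ∈ S, (p.run s).nat 10 c 0 < n + m + 1) ∧ ∃ (l : ℕ) (H : ℝ),
      I.IsColouring D S (fun c => (p.run s).nat 10 c 0) l H ∧ 2 * (l * (H + 2 * D)) ≤ α * D

/-- The whole algorithm, for a given colouring procedure. -/
def pipeline (p : Code) : Code := block [threshold, p, merge]

/-- The colouring procedure changes only the colours and scratch arrays. -/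
def isColouringCode (p : Code) : Bool :=
  p.ok && p.keepsInput && !(p.natWrites.contains 4) && !(p.natWrites.contains 5)

theorem pipeline_run {p : Code} (hp : p.isColouringCode) {α : ℝ} (hα : Colours p I x α)
    (hs : Loaded I x s) (hI : I.Feasible) :
    ∃ D B : ℝ, 2 * B ≤ α * D ∧
      (∀ (C : Fin I.k → Set (Fin n)) (R : ℝ), IsDisjointClustering I.graph C →
        (∀ i, ∀ u ∈ C i, ∀ v ∈ C i, I.dist u v ≤ R) → D ≤ R) ∧
      IsDisjointClustering I.graph (((pipeline p).run s).clusters n I.k) ∧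
      ∃ c : Fin I.k → Fin n, (∀ i : Fin I.k, ((pipeline p).run s).nat 3 i 0 = c i) ∧
        (∀ i, c i ∈ ((pipeline p).run s).clusters n I.k i) ∧
        ∀ i, ∀ v ∈ ((pipeline p).run s).clusters n I.k i, I.dist (c i) v ≤ B := by
  simp only [isColouringCode, Bool.and_eq_true, Bool.not_eq_true', List.contains_eq_mem,
    decide_eq_false_iff_not] at hp
  obtain ⟨⟨⟨-, hp1⟩, hp4⟩, hp5⟩ := hp
  obtain ⟨D, hD, hball, hg, hfeas⟩ := threshold_run hs
  obtain ⟨hk, h0, hopt⟩ := hfeas hI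
  have hs₁ : Loaded I x (threshold.run s) := hs.run
  unfold pipeline
  simp only [run_block_cons, run_block_nil]
  generalize threshold.run s = s₁ at *
  obtain ⟨hlt, l, H, hcol, hle⟩ := hα s₁ D (s₁.marked n 5) ⟨hs₁, hD, fun c => by simp⟩ h0 hk
  have hs₂ : Loaded I x (p.run s₁) := hs₁.run hp1
  have hH : 0 ≤ H := by
    have hn : 0 < n := lt_of_lt_of_le I.one_le_k I.k_le_n
    have := hcol.dist_le ⟨0, hn⟩ ⟨0, hn⟩ .refl
    rwa [Instance.dist_self] at this
  have hmin : ∀ j : ℕ, (((min j l : ℕ) : ℝ)) ≤ ((min (j + 1) l : ℕ) : ℝ) := fun j => by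
    exact_mod_cast min_le_min_right l (Nat.le_succ j)
  obtain ⟨h1, c, h2, h3, h4⟩ := merge_run (col := fun c => (p.run s₁).nat 10 c 0) hs₂
    ⟨by rw [nat_run hp4]; exact hball, by rw [nat_run hp5]; simp, fun _ => rfl⟩ hg hk hlt
    (fun j => ((min j l : ℕ) : ℝ) * (H + 2 * D)) (by simp) (by
      intro j u v huv
      rcases hcol.link_dist h0 huv with rfl | ⟨hj, hd⟩
      · rw [Instance.dist_self, add_zero]
        exact mul_le_mul_of_nonneg_right (hmin j) (by positivity)
      · have : ((min (j + 1) l : ℕ) : ℝ) = ((min j l : ℕ) : ℝ) + 1 := by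
          rw [min_eq_left hj, min_eq_left hj.le]
          push_cast
          rfl
        simp only [this, add_mul, one_mul]
        linarith)
  refine ⟨D, l * (H + 2 * D), hle, hopt, h1, c, h2, h3, fun i v hv => (h4 i v hv).trans ?_⟩
  refine mul_le_mul_of_nonneg_right ?_ (by positivity)
  exact_mod_cast min_le_right _ _

end Code

section Costs

variable {n : ℕ} {I : Instance n} {k : ℕ} {C : Fin k → Set (Fin n)}

theorem dist_le_maxDiameter (d : Fin n → Fin n → ℝ) {i : Fin k} {u v : Fin n} (hu : u ∈ C i)
    (hv : v ∈ C i) : d u v ≤ maxDiameter d C :=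
  le_ciSup (f := fun q : {q : Fin k × Fin n × Fin n // q.2.1 ∈ C q.1 ∧ q.2.2 ∈ C q.1} =>
    d q.1.2.1 q.1.2.2) (Set.finite_range _).bddAbove ⟨(i, u, v), hu, hv⟩

theorem dist_le_maxRadius (d : Fin n → Fin n → ℝ) (c : Fin k → Fin n) {i : Fin k} {u : Fin n}
    (hu : u ∈ C i) : d u (c i) ≤ maxRadius d C c :=
  le_ciSup (f := fun q : {q : Fin k × Fin n // q.2 ∈ C q.1} => d q.1.2 (c q.1.1))
    (Set.finite_range _).bddAbove ⟨(i, u), hu⟩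

theorem IsDisjointClustering.nonempty {G : SimpleGraph (Fin n)} (hC : IsDisjointClustering G C)
    (i : Fin k) : ∃ u, u ∈ C i := by
  obtain ⟨u⟩ := (hC.connected i).nonempty
  exact ⟨u.1, u.2⟩

end Costs

open Classical in
theorem loaded_input {n : ℕ} (I : Instance n) {m : ℕ} (x : Fin n → Fin m → ℝ) :
    Loaded I x (I.inputWithCoordinates x) where
  size := rfl
  clusters := rfl
  dims := rfl
  adj u v := by simp [Instance.inputWithCoordinates]
  dist u v := by simp [Instance.inputWithCoordinates]
  coord u i := by simp [Instance.inputWithCoordinates]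

/-- An algorithm with a good colouring procedure is an approximation algorithm for both objectives:
the diameter of a cluster is at most twice its radius, in the solution and in the optimum. -/
theorem approximatedBy_pipeline (obj : Objective) {n : ℕ} (I : Instance n) {m : ℕ}
    (x : Fin n → Fin m → ℝ) {p : Code} (hp : p.isColouringCode) {α : ℝ} (hα₀ : 0 ≤ α)
    (hα : Code.Colours p I x α) :
    I.ApproximatedBy obj α (Code.pipeline p).compile (I.inputWithCoordinates x)
      (((Code.pipeline p).timePoly.comp (Polynomial.X + 1)).eval (n + m)) := by
  have hok : (Code.pipeline p).ok := by
    simp only [Code.isColouringCode, Bool.and_eq_true] at hp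
    simp only [Code.pipeline, Code.block, Code.ok, Bool.and_eq_true]
    exact ⟨rfl, hp.1.1.1, rfl, trivial⟩
  obtain ⟨t, ht, hle⟩ := Code.exec_compile hok (I.inputWithCoordinates x)
  refine ⟨_, t, ht, ?_, fun hI => ?_⟩
  · simpa [Instance.inputWithCoordinates, Polynomial.eval_comp] using hle
  · obtain ⟨D, B, hB, hopt, hC, c, h1, h2, h3⟩ :=
      Code.pipeline_run hp hα (loaded_input I x) hI
    generalize (Code.pipeline p).run (I.inputWithCoordinates x) = s at *
    have hk : 0 < I.k := I.one_le_k
    cases obj with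
    | center =>
      refine ⟨hC, c, h1, h2, fun C' c' hC' => ?_⟩
      have hD : D ≤ 2 * maxRadius I.dist C' c' := by
        refine hopt C' _ hC' fun i u hu v hv => ?_
        have e1 := dist_le_maxRadius I.dist c' hu
        have e2 := dist_le_maxRadius I.dist c' hv
        have e3 := I.dist_triangle u (c' i) v
        rw [I.dist_comm v] at e2
        linarith
      have : Nonempty {q : Fin I.k × Fin n // q.2 ∈ s.clusters n I.k q.1} := by
        obtain ⟨u, hu⟩ := hC.nonempty ⟨0, hk⟩
        exact ⟨⟨(⟨0, hk⟩, u), hu⟩⟩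
      refine ciSup_le fun q => ?_
      have e1 := h3 _ _ q.2
      rw [I.dist_comm] at e1
      have e2 := mul_le_mul_of_nonneg_left hD hα₀
      linarith
    | diameter =>
      refine ⟨hC, fun C' hC' => ?_⟩
      have hD : D ≤ maxDiameter I.dist C' :=
        hopt C' _ hC' fun i u hu v hv => dist_le_maxDiameter I.dist hu hv
      have : Nonempty {q : Fin I.k × Fin n × Fin n //
          q.2.1 ∈ s.clusters n I.k q.1 ∧ q.2.2 ∈ s.clusters n I.k q.1} := by
        obtain ⟨u, hu⟩ := hC.nonempty ⟨0, hk⟩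
        exact ⟨⟨(⟨0, hk⟩, u, u), hu, hu⟩⟩
      refine ciSup_le fun q => ?_
      have e1 := h3 _ _ q.2.1
      have e2 := h3 _ _ q.2.2
      have e3 := I.dist_triangle q.1.2.1 (c q.1.1) q.1.2.2
      rw [I.dist_comm] at e1
      have e4 := mul_le_mul_of_nonneg_left hD hα₀
      linarith

/-! ### Colouring the centers of a general metric -/

/-- The state of the construction of the colour class `j + 1`. The set `A₀` of all uncoloured centers
consists of the candidates `A`, the centers of colour `j + 1`, and the postponed centers, which are
at most as many as the centers of colour `j + 1`. The centers of colour `j + 1` form groups of radius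
`ρ` (around the points `g z`) that have distance more than `2 * D` from each other and from the
candidates. -/
structure Instance.Carving {n : ℕ} (I : Instance n) (D ρ : ℝ) (A₀ : Finset (Fin n))
    (col₀ : Fin n → ℕ) (j : ℕ) (A : Finset (Fin n)) (col : Fin n → ℕ) : Prop where
  subset : A ⊆ A₀
  col_eq : ∀ u, col u = col₀ u ∨ (u ∈ A₀ ∧ u ∉ A ∧ col u = j + 1)
  apart : ∀ z ∈ A₀, col z = j + 1 → ∀ a ∈ A, 2 * D < I.dist z a
  groups : ∃ g : Fin n → Fin n, ∀ z ∈ A₀, col z = j + 1 → I.dist (g z) z ≤ ρ ∧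
    ∀ z' ∈ A₀, col z' = j + 1 → I.dist z z' ≤ 2 * D → g z = g z'
  card_le : A₀.card ≤ A.card + 2 * (A₀.filter fun u => col u = j + 1).card

namespace Instance

variable {n : ℕ} {I : Instance n} {D ρ : ℝ} {A₀ A : Finset (Fin n)} {col₀ col : Fin n → ℕ} {j : ℕ}

theorem carving_self (h : ∀ u ∈ A₀, col₀ u ≠ j + 1) : I.Carving D ρ A₀ col₀ j A₀ col₀ :=
  ⟨subset_rfl, fun _ => Or.inl rfl, fun z hz hz' => absurd hz' (h z hz),
    ⟨id, fun z hz hz' => absurd hz' (h z hz)⟩, by omega⟩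

open Classical in
/-- The candidates in a ball of radius `r` form a new group, and those at distance between `r` and
`r + 2 * D` are postponed, which keeps the group separated from all later ones. -/
theorem Carving.carve (h : I.Carving D ρ A₀ col₀ j A col) (h₀ : ∀ u ∈ A₀, col₀ u ≠ j + 1)
    (v : Fin n) {r : ℝ} (hr : r ≤ ρ)
    (hcard : (A.filter fun u => I.dist v u ≤ r + 2 * D).card ≤
      2 * (A.filter fun u => I.dist v u ≤ r).card) (hD : 0 ≤ D)
    {A' : Finset (Fin n)} {col' : Fin n → ℕ}
    (hA' : ∀ u, u ∈ A' ↔ u ∈ A ∧ ¬ I.dist v u ≤ r + 2 * D)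
    (hcol' : ∀ u, col' u = if u ∈ A ∧ I.dist v u ≤ r then j + 1 else col u) :
    I.Carving D ρ A₀ col₀ j A' col' := by
  have hZ : ∀ u, u ∈ A₀ → (col' u = j + 1 ↔ (u ∈ A ∧ I.dist v u ≤ r) ∨ col u = j + 1) := by
    intro u _
    rw [hcol']
    split_ifs with hu <;> simp [hu]
  have hdisj : ∀ u ∈ A, col u ≠ j + 1 := by
    intro u hu hcu
    rcases h.col_eq u with h1 | h1
    · exact h₀ u (h.subset hu) (h1 ▸ hcu)
    · exact h1.2.1 hu
  refine ⟨fun u hu => h.subset ((hA' u).1 hu).1, fun u => ?_, fun z hz hz' a ha => ?_, ?_, ?_⟩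
  · rw [hcol']
    split_ifs with hu
    · refine Or.inr ⟨h.subset hu.1, fun hu' => ((hA' u).1 hu').2 ?_, rfl⟩
      linarith [hu.2]
    · rcases h.col_eq u with h1 | h1
      · exact Or.inl h1
      · exact Or.inr ⟨h1.1, fun hu' => h1.2.1 ((hA' u).1 hu').1, h1.2.2⟩
  · obtain ⟨ha1, ha2⟩ := (hA' a).1 ha
    rcases (hZ z hz).1 hz' with ⟨h1, h2⟩ | h1
    · have := I.dist_triangle v z a
      linarith
    · exact h.apart z hz h1 a ha1
  · obtain ⟨g, hg⟩ := h.groups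
    refine ⟨fun u => if u ∈ A then v else g u, fun z hz hz' => ⟨?_, fun w hw hw' hzw => ?_⟩⟩
    · rcases (hZ z hz).1 hz' with ⟨h1, h2⟩ | h1
      · simp only [h1, if_true]
        exact h2.trans hr
      · simp only [if_neg fun hzA => hdisj z hzA h1]
        exact (hg z hz h1).1
    · rcases (hZ z hz).1 hz' with ⟨h1, h2⟩ | h1 <;> rcases (hZ w hw).1 hw' with ⟨h3, h4⟩ | h3
      · simp [h1, h3]
      · have := h.apart w hw h3 z h1
        rw [I.dist_comm] at this
        linarith
      · have := h.apart z hz h1 w h3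
        linarith
      · simp only [if_neg fun hzA => hdisj z hzA h1, if_neg fun hwA => hdisj w hwA h3]
        exact (hg z hz h1).2 w hw h3 hzw
  · have e1 : (A₀.filter fun u => col' u = j + 1).card =
        (A.filter fun u => I.dist v u ≤ r).card + (A₀.filter fun u => col u = j + 1).card := by
      rw [← Finset.card_union_of_disjoint]
      · congr 1
        ext u
        simp only [Finset.mem_filter, Finset.mem_union]
        constructor
        · rintro ⟨h1, h2⟩
          exact ((hZ u h1).1 h2).imp id fun h3 => ⟨h1, h3⟩
        · rintro (h1 | h1)
          · exact ⟨h.subset h1.1, (hZ u (h.subset h1.1)).2 (Or.inl h1)⟩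
          · exact ⟨h1.1, (hZ u h1.1).2 (Or.inr h1.2)⟩
      · refine Finset.disjoint_left.2 fun u hu hu' => ?_
        exact hdisj u (Finset.mem_filter.1 hu).1 (Finset.mem_filter.1 hu').2
    have e2 : A.card = (A.filter fun u => I.dist v u ≤ r + 2 * D).card + A'.card := by
      rw [← Finset.card_filter_add_card_filter_not (fun u => I.dist v u ≤ r + 2 * D)]
      congr 2
      ext u
      rw [hA', Finset.mem_filter]
    have := h.card_le
    omega

/-- The centers coloured in the first `j` rounds. In every round at least half of the uncoloured
centers receive a colour, so that the colour `i` is used only if `2 ^ (i - 1)` is at most the number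
of centers. -/
structure GroupColouring (I : Instance n) (D ρ : ℝ) (S : Finset (Fin n)) (j : ℕ) (col : Fin n → ℕ) :
    Prop where
  le : ∀ u, col u ≤ j
  card : (S.filter fun u => col u = 0).card * 2 ^ j ≤ S.card
  pow_le : ∀ u, col u ≠ 0 → 2 ^ (col u - 1) ≤ S.card
  mem : ∀ u, col u ≠ 0 → u ∈ S
  groups : ∀ i ≠ 0, ∃ g : Fin n → Fin n, ∀ z, col z = i → I.dist (g z) z ≤ ρ ∧
    ∀ z', col z' = i → I.dist z z' ≤ 2 * D → g z = g z'

variable {S : Finset (Fin n)}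

theorem GroupColouring.succ (h : I.GroupColouring D ρ S j col₀)
    (hA₀ : ∀ u, u ∈ A₀ ↔ u ∈ S ∧ col₀ u = 0) (hc : I.Carving D ρ A₀ col₀ j ∅ col) :
    I.GroupColouring D ρ S (j + 1) col := by
  have hnew : ∀ u, col u = j + 1 ↔ u ∈ A₀ ∧ col u = j + 1 := by
    refine fun u => ⟨fun hu => ⟨?_, hu⟩, fun hu => hu.2⟩
    rcases hc.col_eq u with h1 | h1
    · have := h.le u
      omega
    · exact h1.1
  have hold : ∀ u, col u ≠ j + 1 → col u = col₀ u := fun u hu =>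
    (hc.col_eq u).resolve_right fun h1 => hu h1.2.2
  have hcard := hc.card_le
  rw [Finset.card_empty, zero_add] at hcard
  have hA₀S : A₀ = S.filter fun u => col₀ u = 0 := by
    ext u
    rw [hA₀, Finset.mem_filter]
  refine ⟨fun u => ?_, ?_, fun u hu => ?_, fun u hu => ?_, fun i hi => ?_⟩
  · rcases hc.col_eq u with h1 | h1
    · have := h.le u
      omega
    · exact h1.2.2.le
  · have e : S.filter (fun u => col u = 0) = A₀.filter fun u => ¬ col u = j + 1 := by
      ext u
      rw [Finset.mem_filter, Finset.mem_filter, hA₀]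
      constructor
      · rintro ⟨h1, h2⟩
        have := hold u (by omega)
        exact ⟨⟨h1, by omega⟩, by omega⟩
      · rintro ⟨h1, h2⟩
        exact ⟨h1.1, by rw [hold u h2]; exact h1.2⟩
    have e2 := Finset.card_filter_add_card_filter_not (s := A₀) (fun u => col u = j + 1)
    rw [e]
    calc (A₀.filter fun u => ¬ col u = j + 1).card * 2 ^ (j + 1)
        = ((A₀.filter fun u => ¬ col u = j + 1).card * 2) * 2 ^ j := by ring
      _ ≤ A₀.card * 2 ^ j := Nat.mul_le_mul_right _ (by omega)
      _ ≤ S.card := by rw [hA₀S]; exact h.card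
  · by_cases hu' : col u = j + 1
    · have hmem := ((hnew u).1 hu').1
      rw [hu', Nat.add_sub_cancel]
      refine le_trans ?_ h.card
      rw [← hA₀S]
      exact Nat.le_mul_of_pos_left _ (Finset.card_pos.2 ⟨u, hmem⟩)
    · rw [hold u hu'] at hu ⊢
      exact h.pow_le u hu
  · by_cases hu' : col u = j + 1
    · exact ((hA₀ u).1 ((hnew u).1 hu').1).1
    · rw [hold u hu'] at hu
      exact h.mem u hu
  · by_cases hi' : i = j + 1
    · subst hi'
      obtain ⟨g, hg⟩ := hc.groups
      refine ⟨g, fun z hz => ?_⟩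
      obtain ⟨h1, h2⟩ := hg z ((hnew z).1 hz).1 hz
      exact ⟨h1, fun z' hz' => h2 z' ((hnew z').1 hz').1 hz'⟩
    · obtain ⟨g, hg⟩ := h.groups i hi
      refine ⟨g, fun z hz => ?_⟩
      obtain ⟨h1, h2⟩ := hg z (by rw [← hold z (by omega)]; exact hz)
      exact ⟨h1, fun z' hz' => h2 z' (by rw [← hold z' (by omega)]; exact hz')⟩

/-- A chain of centers of one colour with steps of length at most `2 * D` stays in one group. -/
theorem GroupColouring.isColouring (h : I.GroupColouring D ρ S n col) (hρ : 0 ≤ ρ)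
    (hk : S.card ≤ I.k) : I.IsColouring D S col (Nat.log 2 I.k + 2) (2 * ρ) := by
  have hcol : ∀ c ∈ S, col c ≠ 0 := by
    intro c hc h0
    have h1 := h.card
    have h2 : 0 < (S.filter fun u => col u = 0).card :=
      Finset.card_pos.2 ⟨c, Finset.mem_filter.2 ⟨hc, h0⟩⟩
    have h3 : S.card ≤ n := by simpa using Finset.card_le_univ S
    have h4 : n < 2 ^ n := Nat.lt_two_pow_self
    have h5 : 2 ^ n ≤ (S.filter fun u => col u = 0).card * 2 ^ n := Nat.le_mul_of_pos_left _ h2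
    omega
  refine ⟨fun c hc => ?_, fun c c' hcc => ?_⟩
  · have h1 := Nat.le_log_of_pow_le (by norm_num) ((h.pow_le c (hcol c hc)).trans hk)
    omega
  · rcases Relation.ReflTransGen.cases_head hcc with rfl | ⟨b, hb, -⟩
    · rw [dist_self]; positivity
    · obtain ⟨g, hg⟩ := h.groups (col c) (hcol c hb.1.1)
      have key : col c' = col c ∧ g c' = g c := by
        clear hb
        induction hcc with
        | refl => exact ⟨rfl, rfl⟩
        | tail _ hxy ih =>
          refine ⟨by rw [← hxy.2.1, ih.1], ?_⟩
          rw [← ih.2]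
          exact ((hg _ ih.1).2 _ (by rw [← hxy.2.1, ih.1]) hxy.2.2).symm
      have h1 := (hg c rfl).1
      have h2 := (hg c' key.1).1
      rw [key.2] at h2
      have h3 := I.dist_triangle c (g c) c'
      rw [I.dist_comm] at h1
      linarith

end Instance

namespace Code

/-- Counts the candidates (array `14`) that have distance at most `ρ`, respectively at most
`ρ + 2 * D`, from the point in the variable `21`, where `ρ` is the real variable `4`. -/
def countBalls : Code :=
  loop 23 .pts (block [
    guard (Test.all [.eq (entry 14 (var 23)) (.lit 1), .realLE (.read 0 (var 21) (var 23)) (rvar 4)])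
      (set 12 (.add (var 12) (.lit 1))),
    guard (Test.all [.eq (entry 14 (var 23)) (.lit 1), .realLE (.read 0 (var 21) (var 23))
      (.add (rvar 4) (.add (rvar 2) (rvar 2)))]) (set 13 (.add (var 13) (.lit 1)))])

/-- Finds a radius that can be increased by `2 * D` without more than doubling the number of
candidates in the ball. As the machine has no real constants, the initial radius `0` is computed as
a difference. -/
def findRadius : Code :=
  block [
    real 4 (.lit 0) (.lit 0) (.sub (rvar 2) (rvar 2)),
    loop 22 .pts (block [
      set 12 (.lit 0),
      set 13 (.lit 0),
      countBalls,
      guard (.natLE (.add (.add (var 12) (var 12)) (.lit 1)) (var 13))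
        (real 4 (.lit 0) (.lit 0) (.add (rvar 4) (.add (rvar 2) (rvar 2))))])]

/-- Colours the candidates in the inner ball and removes the candidates in the outer ball. -/
def cutBall : Code :=
  loop 23 .pts (block [
    guard (Test.all [.eq (entry 14 (var 23)) (.lit 1), .realLE (.read 0 (var 21) (var 23)) (rvar 4)])
      (setEntry 10 (var 23) (.add (var 20) (.lit 1))),
    guard (Test.all [.eq (entry 14 (var 23)) (.lit 1), .realLE (.read 0 (var 21) (var 23))
      (.add (rvar 4) (.add (rvar 2) (rvar 2)))]) (setEntry 14 (var 23) (.lit 0))])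

/-- Makes all uncoloured centers candidates. -/
def candidates : Code :=
  loop 21 .pts (block [
    setEntry 14 (var 21) (.lit 0),
    guard (Test.all [.eq (entry 5 (var 21)) (.lit 1), .eq (entry 10 (var 21)) (.lit 0)])
      (setEntry 14 (var 21) (.lit 1))])

/-- Colours the centers of a general metric. -/
def colourGeneral : Code :=
  block [
    loop 20 .pts (setEntry 10 (var 20) (.lit 0)),
    loop 20 .pts (block [
      candidates,
      loop 21 .pts (guard (.eq (entry 14 (var 21)) (.lit 1)) (block [findRadius, cutBall]))])]

variable {n : ℕ} {I : Instance n} {m : ℕ} {x : Fin n → Fin m → ℝ} {s : Memory} {D : ℝ}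
  {S : Finset (Fin n)}

open Classical in
theorem countBalls_run (hs : Loaded I x s) (v : Fin n) (hv : s.nat 21 0 0 = v)
    (h12 : s.nat 12 0 0 = 0) (h13 : s.nat 13 0 0 = 0) {D r : ℝ} (hD : s.real 2 0 0 = D)
    (hr : s.real 4 0 0 = r) :
    (countBalls.run s).nat 12 0 0 = ((s.marked n 14).filter fun u => I.dist v u ≤ r).card ∧
    (countBalls.run s).nat 13 0 0 =
      ((s.marked n 14).filter fun u => I.dist v u ≤ r + 2 * D).card := by
  have := run_loop_fin (s₀ := s) (a := 23) (N := .pts) hs.pts (p := block [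
    guard (Test.all [.eq (entry 14 (var 23)) (.lit 1), .realLE (.read 0 (var 21) (var 23)) (rvar 4)])
      (set 12 (.add (var 12) (.lit 1))),
    guard (Test.all [.eq (entry 14 (var 23)) (.lit 1), .realLE (.read 0 (var 21) (var 23))
      (.add (rvar 4) (.add (rvar 2) (rvar 2)))]) (set 13 (.add (var 13) (.lit 1)))])
    (fun t s' => s'.nat 12 0 0 = countBelow (fun u => s.nat 14 u 0 = 1 ∧ I.dist v u ≤ r) t ∧
      s'.nat 13 0 0 = countBelow (fun u => s.nat 14 u 0 = 1 ∧ I.dist v u ≤ r + 2 * D) t)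
    (by simp only [countBelow_zero]; exact ⟨h12, h13⟩) ?_
  · simp only [countBelow_self] at this
    have h1 := this.1
    have h2 := this.2
    refine ⟨h1.trans ?_, h2.trans ?_⟩
    all_goals
      congr 1
      ext u
      simp
  · intro u s' hA hu ⟨h1, h2⟩
    have hs' := hs.agree hA
    have e14 := hA.nat 14 (by decide)
    have e21 : s'.nat 21 0 0 = v := by rw [hA.nat 21 (by decide)]; exact hv
    have e2 : s'.real 2 0 0 = D := by rw [hA.real 2 (by decide)]; exact hD
    have e4 : s'.real 4 0 0 = r := by rw [hA.real 4 (by decide)]; exact hr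
    simp only [countBelow_succ, run_block_cons, run_block_nil]
    -- the first counter
    obtain ⟨s'', hs''⟩ : ∃ s'', (guard (Test.all [.eq (entry 14 (var 23)) (.lit 1),
        .realLE (.read 0 (var 21) (var 23)) (rvar 4)])
        (set 12 (.add (var 12) (.lit 1)))).run s' = s'' := ⟨_, rfl⟩
    have f12 : s''.nat 12 0 0 = countBelow (fun u => s.nat 14 u 0 = 1 ∧ I.dist v u ≤ r) u +
        if s.nat 14 u 0 = 1 ∧ I.dist v u ≤ r then 1 else 0 := by
      rw [← hs'', run_guard]
      split_ifs with ha hb hb <;> simp only [Test.holds_all_cons, Test.holds_all_nil, Test.holds_eq,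
        Test.holds_realLE, NatExp.eval, eval_var, eval_entry, RealExp.eval, eval_rvar, hu, e21, e4,
        e14, hs'.dist, and_true] at ha
      · simp [h1]
      · exact absurd ha hb
      · exact absurd hb ha
      · simp [h1]
    have f13 : s''.nat 13 = s'.nat 13 := by rw [← hs'', nat_run (by decide)]
    have f14 : s''.nat 14 = s.nat 14 := by rw [← hs'', nat_run (by decide), e14]
    have f21 : s''.nat 21 0 0 = v := by rw [← hs'', nat_run (by decide), e21]
    have f23 : s''.nat 23 0 0 = u := by rw [← hs'', nat_run (by decide), hu]
    have f2 : s''.real 2 0 0 = D := by rw [← hs'', real_run (by decide), e2]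
    have f4 : s''.real 4 0 0 = r := by rw [← hs'', real_run (by decide), e4]
    have hs₂ : Loaded I x s'' := hs'' ▸ hs'.run
    rw [hs'', run_guard]
    split_ifs with ha hb hb hb hb hb <;> simp only [Test.holds_all_cons, Test.holds_all_nil, Test.holds_eq,
      Test.holds_realLE, NatExp.eval, eval_var, eval_entry, RealExp.eval, eval_rvar, f21, f23, f4,
      f2, f14, hs₂.dist, and_true, ← two_mul] at ha
    all_goals first
      | exact absurd ha ‹_›
      | exact absurd ‹_› ha
      | simp_all

open Classical in
/-- After `i` increases of the radius the ball contains at least `2 ^ i` candidates. As there are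
fewer than `2 ^ n` points, the search has come to rest after `n` rounds, and the radius is logarithmic
in the number of candidates. -/
theorem findRadius_run (hs : Loaded I x s) (v : Fin n) (hv : s.nat 21 0 0 = v)
    (hvA : v ∈ s.marked n 14) {D : ℝ} (hD : s.real 2 0 0 = D) :
    ∃ (r : ℝ) (i : ℕ), (findRadius.run s).real 4 0 0 = r ∧ r = i * (2 * D) ∧
      2 ^ i ≤ ((s.marked n 14).filter fun u => I.dist v u ≤ r).card ∧
      ((s.marked n 14).filter fun u => I.dist v u ≤ r + 2 * D).card ≤
        2 * ((s.marked n 14).filter fun u => I.dist v u ≤ r).card := by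
  unfold findRadius
  simp only [run_block_cons, run_block_nil]
  have hs₁ : Loaded I x ((real 4 (.lit 0) (.lit 0) (.sub (rvar 2) (rvar 2))).run s) := hs.run
  have h4 : ((real 4 (.lit 0) (.lit 0) (.sub (rvar 2) (rvar 2))).run s).real 4 0 0 = 0 := by simp
  have hD₁ : ((real 4 (.lit 0) (.lit 0) (.sub (rvar 2) (rvar 2))).run s).real 2 0 0 = D := by
    rw [real_run (by decide)]; exact hD
  have h14 : ((real 4 (.lit 0) (.lit 0) (.sub (rvar 2) (rvar 2))).run s).nat 14 = s.nat 14 :=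
    nat_run (by decide) _
  have hv₁ : ((real 4 (.lit 0) (.lit 0) (.sub (rvar 2) (rvar 2))).run s).nat 21 0 0 = v := by
    rw [nat_run (by decide)]; exact hv
  generalize (real 4 (.lit 0) (.lit 0) (.sub (rvar 2) (rvar 2))).run s = s₁ at *
  set N : ℝ → ℕ := fun r => ((s.marked n 14).filter fun u => I.dist v u ≤ r).card with hN
  have := run_loop_fin (s₀ := s₁) (a := 22) (N := .pts) hs₁.pts (p := block [
      set 12 (.lit 0),
      set 13 (.lit 0),
      countBalls,
      guard (.natLE (.add (.add (var 12) (var 12)) (.lit 1)) (var 13))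
        (real 4 (.lit 0) (.lit 0) (.add (rvar 4) (.add (rvar 2) (rvar 2))))])
    (fun t s' => ∃ (r : ℝ) (i : ℕ), s'.real 4 0 0 = r ∧ r = i * (2 * D) ∧ 2 ^ i ≤ N r ∧
      (N (r + 2 * D) ≤ 2 * N r ∨ i = t)) ?_ ?_
  · obtain ⟨r, i, h1, h2, h3, h5⟩ := this
    refine ⟨r, i, h1, h2, h3, h5.resolve_right ?_⟩
    rintro rfl
    have e1 : N r ≤ i := by
      have := Finset.card_le_univ ((s.marked i 14).filter fun u => I.dist v u ≤ r)
      rwa [Fintype.card_fin] at this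
    have e2 : i < 2 ^ i := Nat.lt_two_pow_self
    omega
  · refine ⟨0, 0, h4, by simp, ?_, Or.inr rfl⟩
    rw [pow_zero]
    exact Finset.card_pos.2 ⟨v, Finset.mem_filter.2 ⟨hvA, by rw [Instance.dist_self]⟩⟩
  · rintro t s' hA - ⟨r, i, e1, e2, e3, e5⟩
    simp only [run_block_cons, run_block_nil]
    obtain ⟨s₂, hs₂⟩ : ∃ s₂, (set 13 (.lit 0)).run ((set 12 (.lit 0)).run s') = s₂ := ⟨_, rfl⟩
    have hl : Loaded I x s₂ :=
      hs₂ ▸ ((hs₁.agree hA).run (p := set 12 (.lit 0))).run (p := set 13 (.lit 0))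
    have hm : s₂.nat 14 = s.nat 14 := by
      rw [← hs₂, nat_run (by decide), nat_run (by decide), hA.nat 14 (by decide), h14]
    have hD₂ : s₂.real 2 0 0 = D := by
      rw [← hs₂, real_run (by decide), real_run (by decide), hA.real 2 (by decide), hD₁]
    have hr₂ : s₂.real 4 0 0 = r := by
      rw [← hs₂, real_run (by decide), real_run (by decide), e1]
    obtain ⟨c1, c2⟩ := countBalls_run hl v
      (by rw [← hs₂, nat_run (by decide), nat_run (by decide), hA.nat 21 (by decide), hv₁])
      (by rw [← hs₂]; simp) (by rw [← hs₂]; simp) hD₂ hr₂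
    rw [hs₂]
    have hmm : s₂.marked n 14 = s.marked n 14 := by
      ext u
      simp [hm]
    rw [hmm] at c1 c2
    have hD₃ : (countBalls.run s₂).real 2 0 0 = D := by rw [real_run (by decide), hD₂]
    have hr₃ : (countBalls.run s₂).real 4 0 0 = r := by rw [real_run (by decide), hr₂]
    generalize countBalls.run s₂ = s₃ at *
    simp only [run_guard]
    split_ifs with h <;> simp only [Test.holds_natLE, NatExp.eval, eval_var, c1, c2] at h
    · have hlt : ¬ N (r + 2 * D) ≤ 2 * N r := by simp only [hN]; omega
      refine ⟨r + 2 * D, i + 1, by simp [hD₃, hr₃, two_mul], by rw [e2]; push_cast; ring, ?_,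
        Or.inr ?_⟩
      · rw [pow_succ]; omega
      · rw [e5.resolve_left hlt]
    · exact ⟨r, i, hr₃, e2, e3, Or.inl (by simp only [hN]; omega)⟩

open Classical in
theorem cutBall_run (hs : Loaded I x s) (v : Fin n) (hv : s.nat 21 0 0 = v) {j : ℕ}
    (hj : s.nat 20 0 0 = j) {D r : ℝ} (hD : s.real 2 0 0 = D) (hr : s.real 4 0 0 = r) (u : Fin n) :
    ((cutBall.run s).nat 14 u 0 = 1 ↔ s.nat 14 u 0 = 1 ∧ ¬ I.dist v u ≤ r + 2 * D) ∧
    (cutBall.run s).nat 10 u 0 =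
      if s.nat 14 u 0 = 1 ∧ I.dist v u ≤ r then j + 1 else s.nat 10 u 0 := by
  have := run_loop_fin (n := n) (s₀ := s) (a := 23) (N := .pts) hs.pts (p := block [
    guard (Test.all [.eq (entry 14 (var 23)) (.lit 1), .realLE (.read 0 (var 21) (var 23)) (rvar 4)])
      (setEntry 10 (var 23) (.add (var 20) (.lit 1))),
    guard (Test.all [.eq (entry 14 (var 23)) (.lit 1), .realLE (.read 0 (var 21) (var 23))
      (.add (rvar 4) (.add (rvar 2) (rvar 2)))]) (setEntry 14 (var 23) (.lit 0))])
    (fun t s' => (∀ u : Fin n, t ≤ u → s'.nat 14 u 0 = s.nat 14 u 0 ∧ s'.nat 10 u 0 = s.nat 10 u 0) ∧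
      ∀ u : Fin n, (u : ℕ) < t →
        (s'.nat 14 u 0 = 1 ↔ s.nat 14 u 0 = 1 ∧ ¬ I.dist v u ≤ r + 2 * D) ∧
        s'.nat 10 u 0 = if s.nat 14 u 0 = 1 ∧ I.dist v u ≤ r then j + 1 else s.nat 10 u 0)
    ⟨fun _ _ => ⟨rfl, rfl⟩, fun u hu => absurd hu (by omega)⟩ ?_
  · exact this.2 u u.2
  · intro w s' hA hw ⟨h1, h2⟩
    have hs' := hs.agree hA
    have e20 : s'.nat 20 0 0 = j := by rw [hA.nat 20 (by decide)]; exact hj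
    have e21 : s'.nat 21 0 0 = v := by rw [hA.nat 21 (by decide)]; exact hv
    have e2 : s'.real 2 0 0 = D := by rw [hA.real 2 (by decide)]; exact hD
    have e4 : s'.real 4 0 0 = r := by rw [hA.real 4 (by decide)]; exact hr
    simp only [run_block_cons, run_block_nil]
    obtain ⟨s₂, hs₂⟩ : ∃ s₂, (guard (Test.all [.eq (entry 14 (var 23)) (.lit 1),
        .realLE (.read 0 (var 21) (var 23)) (rvar 4)])
        (setEntry 10 (var 23) (.add (var 20) (.lit 1)))).run s' = s₂ := ⟨_, rfl⟩
    have f14 : s₂.nat 14 = s'.nat 14 := by rw [← hs₂, nat_run (by decide)]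
    have f21 : s₂.nat 21 0 0 = v := by rw [← hs₂, nat_run (by decide), e21]
    have f23 : s₂.nat 23 0 0 = w := by rw [← hs₂, nat_run (by decide), hw]
    have f2 : s₂.real 2 0 0 = D := by rw [← hs₂, real_run (by decide), e2]
    have f4 : s₂.real 4 0 0 = r := by rw [← hs₂, real_run (by decide), e4]
    have hl₂ : Loaded I x s₂ := hs₂ ▸ hs'.run
    have f10 : ∀ u : Fin n, s₂.nat 10 u 0 =
        if u = w ∧ s.nat 14 w 0 = 1 ∧ I.dist v w ≤ r then j + 1 else s'.nat 10 u 0 := by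
      intro u
      rw [← hs₂, run_guard]
      split_ifs with ha hb hb <;> simp only [Test.holds_all_cons, Test.holds_all_nil, Test.holds_eq,
        Test.holds_realLE, NatExp.eval, eval_var, eval_entry, RealExp.eval, eval_rvar, hw, e21, e4,
        (h1 w le_rfl).1, hs'.dist, and_true] at ha
      · simp [hw, e20, hb.1]
      · have : u ≠ w := fun h => hb ⟨h, ha⟩
        simp [hw, Fin.val_inj, this]
      · exact absurd hb.2 ha
      · rfl
    rw [hs₂]
    obtain ⟨s₃, hs₃⟩ : ∃ s₃, (guard (Test.all [.eq (entry 14 (var 23)) (.lit 1),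
        .realLE (.read 0 (var 21) (var 23)) (.add (rvar 4) (.add (rvar 2) (rvar 2)))])
        (setEntry 14 (var 23) (.lit 0))).run s₂ = s₃ := ⟨_, rfl⟩
    have g10 : s₃.nat 10 = s₂.nat 10 := by rw [← hs₃, nat_run (by decide)]
    have g14 : ∀ u : Fin n, s₃.nat 14 u 0 =
        if u = w ∧ s.nat 14 w 0 = 1 ∧ I.dist v w ≤ r + 2 * D then 0 else s'.nat 14 u 0 := by
      intro u
      rw [← hs₃, run_guard]
      split_ifs with ha hb hb <;> simp only [Test.holds_all_cons, Test.holds_all_nil, Test.holds_eq,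
        Test.holds_realLE, NatExp.eval, eval_var, eval_entry, RealExp.eval, eval_rvar, f23, f21, f4,
        f2, f14, (h1 w le_rfl).1, hl₂.dist, and_true, ← two_mul] at ha
      · simp [f23, hb.1]
      · have : u ≠ w := fun h => hb ⟨h, ha⟩
        simp [f23, Fin.val_inj, this, f14]
      · exact absurd hb.2 ha
      · rw [f14]
    rw [hs₃]
    refine ⟨fun u hu => ?_, fun u hu => ?_⟩
    · have hne : u ≠ w := by rintro rfl; omega
      obtain ⟨k1, k2⟩ := h1 u (by omega)
      rw [g10, f10, g14]
      simp [hne, k1, k2]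
    · rw [g10, f10, g14]
      by_cases huw : u = w
      · subst huw
        obtain ⟨k1, k2⟩ := h1 u le_rfl
        rw [k1, k2]
        simp only [true_and]
        refine ⟨?_, trivial⟩
        split_ifs with h
        · simp [h.2]
        · exact ⟨fun h' => ⟨h', fun h'' => h ⟨h', h''⟩⟩, fun h' => h'.1⟩
      · have := Fin.val_ne_of_ne huw
        simpa [huw] using h2 u (by omega)

theorem candidates_run (hs : Loaded I x s) (hS : ∀ c : Fin n, s.nat 5 c 0 = 1 ↔ c ∈ S) (u : Fin n) :
    u ∈ (candidates.run s).marked n 14 ↔ u ∈ S ∧ s.nat 10 u 0 = 0 := by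
  rw [Memory.mem_marked]
  refine (run_loop_each (n := n) (s₀ := s) (a := 21) (N := .pts) hs.pts (fun _ => True)
    (fun u s' => s'.nat 14 u 0 = 1 ↔ u ∈ S ∧ s.nat 10 u 0 = 0) trivial ?_).2 u
  intro u s' hA hu _
  have e5 := hA.nat 5 (by decide)
  have e10 := hA.nat 10 (by decide)
  simp only [run_block_cons, run_block_nil, run_guard]
  split_ifs with h <;> simp only [Test.holds_all_cons, Test.holds_all_nil, Test.holds_eq, eval_entry,
    eval_var, NatExp.eval, run_setEntry, Memory.nat_writeNat, hu, and_true] at h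
  · simp only [Nat.reduceEqDiff, false_and, if_false, e5, e10, hS] at h
    refine ⟨trivial, by simpa [hu] using h, fun v hv H => ?_⟩
    have := Fin.val_ne_of_ne hv.ne
    simpa [hu, this] using H
  · simp only [Nat.reduceEqDiff, false_and, if_false, e5, e10, hS] at h
    refine ⟨trivial, by simpa [hu] using h, fun v hv H => ?_⟩
    have := Fin.val_ne_of_ne hv.ne
    simpa [hu, this] using H

theorem colourGeneral_run (hs : Centered I x D S s) (hD : 0 ≤ D) (hk : S.card ≤ I.k) :
    I.GroupColouring D (Nat.log 2 I.k * (2 * D)) S n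
      fun c => (colourGeneral.run s).nat 10 c 0 := by
  classical
  unfold colourGeneral
  simp only [run_block_cons, run_block_nil]
  have h10 := (run_loop_each (n := n) (s₀ := s) (a := 20) (N := .pts)
    (p := setEntry 10 (var 20) (.lit 0)) hs.loaded.pts (fun _ => True)
    (fun v s' => s'.nat 10 v 0 = 0) trivial (by
      intro v s' _ hv _
      refine ⟨trivial, by simp [hv], fun v' _ h => by simp [h]⟩)).2
  have hs₁ : Centered I x D S ((loop 20 .pts (setEntry 10 (var 20) (.lit 0))).run s) :=
    ⟨hs.loaded.run, by rw [real_run (by decide)]; exact hs.radius,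
      by rw [nat_run (by decide)]; exact hs.center⟩
  generalize (loop 20 .pts (setEntry 10 (var 20) (.lit 0))).run s = s₁ at *
  refine run_loop_fin (s₀ := s₁) (a := 20) (N := .pts) hs₁.loaded.pts
    (fun j s' => I.GroupColouring D (Nat.log 2 I.k * (2 * D)) S j fun c => s'.nat 10 c 0) ?_ ?_
  · refine ⟨fun u => (h10 u).le, ?_, fun u hu => absurd (h10 u) hu, fun u hu => absurd (h10 u) hu,
      fun i hi => ⟨id, fun z hz => absurd ((h10 z).symm.trans hz).symm hi⟩⟩
    rw [pow_zero, mul_one]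
    exact Finset.card_filter_le _ _
  · intro j s₂ hA hj hG
    have hs₂ : Centered I x D S s₂ := ⟨hs₁.loaded.agree hA,
      by rw [hA.real 2 (by decide)]; exact hs₁.radius,
      by rw [hA.nat 5 (by decide)]; exact hs₁.center⟩
    simp only [run_block_cons, run_block_nil]
    have hcand := candidates_run hs₂.loaded hs₂.center
    have hs₃ : Centered I x D S (candidates.run s₂) := ⟨hs₂.loaded.run,
      by rw [real_run (by decide)]; exact hs₂.radius,
      by rw [nat_run (by decide)]; exact hs₂.center⟩
    have hj₃ : (candidates.run s₂).nat 20 0 0 = j := by rw [nat_run (by decide)]; exact hj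
    have h10₃ : (candidates.run s₂).nat 10 = s₂.nat 10 := nat_run (by decide) _
    generalize candidates.run s₂ = s₃ at *
    have h₀ : ∀ u ∈ s₃.marked n 14, s₂.nat 10 u 0 ≠ j + 1 := fun u hu => by
      rw [((hcand u).1 hu).2]
      omega
    have := run_loop_each (s₀ := s₃) (a := 21) (N := .pts)
      (p := guard (.eq (entry 14 (var 21)) (.lit 1)) (block [findRadius, cutBall]))
      hs₃.loaded.pts
      (fun s' => I.Carving D (Nat.log 2 I.k * (2 * D)) (s₃.marked n 14) (fun c => s₂.nat 10 c 0) j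
        (s'.marked n 14) fun c => s'.nat 10 c 0) (fun v s' => s'.nat 14 v 0 ≠ 1) ?_ ?_
    · refine hG.succ hcand ?_
      have hempty : ((loop 21 .pts (guard (.eq (entry 14 (var 21)) (.lit 1))
          (block [findRadius, cutBall]))).run s₃).marked n 14 = ∅ :=
        Finset.eq_empty_of_forall_notMem fun v hv => this.2 v (Memory.mem_marked.1 hv)
      rw [← hempty]
      exact this.1
    · simp only [h10₃]
      exact Instance.carving_self h₀
    · intro v s₄ hA' hv hI
      have hs₄ : Centered I x D S s₄ := ⟨hs₃.loaded.agree hA',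
        by rw [hA'.real 2 (by decide)]; exact hs₃.radius,
        by rw [hA'.nat 5 (by decide)]; exact hs₃.center⟩
      simp only [run_guard]
      split_ifs with h <;> simp only [Test.holds_eq, eval_entry, eval_var, NatExp.eval, hv] at h
      · simp only [run_block_cons, run_block_nil]
        obtain ⟨r, i, h1, h2, h3, h4⟩ := findRadius_run hs₄.loaded v hv (Memory.mem_marked.2 h)
          hs₄.radius
        have hcut := cutBall_run (s := findRadius.run s₄) hs₄.loaded.run v
          (by rw [nat_run (by decide)]; exact hv) (j := j)
          (by rw [nat_run (by decide), hA'.nat 20 (by decide)]; exact hj₃) (D := D)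
          (by rw [real_run (by decide)]; exact hs₄.radius) h1
        simp only [nat_run (p := findRadius) (a := 14) (by decide),
          nat_run (p := findRadius) (a := 10) (by decide)] at hcut
        refine ⟨hI.carve h₀ v (r := r) ?_ h4 hD (fun u => ?_) fun u => ?_, ?_, fun u _ hu hu' =>
          hu ((hcut u).1.1 hu').1⟩
        · rw [h2]
          refine mul_le_mul_of_nonneg_right ?_ (by positivity)
          have hcard : 2 ^ i ≤ I.k := by
            refine h3.trans (((Finset.card_filter_le _ _).trans (Finset.card_le_card ?_)).trans hk)
            exact fun u hu => ((hcand u).1 (hI.subset hu)).1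
          exact_mod_cast Nat.le_log_of_pow_le (by norm_num) hcard
        · simp only [Memory.mem_marked]
          exact (hcut u).1
        · simp only [Memory.mem_marked]
          exact (hcut u).2
        · intro hv'
          refine ((hcut v).1.1 hv').2 ?_
          rw [Instance.dist_self, h2]
          positivity
      · exact ⟨hI, h, fun _ _ H => H⟩

/-- The colouring procedure for general metrics leads to the approximation factor `O(log² k)`. -/
theorem colours_general (I : Instance n) (x : Fin n → Fin m → ℝ) :
    Colours colourGeneral I x (32 * (1 + Real.log I.k) ^ 2) := by
  intro s D S hs hD hk
  have hG := colourGeneral_run hs hD hk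
  refine ⟨fun c _ => ?_, _, _, hG.isColouring (by positivity) hk, ?_⟩
  · have := hG.le c
    omega
  · have hk1 : (1 : ℝ) ≤ I.k := by exact_mod_cast I.one_le_k
    have hlog : (Nat.log 2 I.k : ℝ) ≤ 2 * Real.log I.k := by
      have h1 : ((2 : ℝ) ^ Nat.log 2 I.k) ≤ I.k := by
        exact_mod_cast Nat.pow_log_le_self 2 (by have := I.one_le_k; omega)
      have h2 := Real.log_le_log (by positivity) h1
      rw [Real.log_pow] at h2
      have h3 := Real.log_two_gt_d9
      have h4 : (0 : ℝ) ≤ Nat.log 2 I.k := Nat.cast_nonneg _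
      nlinarith
    have hl : 0 ≤ Real.log I.k := Real.log_nonneg hk1
    have hL : (0 : ℝ) ≤ Nat.log 2 I.k := Nat.cast_nonneg _
    push_cast
    generalize (Nat.log 2 I.k : ℝ) = L at *
    generalize Real.log I.k = y at *
    have : 2 * ((L + 2) * (2 * (L * (2 * D)) + 2 * D)) = (L + 2) * (8 * L + 4) * D := by ring
    rw [this]
    refine mul_le_mul_of_nonneg_right ?_ hD
    calc (L + 2) * (8 * L + 4) ≤ (2 * (1 + y)) * (16 * (1 + y)) :=
          mul_le_mul (by linarith) (by linarith) (by positivity) (by positivity)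
      _ = 32 * (1 + y) ^ 2 := by ring

end Code

/-! ### Colouring the centers of a doubling metric -/

namespace Instance

variable {n : ℕ} {I : Instance n} {D : ℝ} {S : Finset (Fin n)}

theorem doublingConstant_spec (I : Instance n) (x : Fin n) {r : ℝ} (hr : 0 < r) :
    ∃ Y : Finset (Fin n), Y.card ≤ doublingConstant I.dist ∧
      ∀ y, I.dist x y ≤ r → ∃ z ∈ Y, I.dist z y ≤ r / 2 := by
  have hne : {m : ℕ | ∀ x : Fin n, ∀ r : ℝ, 0 < r → ∃ Y : Finset (Fin n), Y.card ≤ m ∧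
      {y | I.dist x y ≤ r} ⊆ ⋃ z ∈ Y, {y | I.dist z y ≤ r / 2}}.Nonempty := by
    refine ⟨n, fun x r hr => ⟨Finset.univ, by simp, fun y _ => ?_⟩⟩
    simp only [Set.mem_iUnion]
    exact ⟨y, Finset.mem_univ y, by simp only [Set.mem_ofPred_eq, dist_self]; positivity⟩
  obtain ⟨Y, hY, hcov⟩ := Nat.sInf_mem hne x r hr
  refine ⟨Y, hY, fun y hy => ?_⟩
  have := hcov (show y ∈ {y | I.dist x y ≤ r} from hy)
  simp only [Set.mem_iUnion] at this
  obtain ⟨z, hz, hzy⟩ := this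
  exact ⟨z, hz, hzy⟩

/-- Iterated halving of the radius in the definition of the doubling constant. -/
theorem exists_cover (I : Instance n) (x : Fin n) {r : ℝ} (hr : 0 < r) (t : ℕ) :
    ∃ Y : Finset (Fin n), Y.card ≤ doublingConstant I.dist ^ t ∧
      ∀ y, I.dist x y ≤ r → ∃ z ∈ Y, I.dist z y ≤ r / 2 ^ t := by
  classical
  induction t with
  | zero => exact ⟨{x}, by simp, fun y hy => ⟨x, by simp, by simpa using hy⟩⟩
  | succ t ih =>
    obtain ⟨Y, hY, hcov⟩ := ih
    choose Z hZ hZcov using fun z => I.doublingConstant_spec z (r := r / 2 ^ t) (by positivity)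
    refine ⟨Y.biUnion Z, ?_, fun y hy => ?_⟩
    · rw [pow_succ]
      exact Finset.card_biUnion_le_card_mul _ _ _ (fun z _ => hZ z) |>.trans
        (Nat.mul_le_mul_right _ hY)
    · obtain ⟨z, hz, hzy⟩ := hcov y hy
      obtain ⟨w, hw, hwy⟩ := hZcov z y hzy
      refine ⟨w, Finset.mem_biUnion.2 ⟨z, hz, hw⟩, ?_⟩
      rw [pow_succ, ← div_div]
      exact hwy

/-- A set of points with pairwise distance more than `2 * D` in a ball of radius `6 * D` has at most
as many points as a cover of the ball of radius `8 * D` by balls of radius `D`. -/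
theorem card_le_of_separated (hD : 0 < D) (p : Fin n) (X : Finset (Fin n))
    (hX : ∀ u ∈ X, I.dist p u ≤ 6 * D) (hsep : ∀ u ∈ X, ∀ v ∈ X, u ≠ v → 2 * D < I.dist u v) :
    X.card ≤ doublingConstant I.dist ^ 3 := by
  obtain ⟨Y, hY, hcov⟩ := I.exists_cover p (r := 8 * D) (by positivity) 3
  have hc : ∀ u, ∃ z, u ∈ X → z ∈ Y ∧ I.dist z u ≤ D := by
    intro u
    by_cases hu : u ∈ X
    · obtain ⟨z, hz, hzu⟩ := hcov u (by linarith [hX u hu])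
      exact ⟨z, fun _ => ⟨hz, by linarith⟩⟩
    · exact ⟨u, fun h => absurd h hu⟩
  choose f hf using hc
  refine (Finset.card_le_card_of_injOn f (fun u hu => (hf u hu).1) ?_).trans hY
  intro u hu v hv huv
  by_contra hne
  have h1 := hsep u hu v hv hne
  have h2 := (hf u hu).2
  have h3 := (hf v hv).2
  have h4 := I.dist_triangle u (f u) v
  rw [I.dist_comm] at h2
  rw [← huv] at h3
  linarith

/-- The map `own` sends every center to a point of the net that consists of its fixed points in `S`:
these have pairwise distance more than `2 * D`, and every center has distance at most `2 * D` from
its owner. -/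
def IsNet (I : Instance n) (D : ℝ) (S : Finset (Fin n)) (own : Fin n → ℕ) : Prop :=
  ∀ v : Fin n, (own v = v ∧ ∀ u < v, u ∈ S → own u = u → 2 * D < I.dist u v) ∨
    ∃ u ∈ S, u < v ∧ own v = u ∧ own u = u ∧ I.dist u v ≤ 2 * D

open Classical in
/-- The earlier points of the net that have distance at most `6 * D` from `v`. -/
noncomputable def conflicts (I : Instance n) (D : ℝ) (S : Finset (Fin n)) (own : Fin n → ℕ)
    (v : Fin n) : Finset (Fin n) :=
  Finset.univ.filter fun u => u < v ∧ u ∈ S ∧ own u = u ∧ I.dist u v ≤ 6 * D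

/-- The colour `κ v` is not used by a conflicting point, and it is bounded by the number of these. -/
def IsNetColouring (I : Instance n) (D : ℝ) (S : Finset (Fin n)) (own κ : Fin n → ℕ) : Prop :=
  ∀ v, (∀ u ∈ I.conflicts D S own v, κ u ≠ κ v) ∧ κ v ≤ (I.conflicts D S own v).card

variable {own κ : Fin n → ℕ}

theorem IsNet.owner (h : I.IsNet D S own) (hD : 0 ≤ D) {v : Fin n} (hv : v ∈ S) :
    ∃ p ∈ S, own v = p ∧ own p = p ∧ I.dist p v ≤ 2 * D := by
  rcases h v with ⟨h1, -⟩ | ⟨u, h1, -, h2, h3, h4⟩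
  · exact ⟨v, hv, h1, h1, by rw [dist_self]; positivity⟩
  · exact ⟨u, h1, h2, h3, h4⟩

theorem IsNet.separated (h : I.IsNet D S own) {u v : Fin n} (huS : u ∈ S) (hvS : v ∈ S)
    (hu : own u = u) (hv : own v = v) (huv : u ≠ v) : 2 * D < I.dist u v := by
  have key : ∀ u v : Fin n, u ∈ S → own u = u → own v = v → u < v → 2 * D < I.dist u v := by
    intro u v huS hu hv huv
    rcases h v with ⟨-, h1⟩ | ⟨w, -, h1, h2, -⟩
    · exact h1 u huv huS hu
    · exact absurd (Fin.ext (h2.symm.trans hv)) h1.ne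
  rcases lt_or_gt_of_ne huv with hlt | hlt
  · exact key u v huS hu hv hlt
  · rw [I.dist_comm]
    exact key v u hvS hv hu hlt

theorem IsNet.card_conflicts (h : I.IsNet D S own) (hD : 0 < D) (v : Fin n) :
    (I.conflicts D S own v).card ≤ doublingConstant I.dist ^ 3 := by
  refine card_le_of_separated hD v _ (fun u hu => ?_) fun u hu w hw huw => ?_
  · rw [I.dist_comm]
    exact (Finset.mem_filter.1 hu).2.2.2.2
  · obtain ⟨-, -, h1, h2, -⟩ := Finset.mem_filter.1 hu
    obtain ⟨-, -, h3, h4, -⟩ := Finset.mem_filter.1 hw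
    exact h.separated h1 h3 h2 h4 huw

theorem IsNetColouring.isColouring (hN : I.IsNet D S own) (h : I.IsNetColouring D S own κ)
    (hD : 0 ≤ D) {col : Fin n → ℕ} (hcol : ∀ v p : Fin n, own v = p → col v = κ p) {l : ℕ}
    (hl : ∀ v, (I.conflicts D S own v).card ≤ l) : I.IsColouring D S col (l + 1) (4 * D) := by
  refine ⟨fun c hc => ?_, fun c c' hcc => ?_⟩
  · obtain ⟨p, -, hp, -⟩ := hN.owner hD hc
    rw [hcol c p hp]
    have := (h p).2
    have := hl p
    omega
  · have hstep : ∀ a b, a ∈ S → b ∈ S → col a = col b → I.dist a b ≤ 2 * D → own a = own b := by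
      intro a b ha hb hab hdist
      obtain ⟨p, hpS, hp, hpp, hpa⟩ := hN.owner hD ha
      obtain ⟨q, hqS, hq, hqq, hqb⟩ := hN.owner hD hb
      rw [hcol a p hp, hcol b q hq] at hab
      have hpq : I.dist p q ≤ 6 * D := by
        have h1 := I.dist_triangle p a q
        have h2 := I.dist_triangle a b q
        rw [I.dist_comm b] at h2
        linarith
      rw [hp, hq]
      by_contra hne
      rcases lt_or_gt_of_ne fun hpq => hne (congrArg Fin.val hpq) with hlt | hlt
      · exact (h q).1 p (Finset.mem_filter.2 ⟨Finset.mem_univ _, hlt, hpS, hpp, hpq⟩) hab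
      · rw [I.dist_comm] at hpq
        exact (h p).1 q (Finset.mem_filter.2 ⟨Finset.mem_univ _, hlt, hqS, hqq, hpq⟩) hab.symm
    rcases Relation.ReflTransGen.cases_tail hcc with rfl | ⟨b, hb, hbc⟩
    · rw [dist_self]; positivity
    · have hc' := hbc.1.2
      clear hb hbc
      have key : c' = c ∨ c ∈ S ∧ own c' = own c := by
        clear hc'
        induction hcc with
        | refl => exact Or.inl rfl
        | tail _ hxy ih =>
          have := hstep _ _ hxy.1.1 hxy.1.2 hxy.2.1 hxy.2.2
          rcases ih with rfl | ⟨h1, h2⟩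
          · exact Or.inr ⟨hxy.1.1, this.symm⟩
          · exact Or.inr ⟨h1, by rw [← this, h2]⟩
      rcases key with rfl | ⟨hc, hcc'⟩
      · rw [dist_self]; positivity
      · obtain ⟨p, -, hp, -, hpc⟩ := hN.owner hD hc
        obtain ⟨q, -, hq, -, hqc⟩ := hN.owner hD hc'
        have hpq : q = p := Fin.ext (by rw [← hp, ← hq, hcc'])
        subst hpq
        have := I.dist_triangle c q c'
        rw [I.dist_comm c q] at this
        linarith

end Instance

namespace Code

/-- Computes the least number that is not marked in array `17`. -/
def leastUnmarked : Code :=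
  block [
    set 16 (.lit 0),
    loop 24 .all (guard (.eq (entry 17 (var 16)) (.lit 1)) (set 16 (.add (var 16) (.lit 1))))]

/-- Removes all marks from array `17`. -/
def clearMarks : Code := loop 21 .all (setEntry 17 (var 21) (.lit 0))

/-- Computes a net among the centers and a net point close to every center. -/
def owners : Code :=
  loop 20 .pts (block [
    setEntry 15 (var 20) (var 20),
    loop 21 .pts (guard (Test.all [.natLE (.add (var 21) (.lit 1)) (var 20),
        .eq (entry 5 (var 21)) (.lit 1), .eq (entry 15 (var 21)) (var 21),
        .realLE (.read 0 (var 21) (var 20)) (.add (rvar 2) (rvar 2))])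
      (setEntry 15 (var 20) (var 21)))])

/-- Marks the colours of the net points in conflict with the point in the variable `20`. -/
def markConflicts : Code :=
  loop 21 .pts (guard (Test.all [.natLE (.add (var 21) (.lit 1)) (var 20),
      .eq (entry 5 (var 21)) (.lit 1), .eq (entry 15 (var 21)) (var 21),
      .realLE (.read 0 (var 21) (var 20))
        (.add (.add (.add (rvar 2) (rvar 2)) (.add (rvar 2) (rvar 2))) (.add (rvar 2) (rvar 2)))])
    (setEntry 17 (entry 18 (var 21)) (.lit 1)))

/-- Colours the centers of a doubling metric. -/
def colourDoubling : Code :=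
  block [
    owners,
    loop 20 .pts (block [clearMarks, markConflicts, leastUnmarked, setEntry 18 (var 20) (var 16)]),
    loop 20 .pts (setEntry 10 (var 20) (entry 18 (entry 15 (var 20))))]

variable {n : ℕ} {I : Instance n} {m : ℕ} {x : Fin n → Fin m → ℝ} {s : Memory} {D : ℝ}
  {S : Finset (Fin n)}

theorem leastUnmarked_run (hs : Loaded I x s) :
    (∀ i < (leastUnmarked.run s).nat 16 0 0, s.nat 17 i 0 = 1) ∧
      (s.nat 17 ((leastUnmarked.run s).nat 16 0 0) 0 ≠ 1 ∨
        (leastUnmarked.run s).nat 16 0 0 = n + m + 1) := by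
  unfold leastUnmarked
  simp only [run_block_cons, run_block_nil]
  have hs₁ : Loaded I x ((set 16 (.lit 0)).run s) := hs.run
  have h16 : ((set 16 (.lit 0)).run s).nat 16 0 0 = 0 := by simp
  have h17 : ((set 16 (.lit 0)).run s).nat 17 = s.nat 17 := nat_run (by decide) _
  generalize (set 16 (.lit 0)).run s = s₁ at *
  refine run_loop (s₀ := s₁) (a := 24) (N := .all) rfl hs₁.all
    (fun t s' => (∀ i < s'.nat 16 0 0, s.nat 17 i 0 = 1) ∧
      (s.nat 17 (s'.nat 16 0 0) 0 ≠ 1 ∨ s'.nat 16 0 0 = t))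
    ⟨fun i hi => by omega, Or.inr h16⟩ ?_
  intro t _ s' hA _ ⟨h1, h2⟩
  have e17 : s'.nat 17 = s.nat 17 := by rw [hA.nat 17 (by decide), h17]
  simp only [run_guard]
  split_ifs with h <;> simp only [Test.holds_eq, eval_entry, eval_var, NatExp.eval, e17] at h
  · have ht := h2.resolve_left (not_not.2 h)
    simp only [run_set, NatExp.eval, eval_var, Memory.nat_writeNat, and_self, if_true]
    refine ⟨fun i hi => ?_, Or.inr (by rw [ht])⟩
    rcases Nat.lt_succ_iff_lt_or_eq.1 hi with hlt | rfl
    · exact h1 i hlt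
    · exact h
  · exact ⟨h1, Or.inl h⟩

theorem clearMarks_run (hs : Loaded I x s) (i : ℕ) (hi : i < n + m + 1) :
    (clearMarks.run s).nat 17 i 0 = 0 := by
  refine (run_loop (s₀ := s) (a := 21) (N := .all) (p := setEntry 17 (var 21) (.lit 0)) rfl hs.all
    (fun t s' => ∀ i < t, s'.nat 17 i 0 = 0) (fun i hi => absurd hi (by omega)) ?_) i hi
  intro t _ s' _ ht h i hi
  by_cases hit : i = t
  · simp [ht, hit]
  · simpa [ht, hit] using h i (by omega)

/-- The least unmarked number after marking the numbers `f u` for `u ∈ X`. -/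
theorem leastUnmarked_of_marks (hs : Loaded I x s) {ι : Type*} (X : Finset ι) (f : ι → ℕ)
    (hX : X.card ≤ n + m) (hf : ∀ i < n + m + 1, s.nat 17 i 0 = 1 ↔ ∃ u ∈ X, f u = i) :
    (∀ u ∈ X, f u ≠ (leastUnmarked.run s).nat 16 0 0) ∧
      (leastUnmarked.run s).nat 16 0 0 ≤ X.card := by
  classical
  obtain ⟨h1, h2⟩ := leastUnmarked_run hs
  generalize (leastUnmarked.run s).nat 16 0 0 = r at *
  have hr : r ≤ n + m + 1 → r ≤ X.card := by
    intro hr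
    have : Finset.range r ⊆ X.image f := by
      intro i hi
      have hi' := Finset.mem_range.1 hi
      obtain ⟨u, hu, hui⟩ := (hf i (by omega)).1 (h1 i hi')
      exact Finset.mem_image.2 ⟨u, hu, hui⟩
    have h3 := Finset.card_le_card this
    rw [Finset.card_range] at h3
    exact h3.trans Finset.card_image_le
  have hle : r < n + m + 1 := by
    by_contra hlt
    -- the numbers below `n + m + 1` cannot all be marked
    have : Finset.range (n + m + 1) ⊆ X.image f := by
      intro i hi
      have hi' := Finset.mem_range.1 hi
      obtain ⟨u, hu, hui⟩ := (hf i hi').1 (h1 i (by omega))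
      exact Finset.mem_image.2 ⟨u, hu, hui⟩
    have h3 := Finset.card_le_card this
    rw [Finset.card_range] at h3
    have := h3.trans Finset.card_image_le
    omega
  refine ⟨fun u hu hur => ?_, hr hle.le⟩
  have := h2.resolve_right (by omega)
  exact this ((hf r hle).2 ⟨u, hu, hur⟩)

theorem owners_run (hs : Centered I x D S s) :
    I.IsNet D S fun v => (owners.run s).nat 15 v 0 := by
  have := run_loop_fin (n := n) (s₀ := s) (a := 20) (N := .pts) hs.loaded.pts (p := block [
    setEntry 15 (var 20) (var 20),
    loop 21 .pts (guard (Test.all [.natLE (.add (var 21) (.lit 1)) (var 20),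
        .eq (entry 5 (var 21)) (.lit 1), .eq (entry 15 (var 21)) (var 21),
        .realLE (.read 0 (var 21) (var 20)) (.add (rvar 2) (rvar 2))])
      (setEntry 15 (var 20) (var 21)))])
    (fun t s' => ∀ v : Fin n, (v : ℕ) < t →
      (s'.nat 15 v 0 = v ∧ ∀ u < v, u ∈ S → s'.nat 15 u 0 = u → 2 * D < I.dist u v) ∨
      ∃ u ∈ S, u < v ∧ s'.nat 15 v 0 = u ∧ s'.nat 15 u 0 = u ∧ I.dist u v ≤ 2 * D)
    (fun v hv => absurd hv (by omega)) ?_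
  · exact fun v => this v v.2
  · intro v s₁ hA hv hI
    simp only [run_block_cons, run_block_nil]
    obtain ⟨s₂, hs₂⟩ : ∃ s₂, (setEntry 15 (var 20) (var 20)).run s₁ = s₂ := ⟨_, rfl⟩
    have hl₂ : Loaded I x s₂ := hs₂ ▸ (hs.loaded.agree hA).run
    have h15 : ∀ w : Fin n, s₂.nat 15 w 0 = if w = v then (v : ℕ) else s₁.nat 15 w 0 := by
      intro w
      rw [← hs₂]
      simp [hv, Fin.val_inj]
    have hv₂ : s₂.nat 20 0 0 = v := by rw [← hs₂, nat_run (by decide)]; exact hv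
    have h5 : s₂.nat 5 = s.nat 5 := by rw [← hs₂, nat_run (by decide), hA.nat 5 (by decide)]
    have hD : s₂.real 2 0 0 = D := by
      rw [← hs₂, real_run (by decide), hA.real 2 (by decide)]; exact hs.radius
    rw [hs₂]
    have := run_loop_fin (n := n) (s₀ := s₂) (a := 21) (N := .pts) hl₂.pts
      (p := guard (Test.all [.natLE (.add (var 21) (.lit 1)) (var 20),
        .eq (entry 5 (var 21)) (.lit 1), .eq (entry 15 (var 21)) (var 21),
        .realLE (.read 0 (var 21) (var 20)) (.add (rvar 2) (rvar 2))])
      (setEntry 15 (var 20) (var 21)))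
      (fun t s' => (∀ w : Fin n, w ≠ v → s'.nat 15 w 0 = s₁.nat 15 w 0) ∧
        ((s'.nat 15 v 0 = v ∧ ∀ u < v, (u : ℕ) < t → u ∈ S → s₁.nat 15 u 0 = u →
          2 * D < I.dist u v) ∨
        ∃ u ∈ S, u < v ∧ s'.nat 15 v 0 = u ∧ s₁.nat 15 u 0 = u ∧ I.dist u v ≤ 2 * D))
      ⟨fun w hw => by rw [h15, if_neg hw], Or.inl ⟨by simp [h15],
        fun u _ hu => absurd hu (by omega)⟩⟩ ?_
    · obtain ⟨g1, g2⟩ := this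
      generalize (loop 21 .pts (guard (Test.all [.natLE (.add (var 21) (.lit 1)) (var 20),
        .eq (entry 5 (var 21)) (.lit 1), .eq (entry 15 (var 21)) (var 21),
        .realLE (.read 0 (var 21) (var 20)) (.add (rvar 2) (rvar 2))])
        (setEntry 15 (var 20) (var 21)))).run s₂ = s₃ at *
      intro w hw
      by_cases hwv : w = v
      · subst hwv
        rcases g2 with ⟨k1, k2⟩ | ⟨u, k1, k2, k3, k4, k5⟩
        · exact Or.inl ⟨k1, fun u hu huS huu => k2 u hu u.2 huS (by rw [← g1 u hu.ne]; exact huu)⟩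
        · exact Or.inr ⟨u, k1, k2, k3, by rw [g1 u k2.ne]; exact k4, k5⟩
      · have hwlt : (w : ℕ) < v := by have := Fin.val_ne_of_ne hwv; omega
        have hne : ∀ u : Fin n, u < w → u ≠ v := fun u hu => by
          rintro rfl
          exact absurd (Fin.lt_def.1 hu) (by omega)
        rcases hI w hwlt with ⟨k1, k2⟩ | ⟨u, k1, k2, k3, k4, k5⟩
        · exact Or.inl ⟨by rw [g1 w hwv]; exact k1,
            fun u hu huS huu => k2 u hu huS (by rw [← g1 u (hne u hu)]; exact huu)⟩
        · exact Or.inr ⟨u, k1, k2, by rw [g1 w hwv]; exact k3, by rw [g1 u (hne u k2)]; exact k4, k5⟩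
    · intro u s₃ hA' hu ⟨g1, g2⟩
      have hl₃ := hl₂.agree hA'
      have hv₃ : s₃.nat 20 0 0 = v := by rw [hA'.nat 20 (by decide)]; exact hv₂
      have h5₃ : ∀ c : Fin n, s₃.nat 5 c 0 = 1 ↔ c ∈ S := by
        rw [hA'.nat 5 (by decide), h5]; exact hs.center
      have hD₃ : s₃.real 2 0 0 = D := by rw [hA'.real 2 (by decide)]; exact hD
      simp only [run_guard]
      split_ifs with h <;> simp only [Test.holds_all_cons, Test.holds_all_nil, Test.holds_eq,
        Test.holds_natLE, Test.holds_realLE, NatExp.eval, eval_var, eval_entry, RealExp.eval,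
        eval_rvar, hu, hv₃, h5₃, hD₃, hl₃.dist, ← two_mul, and_true] at h
      · obtain ⟨k1, k2, k3, k4⟩ := h
        have hlt : u < v := Fin.lt_def.2 (by omega)
        rw [g1 u hlt.ne] at k3
        refine ⟨fun w hw => ?_, Or.inr ⟨u, k2, hlt, by simp [hv₃, hu], k3, k4⟩⟩
        have := Fin.val_ne_of_ne hw
        simpa [hv₃, this] using g1 w hw
      · refine ⟨g1, g2.imp (fun ⟨k1, k2⟩ => ⟨k1, fun w hw hwu hwS hww => ?_⟩) id⟩
        by_cases hwu' : w = u
        · subst hwu'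
          by_contra hd
          exact h ⟨by have := Fin.lt_def.1 hw; omega, hwS, by rw [g1 w hw.ne]; exact hww,
            not_lt.1 hd⟩
        · exact k2 w hw (by have := Fin.val_ne_of_ne hwu'; omega) hwS hww

theorem markConflicts_run (hs : Centered I x D S s) (v : Fin n) (hv : s.nat 20 0 0 = v) (i : ℕ)
    (hi : s.nat 17 i 0 = 0) :
    (markConflicts.run s).nat 17 i 0 = 1 ↔
      ∃ u ∈ I.conflicts D S (fun v => s.nat 15 v 0) v, s.nat 18 u 0 = i := by
  classical
  have := run_loop_fin (n := n) (s₀ := s) (a := 21) (N := .pts) hs.loaded.pts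
    (p := guard (Test.all [.natLE (.add (var 21) (.lit 1)) (var 20),
      .eq (entry 5 (var 21)) (.lit 1), .eq (entry 15 (var 21)) (var 21),
      .realLE (.read 0 (var 21) (var 20))
        (.add (.add (.add (rvar 2) (rvar 2)) (.add (rvar 2) (rvar 2))) (.add (rvar 2) (rvar 2)))])
    (setEntry 17 (entry 18 (var 21)) (.lit 1)))
    (fun t s' => s'.nat 17 i 0 = 1 ↔ ∃ u : Fin n, (u : ℕ) < t ∧
      u ∈ I.conflicts D S (fun v => s.nat 15 v 0) v ∧ s.nat 18 u 0 = i)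
    (by
      simp only [hi, zero_ne_one, false_iff]
      rintro ⟨u, hu, -⟩
      omega) ?_
  · refine this.trans ⟨fun ⟨u, _, h⟩ => ⟨u, h⟩, fun ⟨u, h⟩ => ⟨u, u.2, h⟩⟩
  · intro u s' hA hu hI
    have hs' := hs.loaded.agree hA
    have e5 : ∀ c : Fin n, s'.nat 5 c 0 = 1 ↔ c ∈ S := by
      rw [hA.nat 5 (by decide)]; exact hs.center
    have e2 : s'.real 2 0 0 = D := by rw [hA.real 2 (by decide)]; exact hs.radius
    have e20 : s'.nat 20 0 0 = v := by rw [hA.nat 20 (by decide)]; exact hv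
    have e15 := hA.nat 15 (by decide)
    have e18 := hA.nat 18 (by decide)
    have hmem : u ∈ I.conflicts D S (fun v => s.nat 15 v 0) v ↔
        (u : ℕ) + 1 ≤ v ∧ u ∈ S ∧ s.nat 15 u 0 = u ∧ I.dist u v ≤ D + D + (D + D) + (D + D) := by
      rw [Instance.conflicts, Finset.mem_filter, show D + D + (D + D) + (D + D) = 6 * D by ring]
      simp only [Finset.mem_univ, true_and, Fin.lt_def, Nat.succ_le_iff]
    have hsucc : (∃ w : Fin n, (w : ℕ) < u + 1 ∧
        w ∈ I.conflicts D S (fun v => s.nat 15 v 0) v ∧ s.nat 18 w 0 = i) ↔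
        (∃ w : Fin n, (w : ℕ) < u ∧
        w ∈ I.conflicts D S (fun v => s.nat 15 v 0) v ∧ s.nat 18 w 0 = i) ∨
        (u ∈ I.conflicts D S (fun v => s.nat 15 v 0) v ∧ s.nat 18 u 0 = i) := by
      constructor
      · rintro ⟨w, hw, h⟩
        by_cases hwu : w = u
        · subst hwu; exact Or.inr h
        · exact Or.inl ⟨w, by have := Fin.val_ne_of_ne hwu; omega, h⟩
      · rintro (⟨w, hw, h⟩ | h)
        · exact ⟨w, by omega, h⟩
        · exact ⟨u, by omega, h⟩
    rw [hsucc, ← hI]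
    simp only [run_guard]
    split_ifs with h <;> simp only [Test.holds_all_cons, Test.holds_all_nil, Test.holds_eq,
      Test.holds_natLE, Test.holds_realLE, NatExp.eval, eval_var, eval_entry, RealExp.eval,
      eval_rvar, hu, e20, e5, e2, e15, hs'.dist, and_true, ← hmem] at h
    · simp only [run_setEntry, eval_entry, eval_var, NatExp.eval, hu, e18, Memory.nat_writeNat,
        true_and, and_true, h]
      split_ifs with h'
      · simp [h']
      · simp [Ne.symm h']
    · simp [h]

theorem colourDoubling_run (hs : Centered I x D S s) :
    ∃ own κ : Fin n → ℕ, I.IsNet D S own ∧ I.IsNetColouring D S own κ ∧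
      ∀ v p : Fin n, own v = p → (colourDoubling.run s).nat 10 v 0 = κ p := by
  classical
  unfold colourDoubling
  simp only [run_block_cons, run_block_nil]
  have hnet := owners_run hs
  have hs₁ : Centered I x D S (owners.run s) := ⟨hs.loaded.run,
    by rw [real_run (by decide)]; exact hs.radius, by rw [nat_run (by decide)]; exact hs.center⟩
  generalize owners.run s = s₁ at *
  set own : Fin n → ℕ := fun v => s₁.nat 15 v 0 with hown
  have hκ := run_loop_fin (n := n) (s₀ := s₁) (a := 20) (N := .pts) hs₁.loaded.pts
    (p := block [clearMarks, markConflicts, leastUnmarked, setEntry 18 (var 20) (var 16)])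
    (fun t s' => ∀ v : Fin n, (v : ℕ) < t →
      (∀ u ∈ I.conflicts D S own v, s'.nat 18 u 0 ≠ s'.nat 18 v 0) ∧
        s'.nat 18 v 0 ≤ (I.conflicts D S own v).card) (fun v hv => absurd hv (by omega)) (by
      intro v s₂ hA hv hI
      simp only [run_block_cons, run_block_nil]
      have hl₂ : Loaded I x s₂ := hs₁.loaded.agree hA
      have hclear := clearMarks_run hl₂
      have hs₃ : Centered I x D S (clearMarks.run s₂) := ⟨hl₂.run,
        by rw [real_run (by decide), hA.real 2 (by decide)]; exact hs₁.radius,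
        by rw [nat_run (by decide), hA.nat 5 (by decide)]; exact hs₁.center⟩
      have hv₃ : (clearMarks.run s₂).nat 20 0 0 = v := by rw [nat_run (by decide)]; exact hv
      have h18₃ : (clearMarks.run s₂).nat 18 = s₂.nat 18 := nat_run (by decide) _
      have h15₃ : (clearMarks.run s₂).nat 15 = s₁.nat 15 := by
        rw [nat_run (by decide), hA.nat 15 (by decide)]
      generalize clearMarks.run s₂ = s₃ at *
      have hmark : ∀ i < n + m + 1, (markConflicts.run s₃).nat 17 i 0 = 1 ↔
          ∃ u ∈ I.conflicts D S own v, s₂.nat 18 u 0 = i := by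
        intro i hi
        have := markConflicts_run hs₃ v hv₃ i (hclear i hi)
        rwa [h15₃, h18₃] at this
      have hl₄ : Loaded I x (markConflicts.run s₃) := hs₃.loaded.run
      have hv₄ : (markConflicts.run s₃).nat 20 0 0 = v := by rw [nat_run (by decide)]; exact hv₃
      have h18₄ : (markConflicts.run s₃).nat 18 = s₂.nat 18 := by rw [nat_run (by decide), h18₃]
      generalize markConflicts.run s₃ = s₄ at *
      obtain ⟨k1, k2⟩ := leastUnmarked_of_marks hl₄ (I.conflicts D S own v)
        (fun u => s₂.nat 18 u 0) (by
          have := Finset.card_le_univ (I.conflicts D S own v)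
          rw [Fintype.card_fin] at this
          omega) hmark
      have hv₅ : (leastUnmarked.run s₄).nat 20 0 0 = v := by rw [nat_run (by decide)]; exact hv₄
      have h18₅ : (leastUnmarked.run s₄).nat 18 = s₂.nat 18 := by rw [nat_run (by decide), h18₄]
      generalize leastUnmarked.run s₄ = s₅ at *
      have hself : ((setEntry 18 (var 20) (var 16)).run s₅).nat 18 v 0 = s₅.nat 16 0 0 := by
        simp [hv₅]
      have hne : ∀ w : Fin n, w ≠ v →
          ((setEntry 18 (var 20) (var 16)).run s₅).nat 18 w 0 = s₂.nat 18 w 0 := by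
        intro w hw
        simp [hv₅, Fin.val_inj, hw, h18₅]
      have hlt : ∀ w, ∀ u ∈ I.conflicts D S own w, u < w := fun w u hu =>
        (Finset.mem_filter.1 hu).2.1
      intro w hw
      by_cases hwv : w = v
      · subst hwv
        rw [hself]
        exact ⟨fun u hu => by rw [hne u (hlt w u hu).ne]; exact k1 u hu, k2⟩
      · have hwlt : (w : ℕ) < v := by have := Fin.val_ne_of_ne hwv; omega
        rw [hne w hwv]
        obtain ⟨q1, q2⟩ := hI w hwlt
        refine ⟨fun u hu => ?_, q2⟩
        rw [hne u]
        · exact q1 u hu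
        · rintro rfl
          exact absurd (Fin.lt_def.1 (hlt w u hu)) (by omega))
  have hl₂ : Loaded I x ((loop 20 .pts (block [clearMarks, markConflicts, leastUnmarked,
      setEntry 18 (var 20) (var 16)])).run s₁) := hs₁.loaded.run
  have h15 : ((loop 20 .pts (block [clearMarks, markConflicts, leastUnmarked,
      setEntry 18 (var 20) (var 16)])).run s₁).nat 15 = s₁.nat 15 := nat_run (by decide) _
  generalize (loop 20 .pts (block [clearMarks, markConflicts, leastUnmarked,
      setEntry 18 (var 20) (var 16)])).run s₁ = s₂ at *
  refine ⟨own, fun v => s₂.nat 18 v 0, hnet, fun v => hκ v v.2, fun v p hvp => ?_⟩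
  have h10 := (run_loop_each (n := n) (s₀ := s₂) (a := 20) (N := .pts)
    (p := setEntry 10 (var 20) (entry 18 (entry 15 (var 20)))) hl₂.pts (fun _ => True)
    (fun v s' => s'.nat 10 v 0 = s₂.nat 18 (own v) 0) trivial (by
      intro v s' hA hv _
      refine ⟨trivial, ?_, fun v' hlt h => ?_⟩
      · simp [hv, hA.nat 18 (by decide), hA.nat 15 (by decide), h15, hown]
      · have : (v' : ℕ) ≠ v := Fin.val_ne_of_ne hlt.ne
        simp [hv, this, h])).2
  rw [h10 v, hvp]

/-- The colouring procedure for doubling metrics leads to the approximation factor `O(2 ^ (3 dim))`. -/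
theorem colours_doubling (I : Instance n) (x : Fin n → Fin m → ℝ) :
    Colours colourDoubling I x (24 * 2 ^ (3 * doublingDim I.dist)) := by
  intro s D S hs hD hk
  obtain ⟨own, κ, hnet, hκ, hcol⟩ := colourDoubling_run hs
  have hcard : ∀ v, (I.conflicts D S own v).card ≤ n := fun v => by
    have := Finset.card_le_univ (I.conflicts D S own v)
    rwa [Fintype.card_fin] at this
  refine ⟨fun c hc => ?_, ?_⟩
  · have := (hκ.isColouring hnet hD hcol hcard).lt c hc
    omega
  · -- the packing bound needs `0 < D`; for `D = 0` every number of colours is good enough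
    rcases hD.eq_or_lt with rfl | hpos
    · exact ⟨_, _, hκ.isColouring hnet le_rfl hcol hcard, by simp⟩
    · refine ⟨_, _, hκ.isColouring hnet hD hcol (hnet.card_conflicts hpos), ?_⟩
      have h1 : doublingConstant I.dist ≤ 2 ^ doublingDim I.dist :=
        Nat.le_pow_clog (by norm_num) _
      have h2 : ((doublingConstant I.dist : ℝ)) ^ 3 ≤ 2 ^ (3 * doublingDim I.dist) := by
        rw [mul_comm, pow_mul]
        exact pow_le_pow_left₀ (Nat.cast_nonneg _) (by exact_mod_cast h1) 3
      have h3 : (1 : ℝ) ≤ 2 ^ (3 * doublingDim I.dist) := one_le_pow₀ (by norm_num)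
      push_cast
      generalize (2 : ℝ) ^ (3 * doublingDim I.dist) = y at *
      generalize (doublingConstant I.dist : ℝ) ^ 3 = z at *
      have : 2 * ((z + 1) * (4 * D + 2 * D)) = (12 * (z + 1)) * D := by ring
      rw [this]
      exact mul_le_mul_of_nonneg_right (by linarith) hD

end Code

/-! ### Colouring the centers of an `L_p`-metric -/

section Blocks

variable {n : ℕ} {D : ℝ} {y : Fin n → ℝ} {β : Fin n → ℕ}

/-- A division of the points of a line into consecutive blocks: the `b`-th block begins at `st b`,
has length at most `2 * D`, and its beginning is more than `2 * D` before the beginning of the next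
block. There may be long gaps between the blocks. -/
def IsBlocking (D : ℝ) (y : Fin n → ℝ) (β : Fin n → ℕ) : Prop :=
  ∃ st : ℕ → ℝ, ∀ v, st (β v) ≤ y v ∧ y v ≤ st (β v) + 2 * D ∧
    ∀ b < β v, st b + 2 * D < st (b + 1)

theorem succ_div_eq {N j b : ℕ} (hj : j < N) (hb : (b + 1) % N ≠ j) :
    (b + 1 + (N - j)) / N = (b + (N - j)) / N := by
  rw [show b + 1 + (N - j) = b + (N - j) + 1 by omega, Nat.succ_div, if_neg, add_zero]
  rintro ⟨q, hq⟩
  apply hb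
  have hq0 : q ≠ 0 := by
    rintro rfl
    omega
  obtain ⟨q', rfl⟩ := Nat.exists_eq_succ_of_ne_zero hq0
  have : b + 1 = N * q' + j := by
    rw [Nat.mul_succ] at hq
    omega
  rw [this, Nat.mul_add_mod, Nat.mod_eq_of_lt hj]

/-- A chain of points with steps of length at most `2 * D` that avoids all blocks with index `j`
modulo `N` stays within fewer than `N` consecutive blocks without long gaps. -/
theorem IsBlocking.chain (h : IsBlocking D y β) (hD : 0 ≤ D) {N j : ℕ} (hj : j < N) {u v : Fin n}
    (huv : Relation.ReflTransGen
      (fun a b => (β a % N ≠ j ∧ β b % N ≠ j) ∧ |y a - y b| ≤ 2 * D) u v) :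
    |y u - y v| ≤ 4 * N * D := by
  obtain ⟨st, hst⟩ := h
  have hmono : ∀ w, ∀ b c : ℕ, b ≤ c → c ≤ β w → st b ≤ st c := by
    intro w b c hbc hc
    induction c, hbc using Nat.le_induction with
    | base => exact le_rfl
    | succ c hbc ih =>
      have := (hst w).2.2 c (by omega)
      linarith [ih (by omega)]
  have hstep : ∀ a b, |y a - y b| ≤ 2 * D → β b ≤ β a + 1 ∧
      (β b = β a + 1 → st (β a + 1) ≤ st (β a) + 4 * D) := by
    intro a b hab
    obtain ⟨h1, h2⟩ := abs_le.1 hab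
    obtain ⟨ha1, ha2, -⟩ := hst a
    obtain ⟨hb1, hb2, hb3⟩ := hst b
    refine ⟨?_, fun heq => ?_⟩
    · by_contra hlt
      have e1 := hb3 (β a) (by omega)
      have e2 := hb3 (β a + 1) (by omega)
      have e3 := hmono b (β a + 1 + 1) (β b) (by omega) le_rfl
      linarith
    · rw [heq] at hb1
      linarith
  -- the indices that are `j` modulo `N` cut the sequence of blocks into periods, which are numbered by
  -- this quotient; the chain stays in its period, and all gaps that it crosses are short
  have key : (β u + (N - j)) / N = (β v + (N - j)) / N ∧
      ∀ b, min (β u) (β v) ≤ b → b < max (β u) (β v) → st (b + 1) ≤ st b + 4 * D := by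
    induction huv with
    | refl => exact ⟨rfl, fun b h1 h2 => by omega⟩
    | @tail v w _ hvw ih =>
      obtain ⟨ih1, ih2⟩ := ih
      obtain ⟨⟨hv, hw⟩, hd⟩ := hvw
      obtain ⟨s1, s2⟩ := hstep v w hd
      obtain ⟨s3, s4⟩ := hstep w v (by rwa [abs_sub_comm])
      have hcases : β w = β v ∨ β w = β v + 1 ∨ β v = β w + 1 := by omega
      rcases hcases with h | h | h
      · rw [h]; exact ⟨ih1, ih2⟩
      · refine ⟨by rw [ih1, h, succ_div_eq hj (by rwa [← h])], fun b hb1 hb2 => ?_⟩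
        by_cases hb : b = β v
        · rw [hb]; exact s2 h
        · exact ih2 b (by omega) (by omega)
      · refine ⟨by rw [ih1, h, succ_div_eq hj (by rwa [← h])], fun b hb1 hb2 => ?_⟩
        by_cases hb : b = β w
        · rw [hb]; exact s4 h
        · exact ih2 b (by omega) (by omega)
  obtain ⟨hq, hgap⟩ := key
  have hN : 0 < N := by omega
  have habs : max (β u) (β v) + 1 ≤ min (β u) (β v) + N := by
    have e1 := Nat.div_add_mod (β u + (N - j)) N
    have e2 := Nat.div_add_mod (β v + (N - j)) N
    have e3 := Nat.mod_lt (β u + (N - j)) hN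
    have e4 := Nat.mod_lt (β v + (N - j)) hN
    rw [hq] at e1
    omega
  -- the total length of the blocks between `u` and `v`
  have hlen : ∀ c, min (β u) (β v) ≤ c → c ≤ max (β u) (β v) →
      st c ≤ st (min (β u) (β v)) + ((c : ℝ) - (min (β u) (β v) : ℕ)) * (4 * D) := by
    intro c hc
    induction c, hc using Nat.le_induction with
    | base => intro _; simp
    | succ c hc ih =>
      intro hlt
      have e1 := ih (by omega)
      have e2 := hgap c hc (by omega)
      push_cast at e1 ⊢
      linarith
  have htot := hlen _ (min_le_max) le_rfl
  have hcast : ((max (β u) (β v) : ℕ) : ℝ) - (min (β u) (β v) : ℕ) ≤ N - 1 := by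
    have : ((max (β u) (β v) : ℕ) : ℝ) + 1 ≤ (min (β u) (β v) : ℕ) + N := by exact_mod_cast habs
    linarith
  have hbound : st (max (β u) (β v)) - st (min (β u) (β v)) ≤ (N - 1) * (4 * D) := by
    have := mul_le_mul_of_nonneg_right hcast (by positivity : 0 ≤ 4 * D)
    linarith
  obtain ⟨hu1, hu2, -⟩ := hst u
  obtain ⟨hv1, hv2, -⟩ := hst v
  rw [abs_le]
  rcases le_total (β u) (β v) with hle | hle
  · rw [max_eq_right hle, min_eq_left hle] at hbound
    have := hmono v _ _ hle le_rfl
    constructor <;> nlinarith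
  · rw [max_eq_left hle, min_eq_right hle] at hbound
    have := hmono u _ _ hle le_rfl
    constructor <;> nlinarith

end Blocks

/-- If every coordinate has a blocking and the colour of a point avoids the indices modulo `m + 1` of
its blocks, then the distances in the chains of the colour classes are bounded. -/
theorem Instance.isColouring_of_blocking {n : ℕ} {I : Instance n} {D : ℝ} {S : Finset (Fin n)}
    {m : ℕ} {x : Fin n → Fin m → ℝ} {β : Fin m → Fin n → ℕ} {col : Fin n → ℕ} (hD : 0 ≤ D)
    (hβ : ∀ i, IsBlocking D (fun v => x v i) (β i)) (hcol : ∀ v i, β i v % (m + 1) ≠ col v)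
    (hle : ∀ v, col v ≤ m) (hx : ∀ u v i, |x u i - x v i| ≤ I.dist u v) {ρ : ℝ}
    (hρ : ∀ u v r, 0 ≤ r → (∀ i, |x u i - x v i| ≤ r) → I.dist u v ≤ ρ * r) :
    I.IsColouring D S col (m + 1) (ρ * (4 * (m + 1) * D)) := by
  refine ⟨fun c _ => Nat.lt_succ_iff.2 (hle c), fun c c' hcc => hρ c c' _ (by positivity) fun i => ?_⟩
  have key : col c' = col c ∧ Relation.ReflTransGen (fun a b => (β i a % (m + 1) ≠ col c ∧
      β i b % (m + 1) ≠ col c) ∧ |x a i - x b i| ≤ 2 * D) c c' := by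
    induction hcc with
    | refl => exact ⟨rfl, .refl⟩
    | @tail a b _ hab ih =>
      have h1 : col b = col c := by rw [← hab.2.1, ih.1]
      refine ⟨h1, ih.2.tail ⟨⟨?_, ?_⟩, (hx a b i).trans hab.2.2⟩⟩
      · rw [← ih.1]; exact hcol a i
      · rw [← h1]; exact hcol b i
  have := (hβ i).chain hD (Nat.lt_succ_iff.2 (hle c)) key.2
  push_cast at this
  exact this

namespace Code

/-- Finds the smallest coordinate, with index given by the variable `20`, of a point that does not
belong to a block yet, and stores it in the real variable `5`. -/
def findStart : Code :=
  block [
    set 28 (.lit 0),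
    loop 22 .pts (guard (Test.all [.eq (.read 29 (var 22) (var 20)) (.lit 0),
        .not (Test.all [.eq (var 28) (.lit 1), .realLE (rvar 5) (.read 1 (var 22) (var 20))])])
      (block [real 5 (.lit 0) (.lit 0) (.read 1 (var 22) (var 20)), set 28 (.lit 1)]))]

/-- Puts all points that are at most `2 * D` behind the beginning of the block and do not belong to
a block yet into the block, whose number is in the variable `21`, and whose number modulo `m + 1` is
in the variable `19`. -/
def fillBlock : Code :=
  loop 22 .pts (guard (Test.all [.eq (.read 29 (var 22) (var 20)) (.lit 0),
      .realLE (.read 1 (var 22) (var 20)) (.add (rvar 5) (.add (rvar 2) (rvar 2)))])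
    (block [nat 29 (var 22) (var 20) (.add (var 21) (.lit 1)), nat 30 (var 22) (var 20) (var 19)]))

/-- Increases the variable `19` modulo `m + 1`. -/
def nextResidue : Code :=
  ite (.natLE (.add (var 19) (.lit 1)) (.read 0 (.lit 0) (.lit 2)))
    (set 19 (.add (var 19) (.lit 1))) (set 19 (.lit 0))

/-- Divides the points into blocks with respect to one coordinate. -/
def blocks : Code :=
  block [
    loop 22 .pts (nat 29 (var 22) (var 20) (.lit 0)),
    set 19 (.lit 0),
    loop 21 .pts (block [findStart, fillBlock, nextResidue])]

/-- Marks the residues of the blocks of the point in the variable `20`. -/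
def markResidues : Code := loop 21 .dim (setEntry 17 (.read 30 (var 20) (var 21)) (.lit 1))

/-- Colours the centers of an `L_p`-metric. -/
def colourLp : Code :=
  block [
    loop 20 .dim blocks,
    loop 20 .pts (block [clearMarks, markResidues, leastUnmarked, setEntry 10 (var 20) (var 16)])]

variable {n : ℕ} {I : Instance n} {m : ℕ} {x : Fin n → Fin m → ℝ} {s : Memory} {D : ℝ}

theorem findStart_run (hs : Loaded I x s) (i : Fin m) (hi : s.nat 20 0 0 = i) :
    ((∃ w : Fin n, s.nat 29 w i = 0 ∧ (findStart.run s).real 5 0 0 = x w i) ∧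
      ∀ v : Fin n, s.nat 29 v i = 0 → (findStart.run s).real 5 0 0 ≤ x v i) ∨
    ∀ v : Fin n, s.nat 29 v i ≠ 0 := by
  unfold findStart
  simp only [run_block_cons, run_block_nil]
  obtain ⟨s₁, hs₁⟩ : ∃ s₁, (set 28 (.lit 0)).run s = s₁ := ⟨_, rfl⟩
  have hl₁ : Loaded I x s₁ := hs₁ ▸ hs.run
  have h28 : s₁.nat 28 0 0 = 0 := by rw [← hs₁]; simp
  have h29 : s₁.nat 29 = s.nat 29 := by rw [← hs₁, nat_run (by decide)]
  have hi₁ : s₁.nat 20 0 0 = i := by rw [← hs₁, nat_run (by decide)]; exact hi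
  rw [hs₁]
  have := run_loop_fin (n := n) (s₀ := s₁) (a := 22) (N := .pts) hl₁.pts
    (p := guard (Test.all [.eq (.read 29 (var 22) (var 20)) (.lit 0),
        .not (Test.all [.eq (var 28) (.lit 1), .realLE (rvar 5) (.read 1 (var 22) (var 20))])])
      (block [real 5 (.lit 0) (.lit 0) (.read 1 (var 22) (var 20)), set 28 (.lit 1)]))
    (fun t s' => (s'.nat 28 0 0 = 1 ∧ (∃ w : Fin n, s.nat 29 w i = 0 ∧ s'.real 5 0 0 = x w i) ∧
      ∀ v : Fin n, (v : ℕ) < t → s.nat 29 v i = 0 → s'.real 5 0 0 ≤ x v i) ∨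
      (s'.nat 28 0 0 = 0 ∧ ∀ v : Fin n, (v : ℕ) < t → s.nat 29 v i ≠ 0))
    (Or.inr ⟨h28, fun v hv => absurd hv (by omega)⟩) ?_
  · exact this.imp (fun h => ⟨h.2.1, fun v => h.2.2 v v.2⟩) fun h v => h.2 v v.2
  · intro v s' hA hv hI
    have hs' := hl₁.agree hA
    have e29 : s'.nat 29 = s.nat 29 := by rw [hA.nat 29 (by decide), h29]
    have e20 : s'.nat 20 0 0 = i := by rw [hA.nat 20 (by decide)]; exact hi₁
    have hsplit : ∀ w : Fin n, (w : ℕ) < v + 1 → w = v ∨ (w : ℕ) < v := fun w hw => by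
      by_cases hwv : w = v
      · exact Or.inl hwv
      · have := Fin.val_ne_of_ne hwv
        exact Or.inr (by omega)
    simp only [run_guard]
    split_ifs with h <;> simp only [Test.holds_all_cons, Test.holds_all_nil, Test.holds_eq,
      Test.holds_not, Test.holds_realLE, NatExp.eval, eval_var, RealExp.eval, eval_rvar, hv, e20,
      e29, hs'.coord, and_true] at h
    · left
      obtain ⟨h1, h2⟩ := h
      have e5 : ((block [real 5 (.lit 0) (.lit 0) (.read 1 (var 22) (var 20)),
          set 28 (.lit 1)]).run s').real 5 0 0 = x v i := by
        simp [hv, e20, hs'.coord]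
      rw [e5]
      refine ⟨by simp, ⟨v, h1, rfl⟩, fun w hw hw0 => ?_⟩
      rcases hsplit w hw with rfl | hlt
      · exact le_rfl
      · rcases hI with ⟨k1, -, k3⟩ | ⟨-, k2⟩
        · by_contra hgt
          exact h2 ⟨k1, (k3 w hlt hw0).trans (not_le.1 hgt).le⟩
        · exact absurd hw0 (k2 w hlt)
    · rcases hI with ⟨k1, k2, k3⟩ | ⟨k1, k2⟩
      · refine Or.inl ⟨k1, k2, fun w hw hw0 => ?_⟩
        rcases hsplit w hw with rfl | hlt
        · by_contra hgt
          exact h ⟨hw0, fun hh => hgt hh.2⟩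
        · exact k3 w hlt hw0
      · refine Or.inr ⟨k1, fun w hw hw0 => ?_⟩
        rcases hsplit w hw with rfl | hlt
        · exact h ⟨hw0, fun hh => by omega⟩
        · exact k2 w hlt hw0

open Classical in
theorem fillBlock_run (hs : Loaded I x s) (i : Fin m) (hi : s.nat 20 0 0 = i) {t q : ℕ}
    (ht : s.nat 21 0 0 = t) (hq : s.nat 19 0 0 = q) {y₀ : ℝ} (hD : s.real 2 0 0 = D)
    (hy : s.real 5 0 0 = y₀) :
    (∀ v : Fin n, (fillBlock.run s).nat 29 v i =
        if s.nat 29 v i = 0 ∧ x v i ≤ y₀ + 2 * D then t + 1 else s.nat 29 v i) ∧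
      (∀ v : Fin n, (fillBlock.run s).nat 30 v i =
        if s.nat 29 v i = 0 ∧ x v i ≤ y₀ + 2 * D then q else s.nat 30 v i) ∧
      ∀ (v : Fin n) (i' : Fin m), i' ≠ i → (fillBlock.run s).nat 30 v i' = s.nat 30 v i' := by
  have := run_loop_fin (n := n) (s₀ := s) (a := 22) (N := .pts) hs.pts
    (p := guard (Test.all [.eq (.read 29 (var 22) (var 20)) (.lit 0),
      .realLE (.read 1 (var 22) (var 20)) (.add (rvar 5) (.add (rvar 2) (rvar 2)))])
    (block [nat 29 (var 22) (var 20) (.add (var 21) (.lit 1)), nat 30 (var 22) (var 20) (var 19)]))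
    (fun r s' => (∀ v : Fin n, s'.nat 29 v i =
        if (v : ℕ) < r ∧ s.nat 29 v i = 0 ∧ x v i ≤ y₀ + 2 * D then t + 1 else s.nat 29 v i) ∧
      (∀ v : Fin n, s'.nat 30 v i =
        if (v : ℕ) < r ∧ s.nat 29 v i = 0 ∧ x v i ≤ y₀ + 2 * D then q else s.nat 30 v i) ∧
      ∀ (v : Fin n) (i' : Fin m), i' ≠ i → s'.nat 30 v i' = s.nat 30 v i')
    ⟨fun v => by simp, fun v => by simp, fun _ _ _ => rfl⟩ ?_
  · refine ⟨fun v => ?_, fun v => ?_, this.2.2⟩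
    · exact (this.1 v).trans (by simp)
    · exact (this.2.1 v).trans (by simp)
  · intro v s' hA hv ⟨h1, h2, h3⟩
    have hs' := hs.agree hA
    have e20 : s'.nat 20 0 0 = i := by rw [hA.nat 20 (by decide)]; exact hi
    have e21 : s'.nat 21 0 0 = t := by rw [hA.nat 21 (by decide)]; exact ht
    have e19 : s'.nat 19 0 0 = q := by rw [hA.nat 19 (by decide)]; exact hq
    have e2 : s'.real 2 0 0 = D := by rw [hA.real 2 (by decide)]; exact hD
    have e5 : s'.real 5 0 0 = y₀ := by rw [hA.real 5 (by decide)]; exact hy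
    have e29 : s'.nat 29 v i = s.nat 29 v i := by rw [h1]; simp
    have hlt : ∀ w : Fin n, w ≠ v → ((w : ℕ) < v + 1 ↔ (w : ℕ) < v) := fun w hw => by
      have := Fin.val_ne_of_ne hw
      omega
    simp only [run_guard]
    split_ifs with h <;> simp only [Test.holds_all_cons, Test.holds_all_nil, Test.holds_eq,
      Test.holds_realLE, NatExp.eval, eval_var, RealExp.eval, eval_rvar, hv, e20, e29, e2, e5,
      hs'.coord, and_true, ← two_mul] at h
    · simp only [run_block_cons, run_block_nil, run_nat, eval_var, NatExp.eval,
        Memory.nat_writeNat, hv, e20, e21, e19, Fin.val_inj]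
      refine ⟨fun w => ?_, fun w => ?_, fun w i' hi' => ?_⟩
      · by_cases hw : w = v
        · subst hw; simp [h]
        · simp [hw, hlt w hw, h1 w]
      · by_cases hw : w = v
        · subst hw; simp [h]
        · simp [hw, hlt w hw, h2 w, Fin.val_inj]
      · simp [hi', h3 w i' hi', Fin.val_inj]
    · refine ⟨fun w => ?_, fun w => ?_, h3⟩
      · by_cases hw : w = v
        · subst hw; rw [h1]; simp [h]
        · rw [h1]; simp only [hlt w hw]
      · by_cases hw : w = v
        · subst hw; rw [h2]; simp [h]
        · rw [h2]; simp only [hlt w hw]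

theorem nextResidue_run (hs : Loaded I x s) {t : ℕ} (hq : s.nat 19 0 0 = t % (m + 1)) :
    (nextResidue.run s).nat 19 0 0 = (t + 1) % (m + 1) := by
  have h1 : (t + 1) % (m + 1) = (t % (m + 1) + 1) % (m + 1) := (Nat.mod_add_mod t (m + 1) 1).symm
  have h2 : t % (m + 1) < m + 1 := Nat.mod_lt t (Nat.succ_pos m)
  simp only [nextResidue, run_ite]
  split_ifs with h <;> simp only [Test.holds_natLE, NatExp.eval, eval_var, hq, hs.dims] at h
  · simp only [run_set, NatExp.eval, eval_var, Memory.nat_writeNat, and_self, if_true, hq]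
    rw [h1, Nat.mod_eq_of_lt (Nat.lt_succ_of_le h)]
  · simp only [run_set, NatExp.eval, Memory.nat_writeNat, and_self, if_true]
    rw [h1, show t % (m + 1) + 1 = m + 1 by omega, Nat.mod_self]

/-- The state of the division of the points into blocks after `t` blocks: `e v` is `0` if `v` does
not belong to a block yet, and otherwise one more than the index of its block. The field `card`
shows that `n` blocks suffice. -/
structure PartialBlocks (D : ℝ) (y : Fin n → ℝ) (t : ℕ) (e : Fin n → ℕ) (st : ℕ → ℝ) : Prop where
  le : ∀ v, e v ≤ t
  bounds : ∀ v, e v ≠ 0 → st (e v - 1) ≤ y v ∧ y v ≤ st (e v - 1) + 2 * D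
  gap : ∀ v, e v ≠ 0 → ∀ b < e v - 1, st b + 2 * D < st (b + 1)
  rest : ∀ v, e v = 0 → ∀ b < t, st b + 2 * D < y v
  rest_gap : ∀ v, e v = 0 → ∀ b, b + 1 < t → st b + 2 * D < st (b + 1)
  card : (∀ v, e v ≠ 0) ∨ t ≤ (Finset.univ.filter fun v => e v ≠ 0).card

/-- One more block is added. It begins at the smallest point that does not belong to a block yet; if
there is no such point, the value `y₀` is irrelevant and the block is empty. -/
theorem PartialBlocks.succ {y : Fin n → ℝ} {t : ℕ} {e e' : Fin n → ℕ} {st : ℕ → ℝ} {y₀ : ℝ}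
    (h : PartialBlocks D y t e st) (hD : 0 ≤ D)
    (hy : ((∃ w, e w = 0 ∧ y₀ = y w) ∧ ∀ v, e v = 0 → y₀ ≤ y v) ∨ ∀ v, e v ≠ 0)
    (he' : ∀ v, (e v = 0 ∧ y v ≤ y₀ + 2 * D → e' v = t + 1) ∧
      (¬ (e v = 0 ∧ y v ≤ y₀ + 2 * D) → e' v = e v)) :
    ∃ st', PartialBlocks D y (t + 1) e' st' := by
  rcases hy with ⟨⟨w, hw, hyw⟩, hmin⟩ | hall
  · have hst : ∀ b, b ≠ t → Function.update st t y₀ b = st b := fun b hb =>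
      Function.update_of_ne hb _ _
    have hstt : Function.update st t y₀ t = y₀ := Function.update_self _ _ _
    have hgap : ∀ b < t, Function.update st t y₀ b + 2 * D < Function.update st t y₀ (b + 1) := by
      intro b hb
      rw [hst b (by omega)]
      by_cases hbt : b + 1 = t
      · rw [hbt, hstt, hyw]
        exact h.rest w hw b hb
      · rw [hst _ hbt]
        exact h.rest_gap w hw b (by omega)
    have hcase : ∀ v, (e v = 0 ∧ y v ≤ y₀ + 2 * D ∧ e' v = t + 1) ∨ (e v ≠ 0 ∧ e' v = e v) ∨
        (e v = 0 ∧ y₀ + 2 * D < y v ∧ e' v = 0) := by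
      intro v
      by_cases h1 : e v = 0
      · by_cases h2 : y v ≤ y₀ + 2 * D
        · exact Or.inl ⟨h1, h2, (he' v).1 ⟨h1, h2⟩⟩
        · exact Or.inr (Or.inr ⟨h1, not_le.1 h2, by rw [(he' v).2 fun hh => h2 hh.2, h1]⟩)
      · exact Or.inr (Or.inl ⟨h1, (he' v).2 fun hh => h1 hh.1⟩)
    refine ⟨Function.update st t y₀, fun v => ?_, fun v hv => ?_, fun v hv b hb => ?_,
      fun v hv b hb => ?_, fun v _ b hb => hgap b (by omega), Or.inr ?_⟩
    · have := h.le v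
      rcases hcase v with h1 | h1 | h1 <;> omega
    · rcases hcase v with ⟨h1, h2, h3⟩ | ⟨h1, h2⟩ | ⟨h1, h2, h3⟩
      · rw [h3, Nat.add_sub_cancel, hstt]
        exact ⟨hmin v h1, h2⟩
      · have := h.le v
        rw [h2, hst _ (by omega)]
        exact h.bounds v h1
      · exact absurd h3 hv
    · have := h.le v
      refine hgap b ?_
      rcases hcase v with h1 | h1 | h1 <;> omega
    · rcases hcase v with ⟨-, -, h3⟩ | ⟨h1, h2⟩ | ⟨h1, h2, -⟩
      · omega
      · omega
      · by_cases hbt : b = t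
        · rw [hbt, hstt]; exact h2
        · rw [hst b hbt]
          exact h.rest v h1 b (by omega)
    · have hlt : (Finset.univ.filter fun v => e v ≠ 0).card <
          (Finset.univ.filter fun v => e' v ≠ 0).card := by
        refine Finset.card_lt_card ⟨fun v hv => ?_, fun hsub => ?_⟩
        · simp only [Finset.mem_filter, Finset.mem_univ, true_and] at hv ⊢
          rcases hcase v with h1 | h1 | h1 <;> omega
        · have h1 : e' w = t + 1 := (he' w).1 ⟨hw, by rw [hyw]; linarith⟩
          have := hsub (Finset.mem_filter.2 ⟨Finset.mem_univ w, by omega⟩)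
          exact (Finset.mem_filter.1 this).2 hw
      have := h.card.resolve_left fun hh => hh w hw
      omega
  · have heq : ∀ v, e' v = e v := fun v => (he' v).2 fun hh => hall v hh.1
    refine ⟨st, fun v => ?_, fun v => ?_, fun v => ?_, fun v hv => ?_, fun v hv => ?_, Or.inl ?_⟩
    · have := h.le v
      rw [heq v]; omega
    · rw [heq v]; exact h.bounds v
    · rw [heq v]; exact h.gap v
    · exact absurd ((heq v).symm.trans hv) (hall v)
    · exact absurd ((heq v).symm.trans hv) (hall v)
    · exact fun v => by rw [heq v]; exact hall v

theorem blocks_run (hs : Loaded I x s) (hD : s.real 2 0 0 = D) (hD₀ : 0 ≤ D) (i : Fin m)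
    (hi : s.nat 20 0 0 = i) :
    (∃ β : Fin n → ℕ, IsBlocking D (fun v => x v i) β ∧
      ∀ v : Fin n, (blocks.run s).nat 30 v i = β v % (m + 1)) ∧
    ∀ (v : Fin n) (i' : Fin m), i' ≠ i → (blocks.run s).nat 30 v i' = s.nat 30 v i' := by
  unfold blocks
  simp only [run_block_cons, run_block_nil]
  have h29 := (run_loop_each (n := n) (s₀ := s) (a := 22) (N := .pts)
    (p := nat 29 (var 22) (var 20) (.lit 0)) hs.pts (fun _ => True)
    (fun v s' => s'.nat 29 v i = 0) trivial (by
      intro v s' hA hv _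
      have : s'.nat 20 0 0 = i := by rw [hA.nat 20 (by decide)]; exact hi
      refine ⟨trivial, by simp [hv, this], fun v' _ h => by simp [h]⟩)).2
  obtain ⟨s₁, hs₁⟩ : ∃ s₁, (set 19 (.lit 0)).run
      ((loop 22 .pts (nat 29 (var 22) (var 20) (.lit 0))).run s) = s₁ := ⟨_, rfl⟩
  have hl₁ : Loaded I x s₁ :=
    hs₁ ▸ (hs.run (p := loop 22 .pts (nat 29 (var 22) (var 20) (.lit 0)))).run (p := set 19 (.lit 0))
  have h29₁ : ∀ v : Fin n, s₁.nat 29 v i = 0 := by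
    rw [← hs₁, nat_run (by decide)]; exact h29
  have h19 : s₁.nat 19 0 0 = 0 := by rw [← hs₁]; simp
  have hi₁ : s₁.nat 20 0 0 = i := by
    rw [← hs₁, nat_run (by decide), nat_run (by decide)]; exact hi
  have hD₁ : s₁.real 2 0 0 = D := by
    rw [← hs₁, real_run (by decide), real_run (by decide)]; exact hD
  have h30 : s₁.nat 30 = s.nat 30 := by rw [← hs₁, nat_run (by decide), nat_run (by decide)]
  rw [hs₁]
  have := run_loop_fin (n := n) (s₀ := s₁) (a := 21) (N := .pts) hl₁.pts
    (p := block [findStart, fillBlock, nextResidue])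
    (fun t s' => (∃ st, PartialBlocks D (fun v => x v i) t (fun v : Fin n => s'.nat 29 v i) st) ∧
      (∀ v : Fin n, s'.nat 29 v i ≠ 0 → s'.nat 30 v i = (s'.nat 29 v i - 1) % (m + 1)) ∧
      s'.nat 19 0 0 = t % (m + 1) ∧
      ∀ (v : Fin n) (i' : Fin m), i' ≠ i → s'.nat 30 v i' = s.nat 30 v i')
    ⟨⟨fun _ => 0, ⟨fun v => (h29₁ v).le, fun v hv => absurd (h29₁ v) hv,
      fun v hv => absurd (h29₁ v) hv, fun v _ b hb => absurd hb (by omega),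
      fun v _ b hb => absurd hb (by omega), Or.inr (Nat.zero_le _)⟩⟩,
      fun v hv => absurd (h29₁ v) hv, by rw [h19, Nat.zero_mod],
      fun v i' _ => by rw [h30]⟩ ?_
  · obtain ⟨⟨st, hP⟩, h2, -, h4⟩ := this
    generalize (loop 21 .pts (block [findStart, fillBlock, nextResidue])).run s₁ = s₂ at *
    have hall : ∀ v : Fin n, s₂.nat 29 v i ≠ 0 := by
      rcases hP.card with h | h
      · exact h
      · have huniv : (Finset.univ.filter fun v : Fin n => s₂.nat 29 v i ≠ 0) = Finset.univ := by
          refine Finset.eq_univ_of_card _ (le_antisymm (Finset.card_le_univ _) ?_)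
          rw [Fintype.card_fin]
          exact h
        intro v
        have := Finset.mem_univ v
        rw [← huniv] at this
        exact (Finset.mem_filter.1 this).2
    exact ⟨⟨fun v => s₂.nat 29 v i - 1, ⟨st, fun v => ⟨(hP.bounds v (hall v)).1,
      (hP.bounds v (hall v)).2, hP.gap v (hall v)⟩⟩, fun v => h2 v (hall v)⟩, h4⟩
  · intro t s₂ hA ht ⟨⟨st, hP⟩, h2, h3, h4⟩
    have hl₂ := hl₁.agree hA
    have hi₂ : s₂.nat 20 0 0 = i := by rw [hA.nat 20 (by decide)]; exact hi₁
    have hD₂ : s₂.real 2 0 0 = D := by rw [hA.real 2 (by decide)]; exact hD₁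
    simp only [run_block_cons, run_block_nil]
    have hstart := findStart_run hl₂ i hi₂
    obtain ⟨f1, f2, f3⟩ := fillBlock_run (s := findStart.run s₂) (D := D) hl₂.run i
      (by rw [nat_run (by decide)]; exact hi₂) (t := t) (q := t % (m + 1))
      (by rw [nat_run (by decide)]; exact ht) (by rw [nat_run (by decide)]; exact h3)
      (by rw [real_run (by decide)]; exact hD₂) rfl
    simp only [nat_run (p := findStart) (a := 29) (by decide),
      nat_run (p := findStart) (a := 30) (by decide)] at f1 f2 f3
    have hl₃ : Loaded I x (fillBlock.run (findStart.run s₂)) := (hl₂.run (p := findStart)).run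
    have h19₃ : (fillBlock.run (findStart.run s₂)).nat 19 0 0 = t % (m + 1) := by
      rw [nat_run (by decide), nat_run (by decide)]; exact h3
    have hnext := nextResidue_run hl₃ h19₃
    generalize fillBlock.run (findStart.run s₂) = s₃ at *
    generalize (findStart.run s₂).real 5 0 0 = y₀ at *
    have e29 : (nextResidue.run s₃).nat 29 = s₃.nat 29 := nat_run (by decide) _
    have e30 : (nextResidue.run s₃).nat 30 = s₃.nat 30 := nat_run (by decide) _
    refine ⟨?_, fun v => ?_, hnext, fun v i' hi' => by rw [e30, f3 v i' hi', h4 v i' hi']⟩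
    · rw [e29]
      refine hP.succ (y₀ := y₀) hD₀ hstart fun v => ⟨fun h => ?_, fun h => ?_⟩
      · rw [f1, if_pos h]
      · rw [f1, if_neg h]
    · rw [e29, e30, f1, f2]
      split_ifs with h
      · intro _
        rw [Nat.add_sub_cancel]
      · exact h2 v

theorem markResidues_run (hs : Loaded I x s) (v : Fin n) (hv : s.nat 20 0 0 = v) (r : ℕ)
    (hr : s.nat 17 r 0 = 0) :
    (markResidues.run s).nat 17 r 0 = 1 ↔
      ∃ i ∈ (Finset.univ : Finset (Fin m)), s.nat 30 v i = r := by
  have := run_loop_fin (n := m) (s₀ := s) (a := 21) (N := .dim) hs.dim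
    (p := setEntry 17 (.read 30 (var 20) (var 21)) (.lit 1))
    (fun t s' => s'.nat 17 r 0 = 1 ↔ ∃ i : Fin m, (i : ℕ) < t ∧ s.nat 30 v i = r)
    (by
      simp only [hr, zero_ne_one, false_iff]
      rintro ⟨u, hu, -⟩
      omega) ?_
  · refine this.trans ⟨fun ⟨i, _, h⟩ => ⟨i, Finset.mem_univ _, h⟩, fun ⟨i, _, h⟩ => ⟨i, i.2, h⟩⟩
  · intro i s' hA hi hI
    have e30 := hA.nat 30 (by decide)
    have e20 : s'.nat 20 0 0 = v := by rw [hA.nat 20 (by decide)]; exact hv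
    simp only [run_setEntry, NatExp.eval, eval_var, e20, e30, hi, Memory.nat_writeNat, true_and,
      and_true]
    split_ifs with h
    · simp only [true_iff]
      exact ⟨i, by omega, h.symm⟩
    · rw [hI]
      refine ⟨fun ⟨i', h1, h2⟩ => ⟨i', by omega, h2⟩, fun ⟨i', h1, h2⟩ => ⟨i', ?_, h2⟩⟩
      have : i' ≠ i := by
        rintro rfl
        exact h h2.symm
      have := Fin.val_ne_of_ne this
      omega

theorem colourLp_run (hs : Loaded I x s) (hD : s.real 2 0 0 = D) (hD₀ : 0 ≤ D) :
    ∃ β : Fin m → Fin n → ℕ, (∀ i, IsBlocking D (fun v => x v i) (β i)) ∧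
      ∀ v : Fin n, (∀ i, β i v % (m + 1) ≠ (colourLp.run s).nat 10 v 0) ∧
        (colourLp.run s).nat 10 v 0 ≤ m := by
  unfold colourLp
  simp only [run_block_cons, run_block_nil]
  have hβ := (run_loop_each (n := m) (s₀ := s) (a := 20) (N := .dim) (p := blocks) hs.dim
    (fun _ => True)
    (fun i s' => ∃ β : Fin n → ℕ, IsBlocking D (fun v => x v i) β ∧
      ∀ v : Fin n, s'.nat 30 v i = β v % (m + 1)) trivial (by
    intro i s' hA hi _
    obtain ⟨h1, h2⟩ := blocks_run (hs.agree hA)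
      (by rw [hA.real 2 (by decide)]; exact hD) hD₀ i hi
    refine ⟨trivial, h1, fun i' hlt ⟨β, hb, hv⟩ => ⟨β, hb, fun v => ?_⟩⟩
    rw [h2 v i' hlt.ne, hv v])).2
  have hl₁ : Loaded I x ((loop 20 .dim blocks).run s) := hs.run
  generalize (loop 20 .dim blocks).run s = s₁ at *
  choose β hblock hres using hβ
  refine ⟨β, hblock, (run_loop_each (n := n) (s₀ := s₁) (a := 20) (N := .pts)
    (p := block [clearMarks, markResidues, leastUnmarked, setEntry 10 (var 20) (var 16)])
    hl₁.pts (fun _ => True) (fun v s' => (∀ i, β i v % (m + 1) ≠ s'.nat 10 v 0) ∧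
      s'.nat 10 v 0 ≤ m) trivial ?_).2⟩
  intro v s₂ hA hv _
  simp only [run_block_cons, run_block_nil]
  have hl₂ : Loaded I x s₂ := hl₁.agree hA
  have hclear := clearMarks_run hl₂
  have hl₃ : Loaded I x (clearMarks.run s₂) := hl₂.run
  have hv₃ : (clearMarks.run s₂).nat 20 0 0 = v := by rw [nat_run (by decide)]; exact hv
  have h30 : (clearMarks.run s₂).nat 30 = s₁.nat 30 := by
    rw [nat_run (by decide), hA.nat 30 (by decide)]
  have h10₃ : (clearMarks.run s₂).nat 10 = s₂.nat 10 := nat_run (by decide) _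
  generalize clearMarks.run s₂ = s₃ at *
  have hmark : ∀ r < n + m + 1, (markResidues.run s₃).nat 17 r 0 = 1 ↔
      ∃ i ∈ (Finset.univ : Finset (Fin m)), β i v % (m + 1) = r := by
    intro r hr
    have := markResidues_run hl₃ v hv₃ r (hclear r hr)
    rw [h30] at this
    simpa only [hres] using this
  have hl₄ : Loaded I x (markResidues.run s₃) := hl₃.run
  have hv₄ : (markResidues.run s₃).nat 20 0 0 = v := by rw [nat_run (by decide)]; exact hv₃
  have h10₄ : (markResidues.run s₃).nat 10 = s₂.nat 10 := by rw [nat_run (by decide), h10₃]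
  generalize markResidues.run s₃ = s₄ at *
  obtain ⟨k1, k2⟩ := leastUnmarked_of_marks hl₄ Finset.univ (fun i => β i v % (m + 1))
    (by simp) hmark
  rw [Finset.card_univ, Fintype.card_fin] at k2
  have hv₅ : (leastUnmarked.run s₄).nat 20 0 0 = v := by rw [nat_run (by decide)]; exact hv₄
  have h10₅ : (leastUnmarked.run s₄).nat 10 = s₂.nat 10 := by rw [nat_run (by decide), h10₄]
  generalize leastUnmarked.run s₄ = s₅ at *
  have hself : ((setEntry 10 (var 20) (var 16)).run s₅).nat 10 v 0 = s₅.nat 16 0 0 := by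
    simp [hv₅]
  rw [hself]
  refine ⟨trivial, ⟨fun i => k1 i (Finset.mem_univ i), k2⟩, fun w hw h => ?_⟩
  have hne : ((setEntry 10 (var 20) (var 16)).run s₅).nat 10 w 0 = s₂.nat 10 w 0 := by
    simp [hv₅, Fin.val_inj, hw.ne, h10₅]
  rw [hne]
  exact h

/-- The colouring procedure for `L_p`-metrics leads to the approximation factor `O(d ^ (2 + 1 / p))`. -/
theorem colours_lp (p : ENNReal) [Fact (1 ≤ p)] {d : ℕ} (hd : 1 ≤ d) (I : Instance n)
    (x : Fin n → PiLp p (fun _ : Fin d => ℝ)) (hx : ∀ u v, I.dist u v = dist (x u) (x v)) :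
    Colours colourLp I (fun v i => x v i) (40 * (d : ℝ) ^ (2 + (p⁻¹).toReal)) := by
  intro s D S hs hD hk
  obtain ⟨β, hβ, hcol⟩ := colourLp_run hs.loaded hs.radius hD
  refine ⟨fun c _ => ?_, d + 1, (d : ℝ) ^ (p⁻¹).toReal * (4 * (d + 1) * D),
    Instance.isColouring_of_blocking hD hβ (fun v i => (hcol v).1 i) (fun v => (hcol v).2) ?_ ?_, ?_⟩
  · have := (hcol c).2
    omega
  · intro u v i
    rw [hx, dist_eq_norm]
    simpa using PiLp.norm_apply_le (x u - x v) i
  · intro u v r hr hle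
    have h1 := (PiLp.antilipschitzWith_ofLp p (fun _ : Fin d => ℝ)).le_mul_dist (x u) (x v)
    have h2 : dist (x u).ofLp (x v).ofLp ≤ r := (dist_pi_le_iff hr).2 fun i => by
      rw [Real.dist_eq]; exact hle i
    rw [hx]
    refine h1.trans ?_
    rw [Fintype.card_fin, one_div]
    push_cast
    exact mul_le_mul_of_nonneg_left h2 (by positivity)
  · have hd1 : (1 : ℝ) ≤ d := by exact_mod_cast hd
    have hd0 : (0 : ℝ) < d := by linarith
    have hP : (1 : ℝ) ≤ (d : ℝ) ^ (p⁻¹).toReal := Real.one_le_rpow hd1 ENNReal.toReal_nonneg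
    rw [Real.rpow_add hd0, Real.rpow_two]
    push_cast
    generalize (d : ℝ) ^ (p⁻¹).toReal = P at *
    generalize (d : ℝ) = d at *
    have e : 2 * ((d + 1) * (P * (4 * (d + 1) * D) + 2 * D)) =
        (2 * (d + 1)) * (P * (4 * (d + 1)) + 2) * D := by ring
    rw [e]
    refine mul_le_mul_of_nonneg_right ?_ hD
    have h1 : P * (4 * (d + 1)) + 2 ≤ 10 * (d * P) := by nlinarith [mul_nonneg hd0.le (sub_nonneg.2 hP)]
    calc 2 * (d + 1) * (P * (4 * (d + 1)) + 2) ≤ (4 * d) * (10 * (d * P)) :=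
          mul_le_mul (by linarith) h1 (by positivity) (by positivity)
      _ = 40 * (d ^ 2 * P) := by ring

end Code

end ConnectedClustering

open ConnectedClustering in
theorem mainTheorem1 (obj : Objective) :
    -- general metrics: factor `O(log² k)`
    (∃ (C : ℝ) (prog : Program) (P : Polynomial ℕ), ∀ (n : ℕ) (I : Instance n),
      I.ApproximatedBy obj (C * (1 + Real.log I.k) ^ 2) prog I.input (P.eval n)) ∧
    -- metrics of doubling dimension `dim`: factor `O(2 ^ (3 * dim))`
    (∃ (C : ℝ) (prog : Program) (P : Polynomial ℕ), ∀ (n : ℕ) (I : Instance n),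
      I.ApproximatedBy obj (C * 2 ^ (3 * doublingDim I.dist)) prog I.input (P.eval n)) ∧
    -- `L_p`-metrics in `ℝ^d`: factor `O(d ^ (2 + 1 / p))`
    (∃ (C : ℝ) (prog : Program) (P : Polynomial ℕ), ∀ (p : ENNReal) [Fact (1 ≤ p)] (d : ℕ),
      1 ≤ d → ∀ (n : ℕ) (I : Instance n) (x : Fin n → PiLp p (fun _ : Fin d => ℝ)),
      (∀ u v, I.dist u v = dist (x u) (x v)) →
      I.ApproximatedBy obj (C * (d : ℝ) ^ (2 + (p⁻¹).toReal)) prog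
        (I.inputWithCoordinates (fun v i => x v i)) (P.eval (n + d))) :=
  ⟨⟨32, (Code.pipeline Code.colourGeneral).compile, _, fun _ I =>
      approximatedBy_pipeline obj I (m := 0) _ rfl (by positivity) (Code.colours_general I _)⟩,
    ⟨24, (Code.pipeline Code.colourDoubling).compile, _, fun _ I =>
      approximatedBy_pipeline obj I (m := 0) _ rfl (by positivity) (Code.colours_doubling I _)⟩,
    ⟨40, (Code.pipeline Code.colourLp).compile, _, fun p _ _ hd _ I x hx =>
      approximatedBy_pipeline obj I _ rfl (by positivity) (Code.colours_lp p hd I x hx)⟩⟩
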